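/- Write $\mathbb{R}^{d+1}_+=\{(x,t)\in\mathbb{R}^d\times\mathbb{R}: t>0\}$. For a vector field $A=(A_1,\dots,A_{d+1})\in C^1(\overline{\mathbb{R}^{d+1}_+},\mathbb{R}^{d+1})$ let $dA$ be its exterior derivative ($A$ being regarded as a $1$-form), and let $A^{\shortparallel}(x)=(A_1,\dots,A_d)(x,0)$ for $x\in\mathbb{R}^d$. For $1<p<\infty$ let $W^{1,p}_A(\mathbb{R}^{d+1}_+,\mathbb{C})$ be the space of $U\in W^{1,1}_{\mathrm{loc}}(\mathbb{R}^{d+1}_+,\mathbb{C})$ such that $$\|U\|_{W^{1,p}_A}^p=\int_{\mathbb{R}^{d+1}_+}|U|^p+|\nabla_A U|^p<\infty,\qquad \nabla_A U=\nabla U+iAU,$$ where $\nabla U$ is the weak gradient. For $0<s<1$ let $W^{s,p}_{A^{\shortparallel}}(\mathbb{R}^d,\mathbb{C})$ be the space of $u\in L^p(\mathbb{R}^d,\mathbb{C})$ with $\|u\|_{W^{s,p}_{A^\shortparallel}}^p=\|u\|_{L^p}^p+|u|_{W^{s,p}_{A^{\shortparallel}}}^p<\infty$, where $$|u|_{W^{s,p}_{A^{\shortparallel}}}^p=\iint_{\mathbb{R}^d\times\mathbb{R}^d}\frac{\bigl|e^{i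 I(x,y)}u(y)-u(x)\bigr|^p}{|y-x|^{d+sp}}\,dx\,dy,\qquad I(x,y)=\int_0^1A^{\shortparallel}((1-t)x+ty)\cdot(y-x)\,dt.$$ **Theorem.** Let $d\ge 1$ and $1<p<\infty$. There is a constant $C>0$ depending only on $d$ and $p$ such that the following holds for every $A\in C^1(\overline{\mathbb{R}^{d+1}_+},\mathbb{R}^{d+1})$ with $dA\in L^\infty(\mathbb{R}^{d+1}_+)$. 1. There is a unique continuous linear map $\operatorname{Tr}:W^{1,p}_A(\mathbb{R}^{d+1}_+,\mathbb{C})\to W^{1-1/p,p}_{A^{\shortparallel}}(\mathbb{R}^d,\mathbb{C})$ such that $\operatorname{Tr}U=U(\cdot,0)$ for every $U\in C^1_c(\overline{\mathbb{R}^{d+1}_+},\mathbb{C})$. It is surjective. 2. For every $\beta\ge 0$ with $\|dA\|_{L^\infty(\mathbb{R}^{d+1}_+)}\le\beta$ and every $U\in W^{1,p}_A(\mathbb{R}^{d+1}_+,\mathbb{C})$, the trace $u=\operatorname{Tr}U$ satisfies $$|u|_{W^{1-1/p,p}_{A^{\shortparallel}}(\mathbb{R}^d)}+\beta^{\frac12-\frac1{2p}}\|u\|_{L^p(\mathbb{R}^d)}\le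 C\bigl(\|\nabla_AU\|_{L^p(\mathbb{R}^{d+1}_+)}+\beta^{\frac12}\|U\|_{L^p(\mathbb{R}^{d+1}_+)}\bigr).$$ 3. For every $\beta>0$ with $\|dA\|_{L^\infty(\mathbb{R}^{d+1}_+)}\le\beta$ there is a continuous linear map $\operatorname{Ext}:W^{1-1/p,p}_{A^{\shortparallel}}(\mathbb{R}^d,\mathbb{C})\to W^{1,p}_A(\mathbb{R}^{d+1}_+,\mathbb{C})$ such that $\operatorname{Tr}\circ\operatorname{Ext}$ is the identity and, for every $u\in W^{1-1/p,p}_{A^{\shortparallel}}(\mathbb{R}^d,\mathbb{C})$, the function $U=\operatorname{Ext}u$ satisfies $$\|\nabla_AU\|_{L^p(\mathbb{R}^{d+1}_+)}+\beta^{\frac12}\|U\|_{L^p(\mathbb{R}^{d+1}_+)}\le C\bigl(|u|_{W^{1-1/p,p}_{A^{\shortparallel}}(\mathbb{R}^d)}+\beta^{\frac12-\frac1{2p}}\|u\|_{L^p(\mathbb{R}^d)}\bigr).$$ -/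

import Mathlib

open MeasureTheory Set
open scoped ENNReal ContDiff

noncomputable section

namespace MagneticTrace

/-! ### Geometry of the half-space -/

/-- The open half-space of points of `ℝ^(d+1)` with positive last coordinate. -/
def halfSpace (d : ℕ) : Set (EuclideanSpace ℝ (Fin (d + 1))) :=
  {X | 0 < X (Fin.last d)}

/-- The closed half-space of points of `ℝ^(d+1)` with nonnegative last coordinate. -/
def closedHalfSpace (d : ℕ) : Set (EuclideanSpace ℝ (Fin (d + 1))) :=
  {X | 0 ≤ X (Fin.last d)}

/-- The point `(x, 0)` of `ℝ^(d+1)`, for `x` in `ℝ^d`. -/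
def boundaryPoint {d : ℕ} (x : EuclideanSpace ℝ (Fin d)) : EuclideanSpace ℝ (Fin (d + 1)) :=
  WithLp.toLp 2 (Fin.snoc (α := fun _ => ℝ) x.ofLp 0)

/-- `f` is of class `C¹` up to the boundary on the closed half-space, and vanishes outside
a compact set. -/
def IsC1c {d : ℕ} (f : EuclideanSpace ℝ (Fin (d + 1)) → ℂ) : Prop :=
  ContDiffOn ℝ 1 f (closedHalfSpace d) ∧
    ∃ K : Set (EuclideanSpace ℝ (Fin (d + 1))), IsCompact K ∧
      ∀ X ∈ closedHalfSpace d \ K, f X = 0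

/-! ### Magnetic potentials -/

/-- The vector field `A` seen as a differential form of degree one, `v ↦ A(X) · v`. -/
def oneForm {n : ℕ} (A : EuclideanSpace ℝ (Fin n) → EuclideanSpace ℝ (Fin n))
    (X : EuclideanSpace ℝ (Fin n)) : EuclideanSpace ℝ (Fin n) [⋀^Fin 1]→L[ℝ] ℝ :=
  ContinuousAlternatingMap.ofSubsingleton ℝ (EuclideanSpace ℝ (Fin n)) ℝ (0 : Fin 1)
    (innerSL ℝ (A X))

/-- The magnetic field `dA`, the exterior derivative of `A`. -/
def magneticField {n : ℕ} (A : EuclideanSpace ℝ (Fin n) → EuclideanSpace ℝ (Fin n)) :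
    EuclideanSpace ℝ (Fin n) → EuclideanSpace ℝ (Fin n) [⋀^Fin 2]→L[ℝ] ℝ :=
  extDeriv (oneForm A)

/-- The norm of `dA` in `L^∞` of the open half-space. -/
def magneticFieldNorm {d : ℕ}
    (A : EuclideanSpace ℝ (Fin (d + 1)) → EuclideanSpace ℝ (Fin (d + 1))) : ℝ≥0∞ :=
  eLpNorm (magneticField A) ⊤ (volume.restrict (halfSpace d))

/-- The tangential part of `A` on the boundary, `x ↦ (A_1, ..., A_d)(x, 0)`. -/
def tangential {d : ℕ}
    (A : EuclideanSpace ℝ (Fin (d + 1)) → EuclideanSpace ℝ (Fin (d + 1)))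
    (x : EuclideanSpace ℝ (Fin d)) : EuclideanSpace ℝ (Fin d) :=
  WithLp.toLp 2 (fun j => A (boundaryPoint x) j.castSucc)

/-- The potential `∫_0^1 a((1 - t) x + t y) · (y - x) dt`. -/
def intPot {n : ℕ} (a : EuclideanSpace ℝ (Fin n) → EuclideanSpace ℝ (Fin n))
    (x y : EuclideanSpace ℝ (Fin n)) : ℝ :=
  ∫ t in (0 : ℝ)..1, inner ℝ (a ((1 - t) • x + t • y)) (y - x)

theorem intPot_self {n : ℕ} (a : EuclideanSpace ℝ (Fin n) → EuclideanSpace ℝ (Fin n))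
    (x : EuclideanSpace ℝ (Fin n)) : intPot a x x = 0 := by
  simp [intPot]

instance factOneLeOfReal {p : ℝ} [hp : Fact (1 ≤ p)] : Fact (1 ≤ ENNReal.ofReal p) :=
  ⟨by simpa using hp.out⟩

/-! ### The first-order magnetic Sobolev space -/

/-- `V` is the weak gradient of `U` in `Ω`, both being locally integrable in `Ω`
(so that `U` belongs to `W^{1,1}_loc(Ω)`). -/
def HasWeakGradient {n : ℕ} (Ω : Set (EuclideanSpace ℝ (Fin n)))
    (U : EuclideanSpace ℝ (Fin n) → ℂ)
    (V : EuclideanSpace ℝ (Fin n) → EuclideanSpace ℂ (Fin n)) : Prop :=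
  LocallyIntegrableOn U Ω ∧ LocallyIntegrableOn V Ω ∧
    ∀ φ : EuclideanSpace ℝ (Fin n) → ℝ, ContDiff ℝ ∞ φ → HasCompactSupport φ →
      tsupport φ ⊆ Ω → ∀ j : Fin n,
        ∫ X in Ω, fderiv ℝ φ X (EuclideanSpace.single j 1) • U X
          = - ∫ X in Ω, φ X • V X j

/-- The covariant gradient `V + i A U`, where `V` is the gradient of `U`. -/
def covGradOf {n : ℕ} (A : EuclideanSpace ℝ (Fin n) → EuclideanSpace ℝ (Fin n))
    (U : EuclideanSpace ℝ (Fin n) → ℂ)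
    (V : EuclideanSpace ℝ (Fin n) → EuclideanSpace ℂ (Fin n))
    (X : EuclideanSpace ℝ (Fin n)) : EuclideanSpace ℂ (Fin n) :=
  V X + WithLp.toLp 2 (fun j => Complex.I * (A X j : ℂ) * U X)

theorem integrableOn_smul_of_tsupport {n : ℕ} {Ω : Set (EuclideanSpace ℝ (Fin n))}
    {F : Type*} [NormedAddCommGroup F] [NormedSpace ℝ F]
    {g : EuclideanSpace ℝ (Fin n) → F} (hg : LocallyIntegrableOn g Ω)
    {ψ : EuclideanSpace ℝ (Fin n) → ℝ} (hψ : Continuous ψ) (hc : HasCompactSupport ψ)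
    (hs : tsupport ψ ⊆ Ω) : IntegrableOn (fun X => ψ X • g X) Ω := by
  have h1 : IntegrableOn (fun X => ψ X • g X) (tsupport ψ) :=
    (hg.integrableOn_compact_subset hs hc).continuousOn_smul hψ.continuousOn hc
  have h2 : Integrable (fun X => ψ X • g X) := by
    refine (integrableOn_iff_integrable_of_support_subset ?_).1 h1
    intro X hX
    apply subset_tsupport
    intro h0
    exact hX (by simp [h0])
  exact h2.integrableOn

theorem continuous_fderiv_apply' {n : ℕ} {φ : EuclideanSpace ℝ (Fin n) → ℝ}
    (hφ : ContDiff ℝ ∞ φ) (v : EuclideanSpace ℝ (Fin n)) :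
    Continuous fun X => fderiv ℝ φ X v :=
  (hφ.continuous_fderiv (by simp)).clm_apply continuous_const

theorem locallyIntegrableOn_coord {n : ℕ} {Ω : Set (EuclideanSpace ℝ (Fin n))}
    {V : EuclideanSpace ℝ (Fin n) → EuclideanSpace ℂ (Fin n)} (hV : LocallyIntegrableOn V Ω)
    (j : Fin n) : LocallyIntegrableOn (fun X => V X j) Ω := by
  intro X hX
  obtain ⟨s, hs, h⟩ := hV X hX
  exact ⟨s, hs, (EuclideanSpace.proj (𝕜 := ℂ) j : EuclideanSpace ℂ (Fin n) →L[ℂ] ℂ).integrable_comp h⟩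

namespace HasWeakGradient

variable {n : ℕ} {Ω : Set (EuclideanSpace ℝ (Fin n))}

theorem add {U U' : EuclideanSpace ℝ (Fin n) → ℂ}
    {V V' : EuclideanSpace ℝ (Fin n) → EuclideanSpace ℂ (Fin n)}
    (h : HasWeakGradient Ω U V) (h' : HasWeakGradient Ω U' V') :
    HasWeakGradient Ω (U + U') (V + V') := by
  refine ⟨h.1.add h'.1, h.2.1.add h'.2.1, fun φ h1 h2 h3 j => ?_⟩
  have e1 := h.2.2 φ h1 h2 h3 j
  have e2 := h'.2.2 φ h1 h2 h3 j
  have hc : HasCompactSupport fun X => fderiv ℝ φ X (EuclideanSpace.single j 1) :=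
    h2.fderiv_apply ℝ _
  have hs : tsupport (fun X => fderiv ℝ φ X (EuclideanSpace.single j 1)) ⊆ Ω :=
    (tsupport_fderiv_apply_subset ℝ _).trans h3
  have hd := continuous_fderiv_apply' h1 (EuclideanSpace.single j 1)
  simp only [Pi.add_apply, PiLp.add_apply, smul_add]
  rw [integral_add (integrableOn_smul_of_tsupport h.1 hd hc hs)
      (integrableOn_smul_of_tsupport h'.1 hd hc hs),
    integral_add
      (integrableOn_smul_of_tsupport (locallyIntegrableOn_coord h.2.1 j) h1.continuous h2 h3)
      (integrableOn_smul_of_tsupport (locallyIntegrableOn_coord h'.2.1 j) h1.continuous h2 h3),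
    e1, e2]
  ring

theorem smul {U : EuclideanSpace ℝ (Fin n) → ℂ}
    {V : EuclideanSpace ℝ (Fin n) → EuclideanSpace ℂ (Fin n)}
    (h : HasWeakGradient Ω U V) (c : ℂ) : HasWeakGradient Ω (c • U) (c • V) := by
  refine ⟨h.1.smul c, h.2.1.smul c, fun φ h1 h2 h3 j => ?_⟩
  have e1 := h.2.2 φ h1 h2 h3 j
  simp only [Pi.smul_apply, PiLp.smul_apply, smul_comm _ c, integral_smul, e1, smul_neg]

theorem zero : HasWeakGradient Ω 0 0 :=
  ⟨locallyIntegrableOn_zero, locallyIntegrableOn_zero, by simp⟩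

theorem congr {U U' : EuclideanSpace ℝ (Fin n) → ℂ}
    {V : EuclideanSpace ℝ (Fin n) → EuclideanSpace ℂ (Fin n)}
    (h : HasWeakGradient Ω U V) (e : U =ᵐ[volume.restrict Ω] U') : HasWeakGradient Ω U' V := by
  refine ⟨h.1.congr e, h.2.1, fun φ h1 h2 h3 j => ?_⟩
  rw [← h.2.2 φ h1 h2 h3 j]
  refine integral_congr_ae ?_
  filter_upwards [e] with X hX
  rw [hX]

/-- The weak gradient is unique. -/
theorem unique (hΩ : IsOpen Ω) {U : EuclideanSpace ℝ (Fin n) → ℂ}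
    {V V' : EuclideanSpace ℝ (Fin n) → EuclideanSpace ℂ (Fin n)}
    (h : HasWeakGradient Ω U V) (h' : HasWeakGradient Ω U V') :
    V =ᵐ[volume.restrict Ω] V' := by
  have key : ∀ j : Fin n, ∀ᵐ X, X ∈ Ω → V X j - V' X j = 0 := by
    intro j
    have l1 := locallyIntegrableOn_coord h.2.1 j
    have l2 := locallyIntegrableOn_coord h'.2.1 j
    refine hΩ.ae_eq_zero_of_integral_contDiff_smul_eq_zero (l1.sub l2) ?_
    intro φ h1 h2 h3
    have e : ∫ X in Ω, φ X • V X j = ∫ X in Ω, φ X • V' X j :=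
      neg_injective ((h.2.2 φ h1 h2 h3 j).symm.trans (h'.2.2 φ h1 h2 h3 j))
    have : ∫ X, φ X • (V X j - V' X j) = ∫ X in Ω, φ X • (V X j - V' X j) := by
      refine (setIntegral_eq_integral_of_forall_compl_eq_zero ?_).symm
      intro X hX
      rw [image_eq_zero_of_notMem_tsupport (fun hh => hX (h3 hh)), zero_smul]
    refine this.trans ?_
    simp only [smul_sub]
    rw [integral_sub (integrableOn_smul_of_tsupport l1 h1.continuous h2 h3)
      (integrableOn_smul_of_tsupport l2 h1.continuous h2 h3), e, sub_self]
  rw [Filter.EventuallyEq, ae_restrict_iff' hΩ.measurableSet]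
  filter_upwards [ae_all_iff.2 key] with X hX hXΩ
  ext j
  exact sub_eq_zero.1 (hX j hXΩ)

end HasWeakGradient

theorem isOpen_halfSpace (d : ℕ) : IsOpen (halfSpace d) :=
  isOpen_lt continuous_const (by fun_prop)

theorem covGradOf_add {n : ℕ} (A : EuclideanSpace ℝ (Fin n) → EuclideanSpace ℝ (Fin n))
    (U U' : EuclideanSpace ℝ (Fin n) → ℂ)
    (V V' : EuclideanSpace ℝ (Fin n) → EuclideanSpace ℂ (Fin n)) :
    covGradOf A (U + U') (V + V') = covGradOf A U V + covGradOf A U' V' := by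
  funext X
  ext j
  simp [covGradOf]
  ring

theorem covGradOf_smul {n : ℕ} (A : EuclideanSpace ℝ (Fin n) → EuclideanSpace ℝ (Fin n))
    (c : ℂ) (U : EuclideanSpace ℝ (Fin n) → ℂ)
    (V : EuclideanSpace ℝ (Fin n) → EuclideanSpace ℂ (Fin n)) :
    covGradOf A (c • U) (c • V) = c • covGradOf A U V := by
  funext X
  ext j
  simp [covGradOf]
  ring

theorem covGradOf_congr {n : ℕ} {μ : Measure (EuclideanSpace ℝ (Fin n))}
    (A : EuclideanSpace ℝ (Fin n) → EuclideanSpace ℝ (Fin n))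
    {U U' : EuclideanSpace ℝ (Fin n) → ℂ}
    {V V' : EuclideanSpace ℝ (Fin n) → EuclideanSpace ℂ (Fin n)}
    (hU : U =ᵐ[μ] U') (hV : V =ᵐ[μ] V') : covGradOf A U V =ᵐ[μ] covGradOf A U' V' := by
  filter_upwards [hU, hV] with X h1 h2
  simp [covGradOf, h1, h2]

/-- The set of (classes of) functions `U` in `L^p` of the half-space that have a weak gradient
`∇U` with `∇U + i A U` in `L^p`. -/
def sobolevSubmodule {d : ℕ}
    (A : EuclideanSpace ℝ (Fin (d + 1)) → EuclideanSpace ℝ (Fin (d + 1))) (p : ℝ) :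
    Submodule ℂ (Lp ℂ (ENNReal.ofReal p) (volume.restrict (halfSpace d))) where
  carrier := {U | ∃ V, HasWeakGradient (halfSpace d) U V ∧
    MemLp (covGradOf A U V) (ENNReal.ofReal p) (volume.restrict (halfSpace d))}
  add_mem' := by
    rintro U U' ⟨V, h1, h2⟩ ⟨V', h1', h2'⟩
    have e := (Lp.coeFn_add U U').symm
    refine ⟨V + V', (h1.add h1').congr e, ?_⟩
    refine (memLp_congr_ae (covGradOf_congr A e (Filter.EventuallyEq.refl _ _))).1 ?_
    rw [covGradOf_add]
    exact h2.add h2'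
  zero_mem' := by
    have e := (Lp.coeFn_zero ℂ (ENNReal.ofReal p) (volume.restrict (halfSpace d))).symm
    refine ⟨0, HasWeakGradient.zero.congr e, ?_⟩
    refine (memLp_congr_ae (covGradOf_congr A e (Filter.EventuallyEq.refl _ _))).1 ?_
    have : covGradOf A 0 0 = 0 := by
      funext X
      ext j
      simp [covGradOf]
    rw [this]
    exact MemLp.zero
  smul_mem' := by
    rintro c U ⟨V, h1, h2⟩
    have e := (Lp.coeFn_smul c U).symm
    refine ⟨c • V, (h1.smul c).congr e, ?_⟩
    refine (memLp_congr_ae (covGradOf_congr A e (Filter.EventuallyEq.refl _ _))).1 ?_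
    rw [covGradOf_smul]
    exact h2.const_smul c

/-- The magnetic Sobolev space `W^{1,p}_A` of the half-space. -/
def MagneticSobolev {d : ℕ}
    (A : EuclideanSpace ℝ (Fin (d + 1)) → EuclideanSpace ℝ (Fin (d + 1))) (p : ℝ) : Type :=
  sobolevSubmodule A p

namespace MagneticSobolev

variable {d : ℕ} {A : EuclideanSpace ℝ (Fin (d + 1)) → EuclideanSpace ℝ (Fin (d + 1))} {p : ℝ}

instance instAddCommGroup : AddCommGroup (MagneticSobolev A p) :=
  inferInstanceAs (AddCommGroup (sobolevSubmodule A p))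

instance instModule : Module ℂ (MagneticSobolev A p) :=
  inferInstanceAs (Module ℂ (sobolevSubmodule A p))

/-- The element of `L^p` underlying an element of `W^{1,p}_A`. -/
def toLp : MagneticSobolev A p →ₗ[ℂ]
    Lp ℂ (ENNReal.ofReal p) (volume.restrict (halfSpace d)) :=
  (sobolevSubmodule A p).subtype

theorem toLp_injective : Function.Injective (toLp : MagneticSobolev A p →ₗ[ℂ] _) :=
  Subtype.val_injective

/-- The weak gradient `∇U`, defined up to almost everywhere equality. -/
def weakGrad (U : MagneticSobolev A p) :
    EuclideanSpace ℝ (Fin (d + 1)) → EuclideanSpace ℂ (Fin (d + 1)) :=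
  U.2.choose

theorem hasWeakGradient (U : MagneticSobolev A p) :
    HasWeakGradient (halfSpace d) (toLp U) (weakGrad U) :=
  U.2.choose_spec.1

theorem memLp_covGradOf (U : MagneticSobolev A p) :
    MemLp (covGradOf A (toLp U) (weakGrad U)) (ENNReal.ofReal p)
      (volume.restrict (halfSpace d)) :=
  U.2.choose_spec.2

/-- The weak covariant gradient `∇_A U = ∇U + i A U`, as an element of `L^p`. -/
def covGrad : MagneticSobolev A p →ₗ[ℂ]
    Lp (EuclideanSpace ℂ (Fin (d + 1))) (ENNReal.ofReal p) (volume.restrict (halfSpace d)) where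
  toFun U := (memLp_covGradOf U).toLp _
  map_add' U U' := by
    rw [← MemLp.toLp_add, MemLp.toLp_eq_toLp_iff, ← covGradOf_add]
    have e : (toLp (U + U') : EuclideanSpace ℝ (Fin (d + 1)) → ℂ)
        =ᵐ[volume.restrict (halfSpace d)] toLp U + toLp U' := by
      rw [map_add]
      exact Lp.coeFn_add _ _
    refine covGradOf_congr A e ?_
    exact ((hasWeakGradient (U + U')).congr e).unique
      (isOpen_halfSpace d) ((hasWeakGradient U).add (hasWeakGradient U'))
  map_smul' c U := by
    rw [RingHom.id_apply, ← MemLp.toLp_const_smul, MemLp.toLp_eq_toLp_iff, ← covGradOf_smul]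
    have e : (toLp (c • U) : EuclideanSpace ℝ (Fin (d + 1)) → ℂ)
        =ᵐ[volume.restrict (halfSpace d)] c • toLp U := by
      rw [map_smul]
      exact Lp.coeFn_smul _ _
    refine covGradOf_congr A e ?_
    exact ((hasWeakGradient (c • U)).congr e).unique
      (isOpen_halfSpace d) ((hasWeakGradient U).smul c)

/-- `U ↦ (U, ∇_A U)`, with values in the `ℓ^p` product of two `L^p` spaces. -/
def graphMap : MagneticSobolev A p →ₗ[ℂ]
    WithLp (ENNReal.ofReal p)
      (Lp ℂ (ENNReal.ofReal p) (volume.restrict (halfSpace d)) ×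
        Lp (EuclideanSpace ℂ (Fin (d + 1))) (ENNReal.ofReal p)
          (volume.restrict (halfSpace d))) :=
  (WithLp.linearEquiv (ENNReal.ofReal p) ℂ _).symm.toLinearMap ∘ₗ (toLp.prod covGrad)

theorem graphMap_injective : Function.Injective (graphMap (A := A) (p := p)) := by
  intro U U' h
  apply toLp_injective
  exact congrArg (fun w => w.fst) h

/-- The norm of `W^{1,p}_A` is `(‖U‖_p ^ p + ‖∇_A U‖_p ^ p) ^ (1 / p)`; see `norm_rpow`. -/
instance instNormedAddCommGroup [Fact (1 ≤ p)] : NormedAddCommGroup (MagneticSobolev A p) :=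
  NormedAddCommGroup.induced _ _ (graphMap (A := A) (p := p)) graphMap_injective

instance instNormedSpace [Fact (1 ≤ p)] : NormedSpace ℂ (MagneticSobolev A p) :=
  NormedSpace.induced ℂ _ _ (graphMap (A := A) (p := p))

theorem norm_rpow [hp : Fact (1 ≤ p)] (U : MagneticSobolev A p) :
    ‖U‖ ^ p = ‖toLp U‖ ^ p + ‖covGrad U‖ ^ p := by
  have hp0 : 0 < p := lt_of_lt_of_le one_pos hp.out
  have e : (ENNReal.ofReal p).toReal = p := ENNReal.toReal_ofReal hp0.le
  have h : ‖U‖ = ‖graphMap U‖ := rfl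
  rw [h, WithLp.prod_norm_eq_add (by rw [e]; exact hp0), e, ← Real.rpow_mul (by positivity),
    one_div, inv_mul_cancel₀ hp0.ne', Real.rpow_one]
  rfl

end MagneticSobolev

/-! ### The fractional magnetic Sobolev space -/

/-- `e^{i I(x, y)} u(y) - u(x)`, where `I` is the potential `intPot a`. -/
def covDiff {n : ℕ} (a : EuclideanSpace ℝ (Fin n) → EuclideanSpace ℝ (Fin n))
    (u : EuclideanSpace ℝ (Fin n) → ℂ) (x y : EuclideanSpace ℝ (Fin n)) : ℂ :=
  Complex.exp (Complex.I * (intPot a x y : ℂ)) * u y - u x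

/-- The magnetic Gagliardo seminorm
`(∬ |e^{i I(x, y)} u(y) - u(x)| ^ p / |y - x| ^ (n + s p) dx dy) ^ (1 / p)` on `ℝ^n`. -/
def gagliardo {n : ℕ} (a : EuclideanSpace ℝ (Fin n) → EuclideanSpace ℝ (Fin n)) (s p : ℝ)
    (u : EuclideanSpace ℝ (Fin n) → ℂ) : ℝ≥0∞ :=
  (∫⁻ x, ∫⁻ y, ‖covDiff a u x y‖ₑ ^ p / ‖y - x‖ₑ ^ ((n : ℝ) + s * p)) ^ (1 / p)

/-- The function whose `L^p` norm on `ℝ^n × ℝ^n` is the Gagliardo seminorm. -/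
def diffQuot {n : ℕ} (a : EuclideanSpace ℝ (Fin n) → EuclideanSpace ℝ (Fin n)) (s p : ℝ)
    (u : EuclideanSpace ℝ (Fin n) → ℂ)
    (z : EuclideanSpace ℝ (Fin n) × EuclideanSpace ℝ (Fin n)) : ℂ :=
  covDiff a u z.1 z.2 / ((‖z.2 - z.1‖ ^ ((n : ℝ) / p + s) : ℝ) : ℂ)

section fractional

variable {n : ℕ} {a : EuclideanSpace ℝ (Fin n) → EuclideanSpace ℝ (Fin n)} {s p : ℝ}

theorem enorm_diffQuot_rpow (hp : 0 < p) (u : EuclideanSpace ℝ (Fin n) → ℂ)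
    (x y : EuclideanSpace ℝ (Fin n)) :
    ‖diffQuot a s p u (x, y)‖ₑ ^ p
      = ‖covDiff a u x y‖ₑ ^ p / ‖y - x‖ₑ ^ ((n : ℝ) + s * p) := by
  by_cases h : y = x
  · subst h
    simp [diffQuot, covDiff, intPot_self, hp]
  · have hpos : 0 < ‖y - x‖ := norm_pos_iff.2 (sub_ne_zero.2 h)
    have hpos' : 0 < ‖y - x‖ ^ ((n : ℝ) / p + s) := Real.rpow_pos_of_pos hpos _
    have e1 : ‖diffQuot a s p u (x, y)‖
        = ‖covDiff a u x y‖ / ‖y - x‖ ^ ((n : ℝ) / p + s) := by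
      simp [diffQuot, abs_of_pos hpos']
    rw [← ofReal_norm, e1, ENNReal.ofReal_div_of_pos hpos',
      ENNReal.div_rpow_of_nonneg _ _ hp.le, ofReal_norm, ← ofReal_norm (y - x),
      ENNReal.ofReal_rpow_of_pos hpos, ENNReal.ofReal_rpow_of_pos hpos',
      ← Real.rpow_mul hpos.le]
    congr 3
    field_simp

theorem eLpNorm_diffQuot (hp : 0 < p) {u : EuclideanSpace ℝ (Fin n) → ℂ}
    (hu : AEStronglyMeasurable (diffQuot a s p u) (volume.prod volume)) :
    eLpNorm (diffQuot a s p u) (ENNReal.ofReal p) (volume.prod volume)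
      = gagliardo a s p u := by
  rw [eLpNorm_eq_lintegral_rpow_enorm_toReal (by simpa using hp) (by simp),
    ENNReal.toReal_ofReal hp.le, lintegral_prod _ (hu.enorm.pow_const p), gagliardo]
  simp only [enorm_diffQuot_rpow hp]

theorem diffQuot_congr {u v : EuclideanSpace ℝ (Fin n) → ℂ} (h : u =ᵐ[volume] v) :
    diffQuot a s p u =ᵐ[volume.prod volume] diffQuot a s p v := by
  have h1 : ∀ᵐ z : EuclideanSpace ℝ (Fin n) × EuclideanSpace ℝ (Fin n)
      ∂(volume.prod volume), u z.1 = v z.1 :=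
    Measure.quasiMeasurePreserving_fst.ae h
  have h2 : ∀ᵐ z : EuclideanSpace ℝ (Fin n) × EuclideanSpace ℝ (Fin n)
      ∂(volume.prod volume), u z.2 = v z.2 :=
    Measure.quasiMeasurePreserving_snd.ae h
  filter_upwards [h1, h2] with z e1 e2
  simp [diffQuot, covDiff, e1, e2]

theorem diffQuot_add (u v : EuclideanSpace ℝ (Fin n) → ℂ) :
    diffQuot a s p (u + v) = diffQuot a s p u + diffQuot a s p v := by
  funext z
  simp only [diffQuot, covDiff, Pi.add_apply]
  ring

theorem diffQuot_smul (c : ℂ) (u : EuclideanSpace ℝ (Fin n) → ℂ) :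
    diffQuot a s p (c • u) = c • diffQuot a s p u := by
  funext z
  simp only [diffQuot, covDiff, Pi.smul_apply, smul_eq_mul]
  ring

theorem memLp_diffQuot_iff (hp : 0 < p) {u : EuclideanSpace ℝ (Fin n) → ℂ} :
    MemLp (diffQuot a s p u) (ENNReal.ofReal p) (volume.prod volume) ↔
      AEStronglyMeasurable (diffQuot a s p u) (volume.prod volume) ∧
        gagliardo a s p u < ⊤ := by
  constructor
  · intro h
    exact ⟨h.1, by rw [← eLpNorm_diffQuot hp h.1]; exact h.2⟩
  · rintro ⟨h1, h2⟩
    exact ⟨h1, by rw [eLpNorm_diffQuot hp h1]; exact h2⟩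

end fractional

/-- The set of (classes of) functions `u` in `L^p(ℝ^n)` with finite magnetic Gagliardo seminorm.
The measurability condition is automatic for a continuous `a`; see `mem_fractionalSubmodule`. -/
def fractionalSubmodule {n : ℕ} (a : EuclideanSpace ℝ (Fin n) → EuclideanSpace ℝ (Fin n))
    (s p : ℝ) [hp : Fact (1 ≤ p)] :
    Submodule ℂ (Lp ℂ (ENNReal.ofReal p) (volume : Measure (EuclideanSpace ℝ (Fin n)))) where
  carrier := {u | AEStronglyMeasurable (diffQuot a s p u) (volume.prod volume) ∧
    gagliardo a s p u < ⊤}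
  add_mem' := by
    intro u v hu hv
    have hp0 : 0 < p := lt_of_lt_of_le one_pos hp.out
    refine (memLp_diffQuot_iff hp0).1 ?_
    refine (memLp_congr_ae (diffQuot_congr (Lp.coeFn_add u v))).2 ?_
    rw [diffQuot_add]
    exact ((memLp_diffQuot_iff hp0).2 hu).add ((memLp_diffQuot_iff hp0).2 hv)
  zero_mem' := by
    have hp0 : 0 < p := lt_of_lt_of_le one_pos hp.out
    refine (memLp_diffQuot_iff hp0).1 ?_
    refine (memLp_congr_ae (diffQuot_congr (Lp.coeFn_zero ℂ (ENNReal.ofReal p) volume))).2 ?_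
    have : diffQuot a s p 0 = 0 := by
      funext z
      simp [diffQuot, covDiff]
    rw [this]
    exact MemLp.zero
  smul_mem' := by
    intro c u hu
    have hp0 : 0 < p := lt_of_lt_of_le one_pos hp.out
    refine (memLp_diffQuot_iff hp0).1 ?_
    refine (memLp_congr_ae (diffQuot_congr (Lp.coeFn_smul c u))).2 ?_
    rw [diffQuot_smul]
    exact ((memLp_diffQuot_iff hp0).2 hu).const_smul c

theorem continuous_intPot {n : ℕ} {a : EuclideanSpace ℝ (Fin n) → EuclideanSpace ℝ (Fin n)}
    (ha : Continuous a) :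
    Continuous fun z : EuclideanSpace ℝ (Fin n) × EuclideanSpace ℝ (Fin n) =>
      intPot a z.1 z.2 := by
  unfold intPot
  refine intervalIntegral.continuous_parametric_intervalIntegral_of_continuous' ?_ 0 1
  fun_prop

/-- For a continuous potential, the space consists of the `u` in `L^p` with finite seminorm. -/
theorem mem_fractionalSubmodule {n : ℕ}
    {a : EuclideanSpace ℝ (Fin n) → EuclideanSpace ℝ (Fin n)} (ha : Continuous a)
    {s p : ℝ} [hp : Fact (1 ≤ p)]
    (u : Lp ℂ (ENNReal.ofReal p) (volume : Measure (EuclideanSpace ℝ (Fin n)))) :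
    u ∈ fractionalSubmodule a s p ↔ gagliardo a s p u < ⊤ := by
  refine ⟨fun h => h.2, fun h => ⟨?_, h⟩⟩
  have hu := (Lp.stronglyMeasurable u).measurable
  have h1 := (continuous_intPot ha).measurable
  refine Measurable.aestronglyMeasurable ?_
  unfold diffQuot covDiff
  fun_prop

/-- The fractional magnetic Sobolev space `W^{s,p}_a(ℝ^n)`. -/
def MagneticFractional {n : ℕ} (a : EuclideanSpace ℝ (Fin n) → EuclideanSpace ℝ (Fin n))
    (s p : ℝ) [Fact (1 ≤ p)] : Type :=
  fractionalSubmodule a s p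

namespace MagneticFractional

variable {n : ℕ} {a : EuclideanSpace ℝ (Fin n) → EuclideanSpace ℝ (Fin n)} {s p : ℝ}
  [hp : Fact (1 ≤ p)]

instance instAddCommGroup : AddCommGroup (MagneticFractional a s p) :=
  inferInstanceAs (AddCommGroup (fractionalSubmodule a s p))

instance instModule : Module ℂ (MagneticFractional a s p) :=
  inferInstanceAs (Module ℂ (fractionalSubmodule a s p))

/-- The element of `L^p` underlying an element of `W^{s,p}_a`. -/
def toLp : MagneticFractional a s p →ₗ[ℂ]
    Lp ℂ (ENNReal.ofReal p) (volume : Measure (EuclideanSpace ℝ (Fin n))) :=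
  (fractionalSubmodule a s p).subtype

theorem toLp_injective : Function.Injective (toLp : MagneticFractional a s p →ₗ[ℂ] _) :=
  Subtype.val_injective

/-- The magnetic Gagliardo seminorm of an element of `W^{s,p}_a`, which is finite. -/
def seminorm (u : MagneticFractional a s p) : ℝ :=
  (gagliardo a s p (toLp u)).toReal

theorem memLp_diffQuot (u : MagneticFractional a s p) :
    MemLp (diffQuot a s p (toLp u)) (ENNReal.ofReal p) (volume.prod volume) :=
  (memLp_diffQuot_iff (lt_of_lt_of_le one_pos hp.out)).2 u.2

/-- The difference quotient of `u` as an element of `L^p(ℝ^n × ℝ^n)`. -/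
def quotient : MagneticFractional a s p →ₗ[ℂ]
    Lp ℂ (ENNReal.ofReal p) ((volume : Measure (EuclideanSpace ℝ (Fin n))).prod
      (volume : Measure (EuclideanSpace ℝ (Fin n)))) where
  toFun u := (memLp_diffQuot u).toLp _
  map_add' u v := by
    rw [← MemLp.toLp_add, MemLp.toLp_eq_toLp_iff, ← diffQuot_add]
    refine diffQuot_congr ?_
    rw [map_add]
    exact Lp.coeFn_add _ _
  map_smul' c u := by
    rw [RingHom.id_apply, ← MemLp.toLp_const_smul, MemLp.toLp_eq_toLp_iff, ← diffQuot_smul]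
    refine diffQuot_congr ?_
    rw [map_smul]
    exact Lp.coeFn_smul _ _

theorem norm_quotient (u : MagneticFractional a s p) : ‖quotient u‖ = seminorm u := by
  have h : ‖quotient u‖ = ‖(memLp_diffQuot u).toLp _‖ := rfl
  rw [h, Lp.norm_toLp, eLpNorm_diffQuot (lt_of_lt_of_le one_pos hp.out) (memLp_diffQuot u).1,
    seminorm]

/-- `u` together with its difference quotient, in the `ℓ^p` product of two `L^p` spaces. -/
def graphMap : MagneticFractional a s p →ₗ[ℂ]
    WithLp (ENNReal.ofReal p)
      (Lp ℂ (ENNReal.ofReal p) (volume : Measure (EuclideanSpace ℝ (Fin n))) ×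
        Lp ℂ (ENNReal.ofReal p)
          ((volume : Measure (EuclideanSpace ℝ (Fin n))).prod
      (volume : Measure (EuclideanSpace ℝ (Fin n))))) :=
  (WithLp.linearEquiv (ENNReal.ofReal p) ℂ _).symm.toLinearMap ∘ₗ (toLp.prod quotient)

theorem graphMap_injective : Function.Injective (graphMap (a := a) (s := s) (p := p)) := by
  intro u v h
  apply toLp_injective
  exact congrArg (fun w => w.fst) h

/-- The norm of `W^{s,p}_a` is `(‖u‖_p ^ p + [u] ^ p) ^ (1 / p)`; see `norm_rpow`. -/
instance instNormedAddCommGroup : NormedAddCommGroup (MagneticFractional a s p) :=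
  NormedAddCommGroup.induced _ _ (graphMap (a := a) (s := s) (p := p)) graphMap_injective

instance instNormedSpace : NormedSpace ℂ (MagneticFractional a s p) :=
  NormedSpace.induced ℂ _ _ (graphMap (a := a) (s := s) (p := p))

theorem norm_rpow (u : MagneticFractional a s p) :
    ‖u‖ ^ p = ‖toLp u‖ ^ p + seminorm u ^ p := by
  have hp0 : 0 < p := lt_of_lt_of_le one_pos hp.out
  have e : (ENNReal.ofReal p).toReal = p := ENNReal.toReal_ofReal hp0.le
  have h : ‖u‖ = ‖graphMap u‖ := rfl
  rw [h, WithLp.prod_norm_eq_add (by rw [e]; exact hp0), e, ← Real.rpow_mul (by positivity),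
    one_div, inv_mul_cancel₀ hp0.ne', Real.rpow_one, ← norm_quotient]
  rfl

end MagneticFractional

/-! ### Traces -/

/-- The linear map `T` is given by restriction to the boundary, `U ↦ U(·, 0)`, on the functions
of class `C¹` with compact support in the closed half-space. -/
def IsRestriction {d : ℕ}
    {A : EuclideanSpace ℝ (Fin (d + 1)) → EuclideanSpace ℝ (Fin (d + 1))} {s p : ℝ}
    [Fact (1 ≤ p)]
    (T : MagneticSobolev A p →L[ℂ] MagneticFractional (tangential A) s p) : Prop :=
  ∀ (U : MagneticSobolev A p) (f : EuclideanSpace ℝ (Fin (d + 1)) → ℂ), IsC1c f →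
    U.toLp =ᵐ[volume.restrict (halfSpace d)] f →
      (T U).toLp =ᵐ[volume] fun x => f (boundaryPoint x)

end MagneticTrace

end

/-! The covariant gradient controls parallel transport. Along a segment with velocity `v`, the
function `e^{iθ} f`, where `θ` is the accumulated circulation of `A`, has derivative `e^{iθ} ∇_A f ·
v`, so after transport two values of `f` differ by at most the integral of `|∇_A f|` times `|v|`
(`enorm_transport_le`). Transport depends on the path, but only through the flux of `dA`: the
circulation around a triangle is at most `β` times the product of two sides (`abs_circulation_le`).
The rest is Gagliardo's classical argument with these two facts inserted, at the length scale
`β^{-1/2}` where fluxes become of order one.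

Trace: transport along vertical lines shows that `U`, carried to the boundary, differs from `u` by
at most `T ‖∇_A U‖` in `L^p` of the strip of width `T` (`eLpNorm_stripDiff_le`). The function `u`
itself has norm `T^{1/p} ‖u‖` on that strip, and `T = β^{-1/2}` gives the bound on `‖u‖`. For the
seminorm, `x` and `y` are joined through the point `((x + y)/2, |y - x|)`. This costs two transports
along slanted segments and a flux `O(β |y - x|²)`; as a difference of phases is also at most `2`,
the flux costs only a multiple of `β^{1/2} |y - x| |U|`, which scales like the gradient terms
(`enorm_covDiff_le`). Polar coordinates turn the double integrals into integrals over the half-space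
(`lintegral_covDiff_le`). Density of smooth functions and Fatou's lemma give the general case
(`exists_trace`).

Extension: `U(x, t)` is a mollified average over `|y - x| ≤ t` of `u(y)` transported from `(y, 0)`
to `(x, t)`, cut off at height of order `β^{-1/2}`. In `∇_A U` the derivative of the mollifier has
integral zero, so it only sees covariant increments of `u`, while the derivative of the phase
cancels `A` up to an integral of `dA` (`intPotDeriv_apply`). The resulting averages are estimated by
Hölder's inequality and Tonelli's theorem (`lintegral_slab_ballIntegral_le`).

The two halves meet in `IsTrace`, the requirement that the strip difference be `O(T)`. Since `T^{1 -
1/p}` tends to `0`, it determines `u` (`IsTrace.unique`). Both constructions satisfy it, whence the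
linearity of the trace, its agreement with restriction, and `Tr ∘ Ext = id`. Throughout, `A` is
replaced by a `C¹` extension `B` to the whole space, built by reflection; bounds on `dB` are only
needed on the closed half-space. -/

noncomputable section

namespace MagneticTrace

/-! ### Coordinates on the half-space -/

section coordinates

variable {d : ℕ}

/-- The point `(x, t)` of `ℝ^(d+1)`. -/
def pt (x : EuclideanSpace ℝ (Fin d)) (t : ℝ) : EuclideanSpace ℝ (Fin (d + 1)) :=
  WithLp.toLp 2 (Fin.snoc (α := fun _ => ℝ) x.ofLp t)

/-- The first `d` coordinates of a point of `ℝ^(d+1)`. -/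
def base (X : EuclideanSpace ℝ (Fin (d + 1))) : EuclideanSpace ℝ (Fin d) :=
  WithLp.toLp 2 (fun j => X j.castSucc)

@[simp] theorem pt_castSucc (x : EuclideanSpace ℝ (Fin d)) (t : ℝ) (j : Fin d) :
    pt x t j.castSucc = x j := by simp [pt]

@[simp] theorem pt_last (x : EuclideanSpace ℝ (Fin d)) (t : ℝ) : pt x t (Fin.last d) = t := by
  simp [pt]

@[simp] theorem base_apply (X : EuclideanSpace ℝ (Fin (d + 1))) (j : Fin d) :
    base X j = X j.castSucc := rfl

@[simp] theorem base_pt (x : EuclideanSpace ℝ (Fin d)) (t : ℝ) : base (pt x t) = x := by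
  ext j; simp

theorem boundaryPoint_eq (x : EuclideanSpace ℝ (Fin d)) : boundaryPoint x = pt x 0 := rfl

theorem ext_coord {X Y : EuclideanSpace ℝ (Fin (d + 1))} (h1 : base X = base Y)
    (h2 : X (Fin.last d) = Y (Fin.last d)) : X = Y := by
  ext j
  refine Fin.lastCases h2 (fun i => ?_) j
  exact congrArg (fun x => x i) h1

@[simp] theorem pt_base (X : EuclideanSpace ℝ (Fin (d + 1))) : pt (base X) (X (Fin.last d)) = X :=
  ext_coord (by simp) (by simp)

/-- `(x, t) ↦ pt x t` as a continuous linear map. -/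
def ptL : EuclideanSpace ℝ (Fin d) × ℝ →L[ℝ] EuclideanSpace ℝ (Fin (d + 1)) :=
  LinearMap.toContinuousLinearMap
    { toFun := fun z => pt z.1 z.2
      map_add' := fun z w => ext_coord (by ext j; simp) (by simp)
      map_smul' := fun c z => ext_coord (by ext j; simp) (by simp) }

/-- `base` as a continuous linear map. -/
def baseL : EuclideanSpace ℝ (Fin (d + 1)) →L[ℝ] EuclideanSpace ℝ (Fin d) :=
  LinearMap.toContinuousLinearMap
    { toFun := base
      map_add' := fun z w => by ext j; simp
      map_smul' := fun c z => by ext j; simp }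

theorem pt_add (x y : EuclideanSpace ℝ (Fin d)) (s t : ℝ) :
    pt (x + y) (s + t) = pt x s + pt y t := (ptL (d := d)).map_add (x, s) (y, t)

theorem pt_sub (x y : EuclideanSpace ℝ (Fin d)) (s t : ℝ) :
    pt (x - y) (s - t) = pt x s - pt y t := (ptL (d := d)).map_sub (x, s) (y, t)

theorem pt_smul (c : ℝ) (x : EuclideanSpace ℝ (Fin d)) (t : ℝ) :
    pt (c • x) (c * t) = c • pt x t := (ptL (d := d)).map_smul c (x, t)

@[fun_prop]
theorem continuous_base : Continuous (base (d := d)) := (baseL (d := d)).continuous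

@[fun_prop]
theorem measurable_base : Measurable (base (d := d)) := continuous_base.measurable

@[fun_prop]
theorem continuous_pt {α : Type*} [TopologicalSpace α] {f : α → EuclideanSpace ℝ (Fin d)}
    {g : α → ℝ} (hf : Continuous f) (hg : Continuous g) : Continuous fun a => pt (f a) (g a) :=
  (ptL (d := d)).continuous.comp (hf.prodMk hg)

@[fun_prop]
theorem measurable_pt {α : Type*} [MeasurableSpace α] {f : α → EuclideanSpace ℝ (Fin d)}
    {g : α → ℝ} (hf : Measurable f) (hg : Measurable g) : Measurable fun a => pt (f a) (g a) :=
  (ptL (d := d)).continuous.measurable.comp (hf.prodMk hg)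

theorem inner_pt (x y : EuclideanSpace ℝ (Fin d)) (s t : ℝ) :
    inner ℝ (pt x s) (pt y t) = inner ℝ x y + s * t := by
  simp only [PiLp.inner_apply, Fin.sum_univ_castSucc, pt_castSucc, pt_last]
  simp [mul_comm]

theorem norm_pt_sq (x : EuclideanSpace ℝ (Fin d)) (t : ℝ) :
    ‖pt x t‖ ^ 2 = ‖x‖ ^ 2 + t ^ 2 := by
  rw [← real_inner_self_eq_norm_sq, inner_pt, real_inner_self_eq_norm_sq]
  ring

@[simp] theorem norm_pt_zero_right (x : EuclideanSpace ℝ (Fin d)) : ‖pt x 0‖ = ‖x‖ := by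
  have := norm_pt_sq x 0
  rw [← abs_of_nonneg (norm_nonneg x), ← abs_of_nonneg (norm_nonneg (pt x 0))]
  exact (sq_eq_sq_iff_abs_eq_abs _ _).1 (by simpa using this)

@[simp] theorem norm_pt_zero_left (t : ℝ) : ‖pt (0 : EuclideanSpace ℝ (Fin d)) t‖ = |t| := by
  have := norm_pt_sq (0 : EuclideanSpace ℝ (Fin d)) t
  rw [← abs_of_nonneg (norm_nonneg (pt 0 t))]
  exact (sq_eq_sq_iff_abs_eq_abs _ _).1 (by simpa using this)

theorem norm_pt_le (x : EuclideanSpace ℝ (Fin d)) (t : ℝ) : ‖pt x t‖ ≤ ‖x‖ + |t| := by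
  have : pt x t = pt x 0 + pt 0 t := by rw [← pt_add]; simp
  rw [this]
  refine (norm_add_le _ _).trans ?_
  simp

theorem norm_base_le (X : EuclideanSpace ℝ (Fin (d + 1))) : ‖base X‖ ≤ ‖X‖ := by
  have := norm_pt_sq (base X) (X (Fin.last d))
  rw [pt_base] at this
  exact abs_le_of_sq_le_sq' (by nlinarith [sq_nonneg (X (Fin.last d))]) (norm_nonneg _) |>.2

theorem pt_mem_closedHalfSpace {x : EuclideanSpace ℝ (Fin d)} {t : ℝ} (ht : 0 ≤ t) :
    pt x t ∈ closedHalfSpace d := by simpa [closedHalfSpace] using ht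

theorem halfSpace_subset_closedHalfSpace : halfSpace d ⊆ closedHalfSpace d :=
  fun X hX => show (0 : ℝ) ≤ X (Fin.last d) from le_of_lt (show (0 : ℝ) < X (Fin.last d) from hX)

theorem measurableSet_halfSpace : MeasurableSet (halfSpace d) := (isOpen_halfSpace d).measurableSet

theorem isClosed_closedHalfSpace : IsClosed (closedHalfSpace d) :=
  isClosed_le continuous_const (by fun_prop)

theorem convex_closedHalfSpace : Convex ℝ (closedHalfSpace d) := by
  intro X hX Y hY a b ha hb _
  simp only [closedHalfSpace, mem_ofPred_eq, PiLp.add_apply, PiLp.smul_apply, smul_eq_mul] at *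
  positivity

theorem pt_mem_halfSpace {x : EuclideanSpace ℝ (Fin d)} {t : ℝ} :
    pt x t ∈ halfSpace d ↔ 0 < t := by simp [halfSpace]

theorem closure_halfSpace : closure (halfSpace d) = closedHalfSpace d := by
  refine Subset.antisymm
    (closure_minimal halfSpace_subset_closedHalfSpace isClosed_closedHalfSpace) ?_
  intro X hX
  have hX' : (0 : ℝ) ≤ X (Fin.last d) := hX
  have h : Filter.Tendsto (fun t : ℝ => pt (base X) (X (Fin.last d) + t))
      (nhdsWithin 0 (Ioi 0)) (nhds (pt (base X) (X (Fin.last d) + 0))) := by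
    refine Filter.Tendsto.mono_left ?_ nhdsWithin_le_nhds
    exact Continuous.tendsto (by fun_prop) 0
  rw [add_zero, pt_base] at h
  refine mem_closure_of_tendsto h ?_
  filter_upwards [self_mem_nhdsWithin] with t ht
  have : (0 : ℝ) < t := ht
  rw [pt_mem_halfSpace]
  positivity

/-! ### Integration in coordinates -/

theorem measurePreserving_pt :
    MeasurePreserving (fun z : EuclideanSpace ℝ (Fin d) × ℝ => pt z.1 z.2)
      (volume.prod volume) volume := by
  have h1 : MeasurePreserving (fun z : EuclideanSpace ℝ (Fin d) × ℝ => (z.1.ofLp, z.2))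
      (volume.prod volume) (volume.prod volume) :=
    (PiLp.volume_preserving_ofLp (Fin d)).prod (MeasurePreserving.id volume)
  -- The splitting of a coordinate from a product of lines lists that coordinate first, hence the
  -- swap.
  have h2 : MeasurePreserving (Prod.swap : (Fin d → ℝ) × ℝ → ℝ × (Fin d → ℝ))
      (volume.prod volume) (volume.prod volume) := Measure.measurePreserving_swap
  have h3 := (volume_preserving_piFinSuccAbove (fun _ : Fin (d + 1) => ℝ) (Fin.last d)).symm
  have h4 := PiLp.volume_preserving_toLp (Fin (d + 1))
  convert! h4.comp (h3.comp (h2.comp h1)) using 1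
  funext z
  simp only [Function.comp_apply, pt, Prod.swap]
  congr 1
  exact (Fin.insertNth_last' _ _).symm

/-- Points of `ℝ^(d+1)` whose last coordinate lies in `S`. -/
def slab (d : ℕ) (S : Set ℝ) : Set (EuclideanSpace ℝ (Fin (d + 1))) :=
  {X | X (Fin.last d) ∈ S}

theorem halfSpace_eq_slab : halfSpace d = slab d (Ioi 0) := rfl

theorem measurableSet_slab {S : Set ℝ} (hS : MeasurableSet S) : MeasurableSet (slab d S) :=
  (show Measurable fun X : EuclideanSpace ℝ (Fin (d + 1)) => X (Fin.last d) by fun_prop) hS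

theorem lintegral_slab {S : Set ℝ} (hS : MeasurableSet S)
    {F : EuclideanSpace ℝ (Fin (d + 1)) → ℝ≥0∞} (hF : Measurable F) :
    ∫⁻ X in slab d S, F X = ∫⁻ x, ∫⁻ t in S, F (pt x t) := by
  rw [← lintegral_indicator (measurableSet_slab hS), ← measurePreserving_pt.lintegral_comp
    (hF.indicator (measurableSet_slab hS)), lintegral_prod]
  · refine lintegral_congr fun x => ?_
    rw [← lintegral_indicator hS]
    refine lintegral_congr fun t => ?_
    by_cases h : t ∈ S
    · rw [indicator_of_mem h, indicator_of_mem (by simpa [slab] using h)]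
    · rw [indicator_of_notMem h, indicator_of_notMem (by simpa [slab] using h)]
  · exact ((hF.indicator (measurableSet_slab hS)).comp
      measurePreserving_pt.measurable).aemeasurable

/-- Slicing at fixed height serves whenever translation invariance in `x` is used; `lintegral_slab`
serves estimates along vertical lines. -/
theorem lintegral_slab_symm {S : Set ℝ} (hS : MeasurableSet S)
    {F : EuclideanSpace ℝ (Fin (d + 1)) → ℝ≥0∞} (hF : Measurable F) :
    ∫⁻ X in slab d S, F X = ∫⁻ t in S, ∫⁻ x, F (pt x t) := by
  rw [lintegral_slab hS hF, lintegral_lintegral_swap]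
  exact (hF.comp measurePreserving_pt.measurable).aemeasurable

end coordinates

/-! ### Polar coordinates and Hölder's inequality -/

/-- Polar coordinates for a radial function: away from the null set `{0}` the space is the product
of the sphere and `(0, ∞)`, and the sphere only contributes its mass. No integrability is required.
-/
theorem lintegral_fun_norm {E : Type*} [NormedAddCommGroup E] [NormedSpace ℝ E]
    [FiniteDimensional ℝ E] [Nontrivial E] [MeasurableSpace E] [BorelSpace E]
    (μ : Measure E) [μ.IsAddHaarMeasure] {g : ℝ → ℝ≥0∞} (hg : Measurable g) :
    ∫⁻ x, g ‖x‖ ∂μ = μ.toSphere univ *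
      ∫⁻ r in Ioi (0 : ℝ), ENNReal.ofReal (r ^ (Module.finrank ℝ E - 1)) * g r := by
  have h := μ.measurePreserving_homeomorphUnitSphereProd.lintegral_comp_emb
    (Homeomorph.measurableEmbedding _) (fun z => g (z.2 : ℝ))
  simp only [homeomorphUnitSphereProd_apply_snd_coe] at h
  have h1 : ∫⁻ x, g ‖x‖ ∂μ = ∫⁻ x : ({(0)}ᶜ : Set E), g ‖x.1‖ ∂(μ.comap (↑)) := by
    rw [lintegral_subtype_comap (measurableSet_singleton _).compl fun x => g ‖x‖,
      restrict_compl_singleton]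
  rw [h1, h, lintegral_prod _ (by fun_prop)]
  simp only [lintegral_const]
  rw [mul_comm, Measure.volumeIoiPow, lintegral_withDensity_eq_lintegral_mul _ (by fun_prop)
    (by fun_prop)]
  simp only [Pi.mul_apply]
  rw [lintegral_subtype_comap measurableSet_Ioi
    fun r : ℝ => ENNReal.ofReal (r ^ (Module.finrank ℝ E - 1)) * g r]

/-- The `(d-1)`-dimensional measure of the unit sphere of `ℝ^d`. -/
def sphereMeasure (d : ℕ) : ℝ≥0∞ :=
  (volume : Measure (EuclideanSpace ℝ (Fin d))).toSphere univ

theorem sphereMeasure_lt_top (d : ℕ) : sphereMeasure d < ⊤ := by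
  rw [sphereMeasure, Measure.toSphere_apply_univ]
  exact ENNReal.mul_lt_top (by simp) Metric.isBounded_ball.measure_lt_top

/-- The weight `|h|^{1-d}` cancels the Jacobian `r^{d-1}`. It is exactly the weight left by a
Gagliardo kernel of order `1 - 1/p` once a factor `|h|^p` has been gained. Positive dimension is
needed for polar coordinates. -/
theorem lintegral_norm_rpow_mul {d : ℕ} (hd : 1 ≤ d) {g : ℝ → ℝ≥0∞} (hg : Measurable g) :
    ∫⁻ h : EuclideanSpace ℝ (Fin d), ‖h‖ₑ ^ (1 - d : ℝ) * g ‖h‖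
      = sphereMeasure d * ∫⁻ r in Ioi (0 : ℝ), g r := by
  have : Nonempty (Fin d) := ⟨⟨0, hd⟩⟩
  have := lintegral_fun_norm (volume : Measure (EuclideanSpace ℝ (Fin d)))
    (g := fun r => ENNReal.ofReal r ^ (1 - d : ℝ) * g r) (by fun_prop)
  simp only [ofReal_norm] at this
  rw [this, sphereMeasure]
  congr 1
  refine setLIntegral_congr_fun measurableSet_Ioi fun r hr => ?_
  have hr : 0 < r := hr
  simp only [finrank_euclideanSpace, Fintype.card_fin]
  rw [← mul_assoc, ENNReal.ofReal_rpow_of_pos hr, ← ENNReal.ofReal_mul (by positivity),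
    ← Real.rpow_natCast, ← Real.rpow_add hr, Nat.cast_sub hd]
  simp

theorem lintegral_Ioi_comp_mul_left {g : ℝ → ℝ≥0∞} {s : ℝ} (hs : 0 < s) :
    ∫⁻ r in Ioi (0 : ℝ), g (s * r) = ENNReal.ofReal s⁻¹ * ∫⁻ r in Ioi (0 : ℝ), g r := by
  have h1 : ∀ r : ℝ, (Ioi (0 : ℝ)).indicator (fun r => g (s * r)) r
      = (Ioi (0 : ℝ)).indicator g (s * r) := by
    intro r
    simp only [indicator, mem_Ioi, mul_pos_iff_of_pos_left hs]
  rw [← lintegral_indicator measurableSet_Ioi, ← lintegral_indicator measurableSet_Ioi]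
  simp only [h1]
  have e := (Homeomorph.mulLeft₀ s hs.ne').measurableEmbedding.lintegral_map
    ((Ioi (0 : ℝ)).indicator g) (μ := volume)
  simp only [Homeomorph.coe_mulLeft₀] at e
  rw [← e, Real.map_volume_mul_left hs.ne', lintegral_smul_measure, abs_of_pos (inv_pos.2 hs)]
  rfl

/-- Change of variables in an integral over pairs of points, with values at points of the
half-space at height proportional to the distance. -/
theorem lintegral_lintegral_midpoint {d : ℕ} (hd : 1 ≤ d) {s : ℝ} (hs : 0 < s)
    {F : EuclideanSpace ℝ (Fin (d + 1)) → ℝ≥0∞} (hF : Measurable F) :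
    ∫⁻ x : EuclideanSpace ℝ (Fin d), ∫⁻ y : EuclideanSpace ℝ (Fin d),
        ‖y - x‖ₑ ^ (1 - d : ℝ) * F (pt (x + (s / 2) • (y - x)) (s * ‖y - x‖))
      = sphereMeasure d * (ENNReal.ofReal s⁻¹ * ∫⁻ X in halfSpace d, F X) := by
  have h1 : ∀ x : EuclideanSpace ℝ (Fin d), ∫⁻ y : EuclideanSpace ℝ (Fin d),
        ‖y - x‖ₑ ^ (1 - d : ℝ) * F (pt (x + (s / 2) • (y - x)) (s * ‖y - x‖))
      = ∫⁻ h : EuclideanSpace ℝ (Fin d),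
        ‖h‖ₑ ^ (1 - d : ℝ) * F (pt (x + (s / 2) • h) (s * ‖h‖)) := fun x =>
    lintegral_sub_right_eq_self
      (fun h : EuclideanSpace ℝ (Fin d) =>
        ‖h‖ₑ ^ (1 - d : ℝ) * F (pt (x + (s / 2) • h) (s * ‖h‖))) x
  simp only [h1]
  rw [lintegral_lintegral_swap (by fun_prop)]
  -- At fixed `h` the shift `(s / 2) • h` is absorbed by translation invariance in `x`, which leaves
  -- a radial function of `h`. The factor `s⁻¹` then comes from the height `s ‖h‖`.
  have h2 : ∀ h : EuclideanSpace ℝ (Fin d), ∫⁻ x : EuclideanSpace ℝ (Fin d),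
        ‖h‖ₑ ^ (1 - d : ℝ) * F (pt (x + (s / 2) • h) (s * ‖h‖))
      = ‖h‖ₑ ^ (1 - d : ℝ) * ∫⁻ x, F (pt x (s * ‖h‖)) := by
    intro h
    rw [lintegral_const_mul _ (by fun_prop)]
    congr 1
    exact lintegral_add_right_eq_self (fun x => F (pt x (s * ‖h‖))) ((s / 2) • h)
  simp only [h2]
  have hm : Measurable fun r => ∫⁻ x : EuclideanSpace ℝ (Fin d), F (pt x r) :=
    Measurable.lintegral_prod_right' (f := fun z : ℝ × EuclideanSpace ℝ (Fin d) => F (pt z.2 z.1))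
      (by fun_prop)
  rw [lintegral_norm_rpow_mul hd (g := fun r => ∫⁻ x, F (pt x (s * r))) (by fun_prop),
    lintegral_Ioi_comp_mul_left (g := fun r => ∫⁻ x, F (pt x r)) hs, halfSpace_eq_slab,
    lintegral_slab_symm measurableSet_Ioi hF]

/-- Hölder's inequality for an integral, in the form of a power of an integral. -/
theorem lintegral_rpow_le {α : Type*} [MeasurableSpace α] {μ : Measure α} {p : ℝ} (hp : 1 < p)
    {g : α → ℝ≥0∞} (hg : AEMeasurable g μ) :
    (∫⁻ a, g a ∂μ) ^ p ≤ μ univ ^ (p - 1) * ∫⁻ a, g a ^ p ∂μ := by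
  have hpq := Real.HolderConjugate.conjExponent hp
  have h := ENNReal.lintegral_mul_le_Lp_mul_Lq μ hpq hg (aemeasurable_const (b := (1 : ℝ≥0∞)))
  simp only [Pi.mul_def, mul_one, ENNReal.one_rpow, lintegral_const, one_mul] at h
  have hp0 : 0 < p := by linarith
  calc (∫⁻ a, g a ∂μ) ^ p
      ≤ ((∫⁻ a, g a ^ p ∂μ) ^ (1 / p) * μ univ ^ (1 / p.conjExponent)) ^ p := by gcongr
    _ = μ univ ^ (p - 1) * ∫⁻ a, g a ^ p ∂μ := by
      rw [ENNReal.mul_rpow_of_nonneg _ _ hp0.le, ← ENNReal.rpow_mul, ← ENNReal.rpow_mul,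
        one_div_mul_cancel hp0.ne', ENNReal.rpow_one, mul_comm]
      congr 2
      rw [Real.conjExponent]
      field_simp

/-- A constant for the weighted Hölder inequality on `(0, 1)`. -/
def weightConst (p : ℝ) : ℝ≥0∞ :=
  (∫⁻ s in Ioo (0 : ℝ) 1, ENNReal.ofReal s ^ (-(1 / 2) : ℝ)) ^ (p - 1)

theorem lintegral_Ioo_rpow_lt_top {b : ℝ} (hb : -1 < b) :
    ∫⁻ s in Ioo (0 : ℝ) 1, ENNReal.ofReal s ^ b < ⊤ := by
  have h := ((intervalIntegral.integrableOn_Ioo_rpow_iff (s := b) one_pos).2 hb).2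
  refine lt_of_eq_of_lt (setLIntegral_congr_fun measurableSet_Ioo fun s hs => ?_) h
  simp only
  rw [ENNReal.ofReal_rpow_of_pos hs.1, Real.enorm_eq_ofReal (Real.rpow_nonneg hs.1.le _)]

theorem weightConst_lt_top {p : ℝ} (hp : 1 < p) : weightConst p < ⊤ :=
  ENNReal.rpow_lt_top_of_nonneg (by linarith) (lintegral_Ioo_rpow_lt_top (by norm_num)).ne

/-- Hölder's inequality on `(0, 1)` with a weight. -/
theorem lintegral_Ioo_rpow_le {p : ℝ} (hp : 1 < p) {g : ℝ → ℝ≥0∞} (hg : Measurable g) :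
    (∫⁻ s in Ioo (0 : ℝ) 1, g s) ^ p ≤ weightConst p *
      ∫⁻ s in Ioo (0 : ℝ) 1, ENNReal.ofReal s ^ ((p - 1) / 2 : ℝ) * g s ^ p := by
  have hpq := Real.HolderConjugate.conjExponent hp
  have hp0 : 0 < p := by linarith
  -- This exponent satisfies `a p = (p - 1) / 2` and `a p' = 1 / 2` for the conjugate exponent `p'`:
  -- the dual weight `s^{-1/2}` is integrable at `0`, and the weight `s^{(p-1)/2}` is enough to
  -- absorb a later factor `s⁻¹`.
  set a : ℝ := (p - 1) / (2 * p) with ha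
  have h := ENNReal.lintegral_mul_le_Lp_mul_Lq (volume.restrict (Ioo (0 : ℝ) 1)) hpq
    (f := fun s => ENNReal.ofReal s ^ a * g s) (g := fun s => ENNReal.ofReal s ^ (-a))
    (by fun_prop) (by fun_prop)
  have e1 : ∫⁻ s in Ioo (0 : ℝ) 1, g s
      = ∫⁻ s in Ioo (0 : ℝ) 1, ((fun s => ENNReal.ofReal s ^ a * g s) *
        fun s => ENNReal.ofReal s ^ (-a)) s := by
    refine setLIntegral_congr_fun measurableSet_Ioo fun s hs => ?_
    have h0 : ENNReal.ofReal s ≠ 0 := by simpa using hs.1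
    simp only [Pi.mul_apply]
    rw [mul_comm (ENNReal.ofReal s ^ a), mul_assoc, ← ENNReal.rpow_add _ _ h0 (by simp)]
    simp
  rw [← e1] at h
  refine (ENNReal.rpow_le_rpow h hp0.le).trans (le_of_eq ?_)
  rw [ENNReal.mul_rpow_of_nonneg _ _ hp0.le, ← ENNReal.rpow_mul, ← ENNReal.rpow_mul,
        one_div_mul_cancel hp0.ne', ENNReal.rpow_one, mul_comm, weightConst]
  have hc : p.conjExponent ≠ 0 := hpq.symm.pos.ne'
  have e2 : -a * p.conjExponent = -(1 / 2) := by
    rw [ha, Real.conjExponent]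
    have : p - 1 ≠ 0 := by linarith
    field_simp
  have e3 : 1 / p.conjExponent * p = p - 1 := by
    rw [Real.conjExponent]
    field_simp
  have e4 : a * p = (p - 1) / 2 := by rw [ha]; field_simp
  simp only [← ENNReal.rpow_mul, e2, e3, ENNReal.mul_rpow_of_nonneg _ _ hp0.le, e4]

end MagneticTrace

end

noncomputable section

namespace MagneticTrace

/-! ### Circulations of a potential of class `C¹` -/

/-- Compactness of the closed unit ball about `X₀` times `[0, 1]` provides a constant dominating the
derivative, so the interval integral may be differentiated under the sign. -/
theorem hasFDerivAt_intervalIntegral_of_continuous {H F : Type*} [NormedAddCommGroup H]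
    [NormedSpace ℝ H] [ProperSpace H] [NormedAddCommGroup F] [NormedSpace ℝ F]
    {g : H → ℝ → F} {g' : H → ℝ → H →L[ℝ] F} (hg : Continuous g.uncurry)
    (hg' : Continuous g'.uncurry) (h : ∀ X t, HasFDerivAt (fun X => g X t) (g' X t) X) (X₀ : H) :
    HasFDerivAt (fun X => ∫ t in (0 : ℝ)..1, g X t) (∫ t in (0 : ℝ)..1, g' X₀ t) X₀ := by
  obtain ⟨C, hC⟩ := ((isCompact_closedBall X₀ 1).prod (isCompact_Icc (a := (0 : ℝ)) (b := 1))
    ).exists_bound_of_continuousOn hg'.continuousOn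
  have c1 : ∀ X, Continuous (g X) := fun X => hg.comp (by fun_prop : Continuous fun t => (X, t))
  have c2 : ∀ X, Continuous (g' X) := fun X => hg'.comp (by fun_prop : Continuous fun t => (X, t))
  refine intervalIntegral.hasFDerivAt_integral_of_dominated_of_fderiv_le
    (s := Metric.closedBall X₀ 1) (bound := fun _ => C)
    (Metric.closedBall_mem_nhds _ one_pos) (Filter.Eventually.of_forall fun X =>
      (c1 X).aestronglyMeasurable) ((c1 X₀).intervalIntegrable _ _)
    (c2 X₀).aestronglyMeasurable ?_ (by simp) (Filter.Eventually.of_forall fun t _ X _ => h X t)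
  refine Filter.Eventually.of_forall fun t ht X hX => ?_
  rw [uIoc_of_le zero_le_one] at ht
  exact hC (X, t) ⟨hX, ht.1.le, ht.2⟩

section circulation

variable {n : ℕ} {A : EuclideanSpace ℝ (Fin n) → EuclideanSpace ℝ (Fin n)}

/-- The exterior derivative of `A` evaluated at a pair of vectors. -/
def curl (A : EuclideanSpace ℝ (Fin n) → EuclideanSpace ℝ (Fin n))
    (X v w : EuclideanSpace ℝ (Fin n)) : ℝ :=
  inner ℝ (fderiv ℝ A X v) w - inner ℝ (fderiv ℝ A X w) v

/-- This is the alternation of `dA`. It allows the second vector to be shifted along the first, so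
that a moving vertex disappears from the flux density of a triangle. -/
theorem curl_add_smul_right (X v w : EuclideanSpace ℝ (Fin n)) (c : ℝ) :
    curl A X v (w + c • v) = curl A X v w := by
  simp only [curl, map_add, map_smul, inner_add_right, inner_add_left, inner_smul_left,
    inner_smul_right]
  simp

theorem continuous_curl {α : Type*} [TopologicalSpace α] (hA : ContDiff ℝ 1 A)
    {f g h : α → EuclideanSpace ℝ (Fin n)} (hf : Continuous f) (hg : Continuous g)
    (hh : Continuous h) : Continuous fun a => curl A (f a) (g a) (h a) := by
  have := hA.continuous_fderiv one_ne_zero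
  unfold curl
  exact ((((this.comp hf).clm_apply hg).inner hh)).sub (((this.comp hf).clm_apply hh).inner hg)

/-- The derivative of `∫_0^1 A((1 - t) X + t Y) · (Y - X) dt` with respect to `X`. -/
def intPotDeriv (A : EuclideanSpace ℝ (Fin n) → EuclideanSpace ℝ (Fin n))
    (X Y : EuclideanSpace ℝ (Fin n)) : EuclideanSpace ℝ (Fin n) →L[ℝ] ℝ :=
  ∫ t in (0 : ℝ)..1, ((1 - t) • (innerSL ℝ (Y - X)).comp (fderiv ℝ A ((1 - t) • X + t • Y))
    - innerSL ℝ (A ((1 - t) • X + t • Y)))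

theorem continuous_intPotDeriv_integrand (hA : ContDiff ℝ 1 A) :
    Continuous fun q : (EuclideanSpace ℝ (Fin n) × EuclideanSpace ℝ (Fin n)) × ℝ =>
      ((1 - q.2) • (innerSL ℝ (q.1.2 - q.1.1)).comp
        (fderiv ℝ A ((1 - q.2) • q.1.1 + q.2 • q.1.2))
      - innerSL ℝ (A ((1 - q.2) • q.1.1 + q.2 • q.1.2))) := by
  have h1 := hA.continuous_fderiv one_ne_zero
  have h2 := hA.continuous
  fun_prop

theorem continuous_intPotDeriv (hA : ContDiff ℝ 1 A) :
    Continuous fun z : EuclideanSpace ℝ (Fin n) × EuclideanSpace ℝ (Fin n) =>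
      intPotDeriv A z.1 z.2 :=
  intervalIntegral.continuous_parametric_intervalIntegral_of_continuous'
    (continuous_intPotDeriv_integrand hA) 0 1

theorem hasFDerivAt_intPot (hA : ContDiff ℝ 1 A) (X Y : EuclideanSpace ℝ (Fin n)) :
    HasFDerivAt (fun X => intPot A X Y) (intPotDeriv A X Y) X := by
  have h2 := hA.continuous
  have h3 := hA.differentiable one_ne_zero
  unfold intPot intPotDeriv
  refine hasFDerivAt_intervalIntegral_of_continuous (by unfold Function.uncurry; fun_prop)
    (g' := fun X t => ((1 - t) • (innerSL ℝ (Y - X)).comp (fderiv ℝ A ((1 - t) • X + t • Y))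
    - innerSL ℝ (A ((1 - t) • X + t • Y))))
    ((continuous_intPotDeriv_integrand hA).comp
      (by fun_prop : Continuous fun q : EuclideanSpace ℝ (Fin n) × ℝ => ((q.1, Y), q.2)))
    (fun X t => ?_) X
  have e1 : HasFDerivAt (fun X : EuclideanSpace ℝ (Fin n) => (1 - t) • X + t • Y)
      ((1 - t) • ContinuousLinearMap.id ℝ _) X := ((hasFDerivAt_id X).const_smul (1 - t)).add_const _
  have e2 : HasFDerivAt (fun X : EuclideanSpace ℝ (Fin n) => Y - X)
      (-ContinuousLinearMap.id ℝ _) X := (hasFDerivAt_id X).const_sub Y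
  have e3 := ((h3 ((1 - t) • X + t • Y)).hasFDerivAt.comp X e1).inner ℝ e2
  refine e3.congr_fderiv ?_
  ext v
  simp [fderivInnerCLM_apply, real_inner_comm, inner_smul_left, inner_sub_left]
  ring

/-- The gradient in `X` of the circulation from `X` to `Y` is `-A(X)` up to a remainder that
involves only `dA`. Hence `X ↦ e^{i I(X, Y)}` is nearly covariantly constant, which is the source of
every gauge-invariant bound below. The remainder appears by writing `A(X) · v` as minus the integral
of the derivative of `(1 - t) A · v` along the segment: the terms without derivatives of `A` cancel
and the other two antisymmetrize. -/
theorem intPotDeriv_apply (hA : ContDiff ℝ 1 A) (X Y v : EuclideanSpace ℝ (Fin n)) :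
    intPotDeriv A X Y v + inner ℝ (A X) v
      = ∫ t in (0 : ℝ)..1, (1 - t) * curl A ((1 - t) • X + t • Y) v (Y - X) := by
  have h1 := hA.continuous_fderiv one_ne_zero
  have h2 := hA.continuous
  have h3 := hA.differentiable one_ne_zero
  -- The weight `1 - t` vanishes at the end `Y`, so only the value at `X` survives in the
  -- fundamental theorem of calculus.
  have e1 : ∀ t : ℝ, HasDerivAt (fun t : ℝ => (1 - t) * inner ℝ (A ((1 - t) • X + t • Y)) v)
      ((-1) * inner ℝ (A ((1 - t) • X + t • Y)) v
        + (1 - t) * inner ℝ (fderiv ℝ A ((1 - t) • X + t • Y) (Y - X)) v) t := by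
    intro t
    have d1 : HasDerivAt (fun t : ℝ => 1 - t) (-1) t := by
      simpa using (hasDerivAt_id t).const_sub 1
    have d2 : HasDerivAt (fun t : ℝ => (1 - t) • X + t • Y) (Y - X) t := by
      have := (d1.smul_const X).add ((hasDerivAt_id t).smul_const Y)
      refine this.congr_deriv ?_
      simp [sub_eq_neg_add]
    have d3 := (h3 ((1 - t) • X + t • Y)).hasFDerivAt.comp_hasDerivAt t d2
    have d4 := d3.inner ℝ (hasDerivAt_const t v)
    refine (d1.mul d4).congr_deriv ?_
    simp
  have e2 := intervalIntegral.integral_eq_sub_of_hasDerivAt (a := 0) (b := 1)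
    (fun t _ => e1 t) (Continuous.intervalIntegrable (by fun_prop) _ _)
  simp only [sub_self, zero_mul, sub_zero, one_mul, zero_smul, one_smul, add_zero] at e2
  have e3 : intPotDeriv A X Y v = ∫ t in (0 : ℝ)..1,
      ((1 - t) * inner ℝ (fderiv ℝ A ((1 - t) • X + t • Y) v) (Y - X)
        - inner ℝ (A ((1 - t) • X + t • Y)) v) := by
    rw [intPotDeriv, ContinuousLinearMap.intervalIntegral_apply]
    · refine intervalIntegral.integral_congr fun t _ => ?_
      simp [real_inner_comm, inner_sub_left]
    · exact ((continuous_intPotDeriv_integrand hA).comp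
        (by fun_prop : Continuous fun t : ℝ => ((X, Y), t))).intervalIntegrable _ _
  have e4 : inner ℝ (A X) v = -∫ t in (0 : ℝ)..1, ((-1) * inner ℝ (A ((1 - t) • X + t • Y)) v
        + (1 - t) * inner ℝ (fderiv ℝ A ((1 - t) • X + t • Y) (Y - X)) v) := by
    rw [e2]; ring
  rw [e3, e4, ← sub_eq_add_neg, ← intervalIntegral.integral_sub
    (Continuous.intervalIntegrable (by fun_prop) _ _)
    (Continuous.intervalIntegrable (by fun_prop) _ _)]
  refine intervalIntegral.integral_congr fun t _ => ?_
  simp only [curl]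
  ring

theorem intPot_symm (X Y : EuclideanSpace ℝ (Fin n)) : intPot A Y X = -intPot A X Y := by
  have := intervalIntegral.integral_comp_sub_left
    (fun t => inner ℝ (A ((1 - t) • X + t • Y)) (Y - X)) (1 : ℝ) (a := 0) (b := 1)
  simp only [sub_self, sub_zero] at this
  rw [intPot, intPot, ← this, ← intervalIntegral.integral_neg]
  refine intervalIntegral.integral_congr fun t _ => ?_
  simp only [sub_sub_cancel]
  rw [← inner_neg_right, neg_sub, add_comm]

end circulation

/-! ### Stokes' theorem on triangles -/

section stokes

variable {d : ℕ} {A : EuclideanSpace ℝ (Fin (d + 1)) → EuclideanSpace ℝ (Fin (d + 1))} {β : ℝ}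

/-- The exterior derivative of `A` is bounded by `β` on the closed half-space. -/
def FieldBound (A : EuclideanSpace ℝ (Fin (d + 1)) → EuclideanSpace ℝ (Fin (d + 1)))
    (β : ℝ) : Prop :=
  ∀ X ∈ closedHalfSpace d, ∀ v w, |curl A X v w| ≤ β * ‖v‖ * ‖w‖

theorem segment_mem {X Y : EuclideanSpace ℝ (Fin (d + 1))} (hX : X ∈ closedHalfSpace d)
    (hY : Y ∈ closedHalfSpace d) {t : ℝ} (h0 : 0 ≤ t) (h1 : t ≤ 1) :
    (1 - t) • X + t • Y ∈ closedHalfSpace d :=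
  convex_closedHalfSpace hX hY (by linarith) h0 (by ring)

/-- The weight `1 - t` is merely bounded by `1`; the factor `1/2` that it could give is not needed.
-/
theorem abs_integral_curl_le {X Y v w : EuclideanSpace ℝ (Fin (d + 1))} {b : ℝ}
    (h : ∀ t ∈ Icc (0 : ℝ) 1, |curl A ((1 - t) • X + t • Y) v w| ≤ b) :
    |∫ t in (0 : ℝ)..1, (1 - t) * curl A ((1 - t) • X + t • Y) v w| ≤ b := by
  have := intervalIntegral.norm_integral_le_of_norm_le_const (a := 0) (b := 1) (C := b)
    (f := fun t : ℝ => (1 - t) * curl A ((1 - t) • X + t • Y) v w) ?_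
  · simpa using this
  · intro t ht
    rw [uIoc_of_le zero_le_one] at ht
    have h1 := h t ⟨ht.1.le, ht.2⟩
    rw [Real.norm_eq_abs, abs_mul, abs_of_nonneg (by linarith [ht.2])]
    have := abs_nonneg (curl A ((1 - t) • X + t • Y) v w)
    nlinarith [ht.1, ht.2]

theorem abs_intPotDeriv_add_le (hA : ContDiff ℝ 1 A) (hβ : FieldBound A β)
    {X Y : EuclideanSpace ℝ (Fin (d + 1))} (hX : X ∈ closedHalfSpace d)
    (hY : Y ∈ closedHalfSpace d) (v : EuclideanSpace ℝ (Fin (d + 1))) :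
    |intPotDeriv A X Y v + inner ℝ (A X) v| ≤ β * ‖v‖ * ‖Y - X‖ := by
  rw [intPotDeriv_apply hA]
  exact abs_integral_curl_le fun t ht => hβ _ (segment_mem hX hY ht.1 ht.2) _ _

/-- The circulation of `A` along a triangle is bounded by the field. -/
theorem abs_circulation_le (hA : ContDiff ℝ 1 A) (hβ : FieldBound A β)
    {X Y W : EuclideanSpace ℝ (Fin (d + 1))} (hX : X ∈ closedHalfSpace d)
    (hY : Y ∈ closedHalfSpace d) (hW : W ∈ closedHalfSpace d) :
    |intPot A X Y + intPot A Y W + intPot A W X| ≤ β * ‖X - W‖ * ‖Y - W‖ := by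
  set P : ℝ → EuclideanSpace ℝ (Fin (d + 1)) := fun s => W + s • (X - W) with hP
  have hPm : ∀ s ∈ Icc (0 : ℝ) 1, P s ∈ closedHalfSpace d := by
    intro s hs
    have : P s = (1 - s) • W + s • X := by
      simp only [hP, smul_sub, sub_smul, one_smul]
      abel
    rw [this]
    exact segment_mem hW hX hs.1 hs.2
  have hPd : ∀ s, HasDerivAt P (X - W) s := fun s =>
    (((hasDerivAt_id s).smul_const (X - W)).const_add W).congr_deriv (by simp)
  -- Only one vertex moves, from `W`, where the triangle is degenerate, to `X`. In the difference of
  -- the two circulations the terms `A(P s) · (X - W)` cancel, so its derivative is an integral of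
  -- `dA`.
  have key := norm_image_sub_le_of_norm_deriv_le_segment_01'
    (f := fun s => intPot A (P s) Y - intPot A (P s) W)
    (f' := fun s => intPotDeriv A (P s) Y (X - W) - intPotDeriv A (P s) W (X - W))
    (C := β * ‖X - W‖ * ‖Y - W‖)
    (fun s _ => (((hasFDerivAt_intPot hA (P s) Y).comp_hasDerivAt s (hPd s)).sub
      ((hasFDerivAt_intPot hA (P s) W).comp_hasDerivAt s (hPd s))).hasDerivWithinAt) ?_
  · have e1 : P 1 = X := by simp [hP]
    have e0 : P 0 = W := by simp [hP]
    rw [e0, e1, intPot_self, Real.norm_eq_abs] at key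
    rw [intPot_symm X W, intPot_symm W Y]
    refine le_of_eq_of_le (congrArg _ ?_) key
    ring
  · intro s hs
    have hm := hPm s ⟨hs.1, hs.2.le⟩
    have e : intPotDeriv A (P s) Y (X - W) - intPotDeriv A (P s) W (X - W)
        = ∫ t in (0 : ℝ)..1, (1 - t) * curl A ((1 - t) • P s + t • Y) (X - W) (Y - W) := by
      have e1 := intPotDeriv_apply hA (P s) Y (X - W)
      have e2 := intPotDeriv_apply hA (P s) W (X - W)
      -- By alternation `Y - P s` may be replaced by the fixed side `Y - W`, from which it differs
      -- by a multiple of `X - W`. The vector `W - P s` is itself such a multiple and contributes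
      -- nothing.
      have e3 : ∀ Z, curl A Z (X - W) (Y - P s) = curl A Z (X - W) (Y - W) := fun Z => by
        rw [← curl_add_smul_right Z (X - W) (Y - W) (-s)]
        congr 1
        simp only [hP, neg_smul]
        abel
      have e4 : ∀ Z, curl A Z (X - W) (W - P s) = 0 := fun Z => by
        have : W - P s = 0 + (-s) • (X - W) := by simp only [hP, neg_smul]; abel
        rw [this, curl_add_smul_right]
        simp [curl]
      simp only [e3] at e1
      simp only [e4, mul_zero, intervalIntegral.integral_zero] at e2
      linarith
    rw [e]
    exact abs_integral_curl_le fun t ht => hβ _ (segment_mem hm hY ht.1 ht.2) _ _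

/-- A segment in the boundary has a direction with zero last component, so the normal component of
`A` is not seen. The phase in the seminorm is thus one side of a triangle of the half-space. -/
theorem intPot_tangential (x y : EuclideanSpace ℝ (Fin d)) :
    intPot (tangential A) x y = intPot A (pt x 0) (pt y 0) := by
  unfold intPot
  refine intervalIntegral.integral_congr fun t _ => ?_
  have e1 : (1 - t) • pt x 0 + t • pt y 0 = pt ((1 - t) • x + t • y) 0 := by
    rw [← pt_smul, ← pt_smul, ← pt_add]; simp
  have e2 : pt y 0 - pt x 0 = pt (y - x) 0 := by rw [← pt_sub, sub_zero]
  simp only [e1, e2, tangential, boundaryPoint_eq]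
  simp only [PiLp.inner_apply, Fin.sum_univ_castSucc, pt_castSucc, pt_last]
  simp

end stokes

/-! ### Extension by reflection -/

section reflection

variable {d : ℕ} {F : Type*} [NormedAddCommGroup F] [NormedSpace ℝ F]

/-- Reflection with a dilation by `c` in the last coordinate. -/
def reflectL (d : ℕ) (c : ℝ) :
    EuclideanSpace ℝ (Fin (d + 1)) →L[ℝ] EuclideanSpace ℝ (Fin (d + 1)) :=
  (ptL (d := d)).comp ((baseL (d := d)).prod (-(c • EuclideanSpace.proj (𝕜 := ℝ) (Fin.last d))))

theorem reflectL_apply (c : ℝ) (X : EuclideanSpace ℝ (Fin (d + 1))) :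
    reflectL d c X = pt (base X) (-(c * X (Fin.last d))) := rfl

theorem reflectL_of_last_eq_zero (c : ℝ) {X : EuclideanSpace ℝ (Fin (d + 1))}
    (h : X (Fin.last d) = 0) : reflectL d c X = X :=
  ext_coord (by simp [reflectL_apply]) (by simp [reflectL_apply, h])

/-- The coefficients solve `a + b = 1` and `-(a + b/2) = 1`: a function built from these two
reflections matches both the value and the normal derivative on the boundary, while tangential
derivatives follow from the first equation. -/
theorem reflectL_comb : (-3 : ℝ) • reflectL d 1 + (4 : ℝ) • reflectL d (1 / 2)
    = ContinuousLinearMap.id ℝ (EuclideanSpace ℝ (Fin (d + 1))) := by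
  ext1 X
  refine ext_coord ?_ ?_
  · ext j
    simp [reflectL_apply]
    ring
  · simp [reflectL_apply]
    ring

theorem uniqueDiffOn_closedHalfSpace : UniqueDiffOn ℝ (closedHalfSpace d) := by
  refine uniqueDiffOn_convex convex_closedHalfSpace ⟨pt 0 1, ?_⟩
  exact mem_interior.2 ⟨halfSpace d, halfSpace_subset_closedHalfSpace, isOpen_halfSpace d,
    pt_mem_halfSpace.2 one_pos⟩

/-- A function of class `C¹` on the closed half-space extends to a function of class `C¹`. -/
theorem exists_contDiff_extension {f : EuclideanSpace ℝ (Fin (d + 1)) → F}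
    (hf : ContDiffOn ℝ 1 f (closedHalfSpace d)) :
    ∃ g, ContDiff ℝ 1 g ∧ EqOn g f (closedHalfSpace d) := by
  classical
  set S := closedHalfSpace d with hS
  set L : Set (EuclideanSpace ℝ (Fin (d + 1))) := {X | X (Fin.last d) ≤ 0} with hL
  set f' := fderivWithin ℝ f S with hf'
  have hd : ∀ X ∈ S, HasFDerivWithinAt f (f' X) S X := fun X hX =>
    (hf.differentiableOn one_ne_zero X hX).hasFDerivWithinAt
  have hc : ContinuousOn f' S :=
    hf.continuousOn_fderivWithin uniqueDiffOn_closedHalfSpace le_rfl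
  have hm : ∀ c : ℝ, 0 ≤ c → MapsTo (reflectL d c) L S := by
    intro c hc0 X hX
    have hX : X (Fin.last d) ≤ 0 := hX
    rw [reflectL_apply]
    exact pt_mem_closedHalfSpace (by nlinarith)
  -- Below the boundary the extension is a combination of the values at heights `|t|` and `|t| / 2`,
  -- a single reflection being only continuous up to first order.
  set g : EuclideanSpace ℝ (Fin (d + 1)) → F := fun X =>
    (-3 : ℝ) • f (reflectL d 1 X) + (4 : ℝ) • f (reflectL d (1 / 2) X) with hg
  set g' : EuclideanSpace ℝ (Fin (d + 1)) → EuclideanSpace ℝ (Fin (d + 1)) →L[ℝ] F := fun X =>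
    (-3 : ℝ) • (f' (reflectL d 1 X)).comp (reflectL d 1)
      + (4 : ℝ) • (f' (reflectL d (1 / 2) X)).comp (reflectL d (1 / 2)) with hg'
  have hgd : ∀ X ∈ L, HasFDerivWithinAt g (g' X) L X := fun X hX =>
    (((hd _ (hm 1 zero_le_one hX)).comp X (reflectL d 1).hasFDerivWithinAt
      (hm 1 zero_le_one)).const_smul (-3 : ℝ)).add
    (((hd _ (hm (1 / 2) (by norm_num) hX)).comp X (reflectL d (1 / 2)).hasFDerivWithinAt
      (hm (1 / 2) (by norm_num))).const_smul (4 : ℝ))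
  have hgc : ContinuousOn g' L := by
    have c1 := (hc.comp (reflectL d 1).continuous.continuousOn (hm 1 zero_le_one)).clm_comp
      (continuousOn_const (c := reflectL d 1))
    have c2 := (hc.comp (reflectL d (1 / 2)).continuous.continuousOn
      (hm (1 / 2) (by norm_num))).clm_comp (continuousOn_const (c := reflectL d (1 / 2)))
    exact (c1.const_smul (-3 : ℝ)).add (c2.const_smul (4 : ℝ))
  have e0 : ∀ X, X (Fin.last d) = 0 → f X = g X := by
    intro X hX
    simp only [hg, reflectL_of_last_eq_zero _ hX, ← add_smul]
    norm_num
  have e1 : ∀ X, X (Fin.last d) = 0 → f' X = g' X := by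
    intro X hX
    simp only [hg', reflectL_of_last_eq_zero _ hX, ← ContinuousLinearMap.comp_smul,
      ← ContinuousLinearMap.comp_add]
    rw [reflectL_comb]
    rfl
  refine ⟨fun X => if 0 ≤ X (Fin.last d) then f X else g X, ?_, fun X hX => if_pos hX⟩
  refine contDiff_one_iff_hasFDerivAt.2
    ⟨fun X => if 0 ≤ X (Fin.last d) then f' X else g' X, ?_, ?_⟩
  · refine continuous_if (fun X hX => e1 X ?_) ?_ ?_
    · exact (frontier_le_subset_eq continuous_const (by fun_prop) hX).symm
    · exact hc.mono isClosed_closedHalfSpace.closure_subset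
    · refine hgc.mono (closure_minimal ?_ (isClosed_le (by fun_prop) continuous_const))
      intro X hX
      exact (not_le.1 hX).le
  · intro X
    have hLc : IsClosed L := isClosed_le (by fun_prop) continuous_const
    rw [← hasFDerivWithinAt_univ]
    have hU : univ = S ∪ L := by
      refine (eq_univ_of_forall fun Y => ?_).symm
      exact le_total 0 (Y (Fin.last d))
    rw [hU]
    -- Derivatives within the two closed half-spaces glue to a full derivative, as the candidates
    -- agree on the common boundary; at a point outside one of the closed sets the corresponding
    -- condition is vacuous.
    refine HasFDerivWithinAt.union ?_ ?_
    · by_cases hX : X ∈ S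
      · refine ((hd X hX).congr (fun Y hY => if_pos hY) (if_pos hX)).congr_fderiv ?_
        exact (if_pos hX).symm
      · exact .of_notMem_closure (by rwa [isClosed_closedHalfSpace.closure_eq])
    · have hgl : ∀ Y ∈ L, (if 0 ≤ Y (Fin.last d) then f Y else g Y) = g Y := by
        intro Y hY
        split_ifs with h
        · exact e0 Y (le_antisymm hY h)
        · rfl
      by_cases hX : X ∈ L
      · refine ((hgd X hX).congr hgl (hgl X hX)).congr_fderiv ?_
        dsimp only
        split_ifs with h
        · exact (e1 X (le_antisymm hX h)).symm
        · rfl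
      · exact .of_notMem_closure (by rwa [hLc.closure_eq])

end reflection

/-! ### The exterior derivative and its pointwise bound -/

theorem oneForm_eq {n : ℕ} (A : EuclideanSpace ℝ (Fin n) → EuclideanSpace ℝ (Fin n))
    (X : EuclideanSpace ℝ (Fin n)) (v : Fin 1 → EuclideanSpace ℝ (Fin n)) :
    oneForm A X v = inner ℝ (A X) (v 0) := rfl

/-- This is the bridge from the exterior derivative of the statement to `curl`, in terms of which
all fluxes are computed. -/
theorem magneticField_apply {n : ℕ} {A : EuclideanSpace ℝ (Fin n) → EuclideanSpace ℝ (Fin n)}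
    {X : EuclideanSpace ℝ (Fin n)} (hA : DifferentiableAt ℝ A X)
    (v w : EuclideanSpace ℝ (Fin n)) : magneticField A X ![v, w] = curl A X v w := by
  have h1 : DifferentiableAt ℝ (oneForm A) X := by
    have : oneForm A = (ContinuousAlternatingMap.ofSubsingletonLIE (𝕜 := ℝ)
        (E := EuclideanSpace ℝ (Fin n)) (F := ℝ) (0 : Fin 1)) ∘ fun X => innerSL ℝ (A X) := rfl
    rw [this]
    exact (LinearIsometryEquiv.differentiable _).differentiableAt.comp X
      ((innerSL ℝ).differentiableAt.comp X hA)
  rw [magneticField, extDeriv_apply h1, Fin.sum_univ_two]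
  have h2 : ∀ a b : EuclideanSpace ℝ (Fin n),
      fderiv ℝ (fun X => inner ℝ (A X) a) X b = inner ℝ (fderiv ℝ A X b) a := by
    intro a b
    have := (hA.hasFDerivAt.inner ℝ (hasFDerivAt_const a X)).fderiv
    rw [this]
    simp [fderivInnerCLM_apply]
  simp only [oneForm_eq]
  simp [Fin.removeNth, h2, curl]
  ring

/-- An essential bound on a continuous field holds everywhere, and then up to the boundary by
closure. Boundary points matter because the triangles used have sides on the boundary. Derivatives
of `A` and `B` agree in the open half-space, where the two fields coincide near each point. -/
theorem fieldBound_of_magneticFieldNorm_le {d : ℕ}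
    {A B : EuclideanSpace ℝ (Fin (d + 1)) → EuclideanSpace ℝ (Fin (d + 1))}
    (hB : ContDiff ℝ 1 B) (hAB : EqOn B A (closedHalfSpace d)) {β : ℝ} (hβ : 0 ≤ β)
    (h : magneticFieldNorm A ≤ ENNReal.ofReal β) : FieldBound B β := by
  intro X hX v w
  rw [← closure_halfSpace] at hX
  refine closure_minimal (t := {X | |curl B X v w| ≤ β * ‖v‖ * ‖w‖}) ?_
    (isClosed_le (continuous_curl hB continuous_id continuous_const continuous_const).abs
      continuous_const) hX
  have h1 : ∀ᵐ X ∂volume.restrict (halfSpace d), |curl B X v w| ≤ β * ‖v‖ * ‖w‖ := by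
    rw [magneticFieldNorm, eLpNorm_exponent_top] at h
    filter_upwards [ae_le_eLpNormEssSup (f := magneticField A)
      (μ := volume.restrict (halfSpace d)), ae_restrict_mem measurableSet_halfSpace] with X hX hXm
    have e : B =ᶠ[nhds X] A := by
      filter_upwards [(isOpen_halfSpace d).mem_nhds hXm] with Y hY
      exact hAB (halfSpace_subset_closedHalfSpace hY)
    have hd : DifferentiableAt ℝ A X :=
      e.differentiableAt_iff.1 (hB.differentiable one_ne_zero X)
    have hc : curl B X v w = curl A X v w := by rw [curl, curl, e.fderiv_eq]
    have hn : ‖magneticField A X‖ ≤ β := by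
      have := hX.trans h
      rw [← ofReal_norm] at this
      exact (ENNReal.ofReal_le_ofReal_iff hβ).1 this
    rw [hc, ← magneticField_apply hd, ← Real.norm_eq_abs]
    refine ((magneticField A X).le_opNorm _).trans ?_
    rw [Fin.prod_univ_two]
    simp only [Matrix.cons_val_zero, Matrix.cons_val_one, ← mul_assoc]
    gcongr
  intro X hX
  by_contra hcon
  -- The set where the bound fails inside the half-space is open and null, hence empty.
  set O := {X | ¬ |curl B X v w| ≤ β * ‖v‖ * ‖w‖} ∩ halfSpace d with hO
  have hOo : IsOpen O := by
    refine IsOpen.inter ?_ (isOpen_halfSpace d)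
    simp only [not_le]
    exact isOpen_lt continuous_const
      (continuous_curl hB continuous_id continuous_const continuous_const).abs
  have h0 : volume O = 0 := by
    rw [ae_iff, Measure.restrict_apply' measurableSet_halfSpace] at h1
    exact h1
  have h2 := (hOo.measure_eq_zero_iff volume).1 h0
  exact (h2 ▸ (⟨hcon, hX⟩ : X ∈ O) : X ∈ (∅ : Set _))

end MagneticTrace

end

noncomputable section

namespace MagneticTrace

theorem eLpNorm_ofReal {α F : Type*} [MeasurableSpace α] [NormedAddCommGroup F] {p : ℝ}
    (hp : 0 < p) (g : α → F) (μ : Measure α) :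
    eLpNorm g (ENNReal.ofReal p) μ = (∫⁻ a, ‖g a‖ₑ ^ p ∂μ) ^ (1 / p) := by
  rw [eLpNorm_eq_lintegral_rpow_enorm_toReal (by simpa using hp) (by simp),
    ENNReal.toReal_ofReal hp.le]

theorem eLpNorm_ofReal_rpow {α F : Type*} [MeasurableSpace α] [NormedAddCommGroup F] {p : ℝ}
    (hp : 0 < p) (g : α → F) (μ : Measure α) :
    eLpNorm g (ENNReal.ofReal p) μ ^ p = ∫⁻ a, ‖g a‖ₑ ^ p ∂μ := by
  rw [eLpNorm_ofReal hp, ← ENNReal.rpow_mul, one_div_mul_cancel hp.ne', ENNReal.rpow_one]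

/-! ### Classical gradients and parallel transport -/

section transport

variable {n : ℕ} {A : EuclideanSpace ℝ (Fin n) → EuclideanSpace ℝ (Fin n)}
  {f : EuclideanSpace ℝ (Fin n) → ℂ}

/-- The classical gradient of a complex-valued function. -/
def grad (f : EuclideanSpace ℝ (Fin n) → ℂ) (X : EuclideanSpace ℝ (Fin n)) :
    EuclideanSpace ℂ (Fin n) :=
  WithLp.toLp 2 (fun j => fderiv ℝ f X (EuclideanSpace.single j 1))

@[simp] theorem grad_apply (X : EuclideanSpace ℝ (Fin n)) (j : Fin n) :
    grad f X j = fderiv ℝ f X (EuclideanSpace.single j 1) := rfl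

theorem covGradOf_apply (U : EuclideanSpace ℝ (Fin n) → ℂ)
    (V : EuclideanSpace ℝ (Fin n) → EuclideanSpace ℂ (Fin n)) (X : EuclideanSpace ℝ (Fin n))
    (j : Fin n) : covGradOf A U V X j = V X j + Complex.I * (A X j : ℂ) * U X := rfl

theorem continuous_grad (hf : ContDiff ℝ 1 f) : Continuous (grad f) := by
  refine (PiLp.continuous_toLp 2 _).comp (continuous_pi fun j => ?_)
  exact (hf.continuous_fderiv one_ne_zero).clm_apply continuous_const

theorem continuous_covGradOf (hA : Continuous A) (hf : ContDiff ℝ 1 f) :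
    Continuous (covGradOf A f (grad f)) := by
  refine (continuous_grad hf).add ((PiLp.continuous_toLp 2 _).comp (continuous_pi fun j => ?_))
  have h1 : Continuous fun X => A X j := by fun_prop
  have h2 := hf.continuous
  fun_prop

/-- The pairing of a complex vector with a real one is bounded by the product of the norms. -/
theorem norm_sum_mul_le (w : EuclideanSpace ℂ (Fin n)) (v : EuclideanSpace ℝ (Fin n)) :
    ‖∑ j, (v j : ℂ) * w j‖ ≤ ‖w‖ * ‖v‖ := by
  set v' : EuclideanSpace ℂ (Fin n) := WithLp.toLp 2 (fun j => (v j : ℂ)) with hv'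
  have h1 : ‖v'‖ = ‖v‖ := by
    rw [EuclideanSpace.norm_eq, EuclideanSpace.norm_eq]
    simp [hv']
  have h2 : inner ℂ v' w = ∑ j, (v j : ℂ) * w j := by
    simp [PiLp.inner_apply, hv', mul_comm]
  rw [← h1, ← h2, mul_comm]
  exact norm_inner_le_norm _ _

theorem clm_eq_sum {F : Type*} [NormedAddCommGroup F] [NormedSpace ℝ F]
    (L : EuclideanSpace ℝ (Fin n) →L[ℝ] F) (v : EuclideanSpace ℝ (Fin n)) :
    L v = ∑ j, v j • L (EuclideanSpace.single j 1) := by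
  conv_lhs => rw [← (EuclideanSpace.basisFun (Fin n) ℝ).sum_repr v]
  simp [map_sum]

/-- The left side is the pairing of the covariant gradient with `v`, so that Cauchy–Schwarz applies.
The connection term has to stay inside the norm: neither summand is controlled alone. -/
theorem norm_covariant_derivative_le (X v : EuclideanSpace ℝ (Fin n)) :
    ‖fderiv ℝ f X v + Complex.I * (inner ℝ (A X) v : ℝ) * f X‖
      ≤ ‖covGradOf A f (grad f) X‖ * ‖v‖ := by
  refine le_of_eq_of_le (congrArg _ ?_) (norm_sum_mul_le _ v)
  rw [clm_eq_sum (fderiv ℝ f X) v]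
  simp only [covGradOf_apply, grad_apply, mul_add, Finset.sum_add_distrib, PiLp.inner_apply]
  congr 1
  push_cast
  rw [Finset.mul_sum, Finset.sum_mul]
  refine Finset.sum_congr rfl fun j _ => ?_
  simp
  ring

theorem intPot_add_smul (X v : EuclideanSpace ℝ (Fin n)) (T : ℝ) :
    intPot A X (X + T • v) = ∫ τ in (0 : ℝ)..T, inner ℝ (A (X + τ • v)) v := by
  have := intervalIntegral.smul_integral_comp_mul_left
    (fun τ => inner ℝ (A (X + τ • v)) v) T (a := 0) (b := 1)
  simp only [mul_zero, mul_one] at this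
  rw [← this, intPot, ← intervalIntegral.integral_smul]
  refine intervalIntegral.integral_congr fun t _ => ?_
  have e : (1 - t) • X + t • (X + T • v) = X + (T * t) • v := by
    rw [mul_comm, mul_smul, smul_add, sub_smul, one_smul]
    abel
  simp only [e, add_sub_cancel_left, inner_smul_right, smul_eq_mul]

theorem norm_exp_I_mul (a : ℝ) : ‖Complex.exp (Complex.I * (a : ℂ))‖ = 1 := by
  rw [mul_comm, Complex.norm_exp_ofReal_mul_I]

theorem continuous_intPot_comp {α : Type*} [TopologicalSpace α] (hA : Continuous A)
    {f g : α → EuclideanSpace ℝ (Fin n)} (hf : Continuous f) (hg : Continuous g) :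
    Continuous fun a => intPot A (f a) (g a) := by
  have h := Continuous.comp (continuous_intPot hA) (hf.prodMk hg)
  exact h

/-- Parallel transport along a segment. -/
theorem enorm_transport_le (hA : ContDiff ℝ 1 A) (hf : ContDiff ℝ 1 f)
    (X v : EuclideanSpace ℝ (Fin n)) {T : ℝ} (hT : 0 ≤ T) :
    ‖Complex.exp (Complex.I * (intPot A X (X + T • v) : ℂ)) * f (X + T • v) - f X‖ₑ
      ≤ ‖v‖ₑ * ∫⁻ τ in Ioo 0 T, ‖covGradOf A f (grad f) (X + τ • v)‖ₑ := by
  have hAc := hA.continuous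
  have hfc := hf.continuous
  have hG := continuous_covGradOf hAc hf
  -- The phase `θ` is the circulation accumulated up to time `s`. Its derivative supplies the
  -- connection term, so the product with `f` has the covariant derivative of `f`, up to a factor of
  -- modulus one, as its derivative.
  set θ : ℝ → ℝ := fun s => ∫ τ in (0 : ℝ)..s, inner ℝ (A (X + τ • v)) v with hθ
  have hθd : ∀ s, HasDerivAt θ (inner ℝ (A (X + s • v)) v) s := fun s =>
    (Continuous.integral_hasStrictDerivAt (f := fun τ => inner ℝ (A (X + τ • v)) v)
      (by fun_prop) 0 s).hasDerivAt
  set h' : ℝ → ℂ := fun s => Complex.exp (Complex.I * (θ s : ℂ)) *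
    (fderiv ℝ f (X + s • v) v + Complex.I * (inner ℝ (A (X + s • v)) v : ℝ) * f (X + s • v))
    with hh'
  have hd : ∀ s, HasDerivAt (fun s => Complex.exp (Complex.I * (θ s : ℂ)) * f (X + s • v))
      (h' s) s := by
    intro s
    have d1 : HasDerivAt (fun s : ℝ => Complex.I * (θ s : ℂ))
        (Complex.I * (inner ℝ (A (X + s • v)) v : ℝ)) s :=
      (hθd s).ofReal_comp.const_mul Complex.I
    have d2 : HasDerivAt (fun s : ℝ => X + s • v) v s :=
      (((hasDerivAt_id s).smul_const v).const_add X).congr_deriv (by simp)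
    have d3 := ((hf.differentiable one_ne_zero) (X + s • v)).hasFDerivAt.comp_hasDerivAt s d2
    refine (d1.cexp.mul d3).congr_deriv ?_
    simp only [hh', Function.comp_apply]
    ring
  have hθc : Continuous θ := continuous_iff_continuousAt.2 fun s => (hθd s).continuousAt
  have hfd := hf.continuous_fderiv one_ne_zero
  have hc : Continuous h' := by
    have : Continuous fun s : ℝ => fderiv ℝ f (X + s • v) v :=
      (hfd.comp (by fun_prop)).clm_apply continuous_const
    fun_prop
  have key := intervalIntegral.integral_eq_sub_of_hasDerivAt (a := 0) (b := T)
    (fun s _ => hd s) (hc.intervalIntegrable _ _)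
  have hθ0 : θ 0 = 0 := by simp [hθ]
  simp only [hθ0, Complex.ofReal_zero, mul_zero, Complex.exp_zero, one_mul, zero_smul,
    add_zero] at key
  rw [intPot_add_smul, ← key, intervalIntegral.integral_of_le hT,
    ← Measure.restrict_congr_set Ioo_ae_eq_Ioc]
  refine (enorm_integral_le_lintegral_enorm _).trans ?_
  rw [← lintegral_const_mul' _ _ (by simp)]
  refine lintegral_mono fun s => ?_
  rw [← enorm_norm v, ← enorm_norm (covGradOf _ _ _ _), ← enorm_mul, enorm_le_iff_norm_le]
  rw [hh', norm_mul, norm_exp_I_mul, one_mul, Real.norm_of_nonneg (by positivity),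
    mul_comm ‖v‖]
  exact norm_covariant_derivative_le _ _

end transport

/-! ### Inequalities for phases and powers -/

theorem norm_exp_sub_exp_le (a b : ℝ) :
    ‖Complex.exp (Complex.I * (a : ℂ)) - Complex.exp (Complex.I * (b : ℂ))‖ ≤ |a - b| := by
  have e : Complex.exp (Complex.I * (a : ℂ)) - Complex.exp (Complex.I * (b : ℂ))
      = Complex.exp (Complex.I * (b : ℂ)) * (Complex.exp (Complex.I * ((a - b : ℝ) : ℂ)) - 1) := by
    rw [mul_sub, ← Complex.exp_add]
    push_cast
    ring_nf
  rw [e, norm_mul, norm_exp_I_mul, one_mul]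
  exact Real.norm_exp_I_mul_ofReal_sub_one_le

/-- The difference is at most `min 2 (q ^ 2)`, and this is at most `2 * q`. The interpolation turns
a flux of size `β r²` into an error of size `β^{1/2} r`, the power of `r` for which the Gagliardo
integral converges. -/
theorem norm_exp_sub_exp_le_sqrt {a b q : ℝ} (hq : 0 ≤ q) (h : |a - b| ≤ q ^ 2) :
    ‖Complex.exp (Complex.I * (a : ℂ)) - Complex.exp (Complex.I * (b : ℂ))‖ ≤ 2 * q := by
  have h1 := norm_exp_sub_exp_le a b
  have h2 := norm_sub_le (Complex.exp (Complex.I * (a : ℂ))) (Complex.exp (Complex.I * (b : ℂ)))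
  rw [norm_exp_I_mul, norm_exp_I_mul] at h2
  rcases le_total q 1 with h3 | h3 <;> nlinarith

theorem add_three_rpow_le {a b c : ℝ≥0∞} {p : ℝ} (hp : 0 ≤ p) :
    (a + b + c) ^ p ≤ 3 ^ p * (a ^ p + b ^ p + c ^ p) := by
  have h : a + b + c ≤ 3 * max (max a b) c := by
    have e : (3 : ℝ≥0∞) = 1 + 1 + 1 := by norm_num
    rw [e, add_mul, add_mul, one_mul]
    gcongr
    · exact (le_max_left a b).trans (le_max_left _ _)
    · exact (le_max_right a b).trans (le_max_left _ _)
    · exact le_max_right _ _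
  refine (ENNReal.rpow_le_rpow h hp).trans ?_
  rw [ENNReal.mul_rpow_of_nonneg _ _ hp]
  gcongr
  rcases le_total a b with h1 | h1 <;> rcases le_total (max a b) c with h2 | h2
  all_goals simp only [h1, max_eq_left, max_eq_right] at h2 ⊢
  all_goals first
    | rw [max_eq_right h2]; exact le_add_self
    | rw [max_eq_left h2]; rw [add_assoc]; first | exact le_self_add | skip
  exact le_add_left le_self_add

/-! ### Trace estimates for functions of class `C¹` -/

section classical

variable {d : ℕ} {A : EuclideanSpace ℝ (Fin (d + 1)) → EuclideanSpace ℝ (Fin (d + 1))} {β p : ℝ}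
  {f : EuclideanSpace ℝ (Fin (d + 1)) → ℂ}

/-- The difference between the transport of `U` to the boundary and `u`. -/
def stripDiff (A : EuclideanSpace ℝ (Fin (d + 1)) → EuclideanSpace ℝ (Fin (d + 1)))
    (U : EuclideanSpace ℝ (Fin (d + 1)) → ℂ) (u : EuclideanSpace ℝ (Fin d) → ℂ)
    (X : EuclideanSpace ℝ (Fin (d + 1))) : ℂ :=
  Complex.exp (Complex.I * (intPot A (pt (base X) 0) X : ℂ)) * U X - u (base X)

/-- Transport along a vertical line and Hölder's inequality on `(0, t)` bound the `p`-th power of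
the difference by `t^{p-1}` times the integral of `|∇_A f|^p` over the line; integrating over `0 < t
< T` yields `T^p`. The rate `T`, faster than the natural size `T^{1/p}` of a strip, is what later
makes traces unique. -/
theorem eLpNorm_stripDiff_le (hp : 1 < p) (hA : ContDiff ℝ 1 A) (hf : ContDiff ℝ 1 f) {T : ℝ}
    (hT : 0 < T) :
    eLpNorm (stripDiff A f fun x => f (pt x 0)) (ENNReal.ofReal p)
        (volume.restrict (slab d (Ioo 0 T)))
      ≤ ENNReal.ofReal T * eLpNorm (covGradOf A f (grad f)) (ENNReal.ofReal p)
        (volume.restrict (halfSpace d)) := by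
  have hp0 : 0 < p := by linarith
  have hG := continuous_covGradOf hA.continuous hf
  have hGm : Measurable fun X => ‖covGradOf A f (grad f) X‖ₑ ^ p := by fun_prop
  have hfc := hf.continuous
  have hm : Measurable fun X => ‖stripDiff A f (fun x => f (pt x 0)) X‖ₑ ^ p := by
    have h1 := continuous_intPot_comp hA.continuous
      (f := fun X : EuclideanSpace ℝ (Fin (d + 1)) => pt (base X) 0) (g := fun X => X)
      (by fun_prop) (by fun_prop)
    have h2 : Continuous (stripDiff A f (fun x => f (pt x 0))) := by
      unfold stripDiff
      fun_prop
    exact h2.measurable.enorm.pow_const p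
  rw [← ENNReal.rpow_le_rpow_iff hp0, ENNReal.mul_rpow_of_nonneg _ _ hp0.le,
    eLpNorm_ofReal_rpow hp0, eLpNorm_ofReal_rpow hp0, lintegral_slab measurableSet_Ioo hm,
    halfSpace_eq_slab, lintegral_slab measurableSet_Ioi hGm,
    ← lintegral_const_mul' _ _ (ENNReal.rpow_ne_top_of_nonneg hp0.le (by simp))]
  refine lintegral_mono fun x => ?_
  have key : ∀ t ∈ Ioo 0 T, ‖stripDiff A f (fun x => f (pt x 0)) (pt x t)‖ₑ ^ p
      ≤ ENNReal.ofReal T ^ (p - 1) *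
        ∫⁻ τ in Ioi 0, ‖covGradOf A f (grad f) (pt x τ)‖ₑ ^ p := by
    intro t ht
    have e : ∀ τ : ℝ, pt x 0 + τ • pt (0 : EuclideanSpace ℝ (Fin d)) 1 = pt x τ := by
      intro τ
      rw [← pt_smul, ← pt_add]
      simp
    have h1 := enorm_transport_le hA hf (pt x 0) (pt 0 1) ht.1.le
    simp only [e] at h1
    have h2 : ‖pt (0 : EuclideanSpace ℝ (Fin d)) 1‖ₑ = 1 := by
      rw [← ofReal_norm, norm_pt_zero_left]; simp
    rw [h2, one_mul] at h1
    have h3 : ‖stripDiff A f (fun x => f (pt x 0)) (pt x t)‖ₑ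
        ≤ ∫⁻ τ in Ioo 0 t, ‖covGradOf A f (grad f) (pt x τ)‖ₑ := by
      simpa [stripDiff] using h1
    refine (ENNReal.rpow_le_rpow h3 hp0.le).trans ((lintegral_rpow_le hp (by fun_prop)).trans ?_)
    rw [Measure.restrict_apply_univ, Real.volume_Ioo, sub_zero]
    refine mul_le_mul' (ENNReal.rpow_le_rpow (ENNReal.ofReal_le_ofReal ht.2.le)
      (by linarith)) (lintegral_mono_set Ioo_subset_Ioi_self)
  refine (setLIntegral_mono' measurableSet_Ioo key).trans (le_of_eq ?_)
  rw [setLIntegral_const, Real.volume_Ioo, sub_zero, mul_right_comm]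
  congr 1
  have h0 : ENNReal.ofReal T ≠ 0 := by simpa using hT
  nth_rewrite 2 [← ENNReal.rpow_one (ENNReal.ofReal T)]
  rw [← ENNReal.rpow_add _ _ h0 (by simp)]
  simp

/-- The first constant in the trace estimate. -/
def traceConst (d : ℕ) (p : ℝ) : ℝ≥0∞ :=
  3 ^ p * (2 * (2 ^ p * (weightConst p * (sphereMeasure d *
    ∫⁻ s in Ioo (0 : ℝ) 1, ENNReal.ofReal s ^ ((p - 3) / 2 : ℝ)))) + 4 ^ p * sphereMeasure d)

theorem traceConst_lt_top (d : ℕ) (hp : 1 < p) : traceConst d p < ⊤ := by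
  have h1 : ∫⁻ s in Ioo (0 : ℝ) 1, ENNReal.ofReal s ^ ((p - 3) / 2 : ℝ) < ⊤ :=
    lintegral_Ioo_rpow_lt_top (by linarith)
  have h2 := weightConst_lt_top hp
  have h3 := sphereMeasure_lt_top d
  have h4 : ∀ n : ℕ, (n : ℝ≥0∞) ^ p < ⊤ := fun n =>
    ENNReal.rpow_lt_top_of_nonneg (by linarith) (by simp)
  refine ENNReal.mul_lt_top (h4 3) (ENNReal.add_lt_top.2 ⟨ENNReal.mul_lt_top (by simp)
    (ENNReal.mul_lt_top (h4 2) (ENNReal.mul_lt_top h2 (ENNReal.mul_lt_top h3 h1))),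
    ENNReal.mul_lt_top (h4 4) h3⟩)

/-- A Hardy-type inequality. For each `s` the change of variables to points of the half-space costs
`s⁻¹`, which is not integrable at `0`. The weight in Hölder's inequality on `(0, 1)` improves it to
`s^{(p-3)/2}`, which is integrable precisely because `p > 1`. -/
theorem lintegral_midpoint_segment_le (hd : 1 ≤ d) (hp : 1 < p)
    {g : EuclideanSpace ℝ (Fin (d + 1)) → ℝ≥0∞} (hg : Measurable g) :
    ∫⁻ x : EuclideanSpace ℝ (Fin d), ∫⁻ y : EuclideanSpace ℝ (Fin d), ‖y - x‖ₑ ^ (1 - d : ℝ) *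
        (∫⁻ s in Ioo (0 : ℝ) 1, g (pt (x + (s / 2) • (y - x)) (s * ‖y - x‖))) ^ p
      ≤ weightConst p * (sphereMeasure d *
        ∫⁻ s in Ioo (0 : ℝ) 1, ENNReal.ofReal s ^ ((p - 3) / 2 : ℝ)) *
        ∫⁻ X in halfSpace d, g X ^ p := by
  have h1 : ∀ x y : EuclideanSpace ℝ (Fin d), ‖y - x‖ₑ ^ (1 - d : ℝ) *
        (∫⁻ s in Ioo (0 : ℝ) 1, g (pt (x + (s / 2) • (y - x)) (s * ‖y - x‖))) ^ p
      ≤ weightConst p * ∫⁻ s in Ioo (0 : ℝ) 1, ENNReal.ofReal s ^ ((p - 1) / 2 : ℝ) *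
        (‖y - x‖ₑ ^ (1 - d : ℝ) * g (pt (x + (s / 2) • (y - x)) (s * ‖y - x‖)) ^ p) := by
    intro x y
    refine (mul_le_mul_right (lintegral_Ioo_rpow_le hp (by fun_prop)) _).trans (le_of_eq ?_)
    rw [mul_left_comm, ← lintegral_const_mul _ (by fun_prop)]
    simp only [mul_left_comm]
  refine (lintegral_mono fun x => lintegral_mono fun y => h1 x y).trans ?_
  have hw := (weightConst_lt_top hp).ne
  simp only [lintegral_const_mul' _ _ hw]
  rw [mul_assoc]
  refine mul_le_mul_right ?_ _
  have h2 : ∀ x : EuclideanSpace ℝ (Fin d), ∫⁻ y : EuclideanSpace ℝ (Fin d),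
      ∫⁻ s in Ioo (0 : ℝ) 1, ENNReal.ofReal s ^ ((p - 1) / 2 : ℝ) *
        (‖y - x‖ₑ ^ (1 - d : ℝ) * g (pt (x + (s / 2) • (y - x)) (s * ‖y - x‖)) ^ p)
      = ∫⁻ s in Ioo (0 : ℝ) 1, ENNReal.ofReal s ^ ((p - 1) / 2 : ℝ) *
        ∫⁻ y : EuclideanSpace ℝ (Fin d),
        (‖y - x‖ₑ ^ (1 - d : ℝ) * g (pt (x + (s / 2) • (y - x)) (s * ‖y - x‖)) ^ p) := by
    intro x
    rw [lintegral_lintegral_swap (by fun_prop)]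
    refine lintegral_congr fun s => ?_
    rw [lintegral_const_mul _ (by fun_prop)]
  simp only [h2]
  have hm : Measurable fun z : EuclideanSpace ℝ (Fin d) × ℝ => ∫⁻ y : EuclideanSpace ℝ (Fin d),
        (‖y - z.1‖ₑ ^ (1 - d : ℝ) * g (pt (z.1 + (z.2 / 2) • (y - z.1)) (z.2 * ‖y - z.1‖)) ^ p) :=
    Measurable.lintegral_prod_right'
      (f := fun w : (EuclideanSpace ℝ (Fin d) × ℝ) × EuclideanSpace ℝ (Fin d) =>
        (‖w.2 - w.1.1‖ₑ ^ (1 - d : ℝ) *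
          g (pt (w.1.1 + (w.1.2 / 2) • (w.2 - w.1.1)) (w.1.2 * ‖w.2 - w.1.1‖)) ^ p))
      (by fun_prop)
  rw [lintegral_lintegral_swap (Measurable.aemeasurable (by
    exact Measurable.mul (by fun_prop) hm))]
  have h3 : ∀ s ∈ Ioo (0 : ℝ) 1, ∫⁻ x : EuclideanSpace ℝ (Fin d),
      ENNReal.ofReal s ^ ((p - 1) / 2 : ℝ) * ∫⁻ y : EuclideanSpace ℝ (Fin d),
        (‖y - x‖ₑ ^ (1 - d : ℝ) * g (pt (x + (s / 2) • (y - x)) (s * ‖y - x‖)) ^ p)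
      = ENNReal.ofReal s ^ ((p - 3) / 2 : ℝ) *
        (sphereMeasure d * ∫⁻ X in halfSpace d, g X ^ p) := by
    intro s hs
    have h0 : ENNReal.ofReal s ≠ 0 := by simpa using hs.1
    have hmx : Measurable fun x : EuclideanSpace ℝ (Fin d) => ∫⁻ y : EuclideanSpace ℝ (Fin d),
        (‖y - x‖ₑ ^ (1 - d : ℝ) * g (pt (x + (s / 2) • (y - x)) (s * ‖y - x‖)) ^ p) := by
      have h := Measurable.comp hm (measurable_prodMk_right (y := s))
      exact h
    rw [lintegral_const_mul _ hmx, lintegral_lintegral_midpoint hd hs.1 (F := fun X => g X ^ p)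
      (by fun_prop), mul_left_comm (sphereMeasure d), ← mul_assoc, ENNReal.ofReal_inv_of_pos hs.1,
      ← ENNReal.rpow_neg_one, ← ENNReal.rpow_add _ _ h0 (by simp)]
    congr 2
    ring
  rw [setLIntegral_congr_fun measurableSet_Ioo h3, lintegral_mul_const _ (by fun_prop)]
  refine le_of_eq ?_
  ring

/-- Both boundary points are transported to the common point `Z` above their midpoint, at height `‖y
- x‖`. The two slanted segments account for the first two terms; the third is the failure of the
triangle with vertices `(x, 0)`, `(y, 0)`, `Z` to have trivial holonomy. -/
theorem enorm_covDiff_le (hA : ContDiff ℝ 1 A) (hf : ContDiff ℝ 1 f) (hβ0 : 0 ≤ β)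
    (hβ : FieldBound A β) (x y : EuclideanSpace ℝ (Fin d)) :
    ‖covDiff (tangential A) (fun x => f (pt x 0)) x y‖ₑ
      ≤ 2 * ‖y - x‖ₑ * (∫⁻ s in Ioo (0 : ℝ) 1,
          ‖covGradOf A f (grad f) (pt (x + (s / 2) • (y - x)) (s * ‖y - x‖))‖ₑ)
        + 2 * ‖x - y‖ₑ * (∫⁻ s in Ioo (0 : ℝ) 1,
          ‖covGradOf A f (grad f) (pt (y + (s / 2) • (x - y)) (s * ‖x - y‖))‖ₑ)
        + 4 * ENNReal.ofReal (β ^ (1 / 2 : ℝ)) * ‖y - x‖ₑ *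
          ‖f (pt (x + ((1 : ℝ) / 2) • (y - x)) (1 * ‖y - x‖))‖ₑ := by
  set Z := pt (x + ((1 : ℝ) / 2) • (y - x)) (1 * ‖y - x‖) with hZ
  -- The point `Z` is symmetric in `x` and `y`, so one estimate along a slanted segment serves both
  -- ends.
  have hZ' : Z = pt (y + ((1 : ℝ) / 2) • (x - y)) (1 * ‖x - y‖) := by
    rw [hZ, norm_sub_rev]
    congr 1
    module
  have seg : ∀ (x y : EuclideanSpace ℝ (Fin d)) (τ : ℝ),
      pt x 0 + τ • pt (((1 : ℝ) / 2) • (y - x)) ‖y - x‖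
        = pt (x + (τ / 2) • (y - x)) (τ * ‖y - x‖) := by
    intro x y τ
    rw [← pt_smul, ← pt_add, smul_smul, zero_add]
    congr 3
    ring
  -- The triangle inequality gives `3/2` in place of `√5 / 2`; below it is rounded up to `2`.
  have hv : ∀ x y : EuclideanSpace ℝ (Fin d),
      ‖pt (((1 : ℝ) / 2) • (y - x)) ‖y - x‖‖ ≤ 3 / 2 * ‖y - x‖ := by
    intro x y
    refine (norm_pt_le _ _).trans (le_of_eq ?_)
    rw [norm_smul, abs_norm]
    norm_num
    ring
  have tr : ∀ x y : EuclideanSpace ℝ (Fin d),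
      ‖Complex.exp (Complex.I * (intPot A (pt x 0)
          (pt (x + ((1 : ℝ) / 2) • (y - x)) (1 * ‖y - x‖)) : ℂ)) *
          f (pt (x + ((1 : ℝ) / 2) • (y - x)) (1 * ‖y - x‖)) - f (pt x 0)‖ₑ
        ≤ 2 * ‖y - x‖ₑ * ∫⁻ s in Ioo (0 : ℝ) 1,
          ‖covGradOf A f (grad f) (pt (x + (s / 2) • (y - x)) (s * ‖y - x‖))‖ₑ := by
    intro x y
    have h := enorm_transport_le hA hf (pt x 0) (pt (((1 : ℝ) / 2) • (y - x)) ‖y - x‖)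
      zero_le_one
    simp only [seg] at h
    refine h.trans (mul_le_mul_left ?_ _)
    have e2 : 2 * ENNReal.ofReal ‖y - x‖ = ENNReal.ofReal (2 * ‖y - x‖) := by
      rw [ENNReal.ofReal_mul (by norm_num)]; simp
    rw [← ofReal_norm, ← ofReal_norm, e2]
    refine ENNReal.ofReal_le_ofReal ((hv x y).trans ?_)
    nlinarith [norm_nonneg (y - x)]
  have h1 := tr x y
  have h2 := tr y x
  rw [← hZ] at h1
  rw [← hZ'] at h2
  have dist : ∀ x y : EuclideanSpace ℝ (Fin d),
      ‖pt x 0 - pt (x + ((1 : ℝ) / 2) • (y - x)) (1 * ‖y - x‖)‖ ≤ 3 / 2 * ‖y - x‖ := by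
    intro x y
    have e := seg x y 1
    rw [← e, one_smul, sub_add_cancel_left, norm_neg]
    exact hv x y
  have dx := dist x y
  have dy := dist y x
  rw [← hZ] at dx
  rw [← hZ', norm_sub_rev x y] at dy
  have hc := abs_circulation_le hA hβ (X := pt x 0) (Y := pt y 0) (W := Z)
    (pt_mem_closedHalfSpace le_rfl) (pt_mem_closedHalfSpace le_rfl)
    (pt_mem_closedHalfSpace (by positivity))
  -- The flux is at most `4 β ‖y - x‖²`, written as a square so that the interpolated bound on
  -- phases applies.
  have hq : |(intPot A (pt x 0) (pt y 0) + intPot A (pt y 0) Z) - intPot A (pt x 0) Z|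
      ≤ (2 * (β ^ (1 / 2 : ℝ) * ‖y - x‖)) ^ 2 := by
    rw [intPot_symm (pt x 0) Z] at hc
    rw [sub_eq_add_neg]
    refine hc.trans ?_
    have hs : (β ^ (1 / 2 : ℝ)) ^ 2 = β := by
      rw [← Real.rpow_natCast, ← Real.rpow_mul hβ0]; norm_num
    have e : (2 * (β ^ (1 / 2 : ℝ) * ‖y - x‖)) ^ 2 = β * (2 * ‖y - x‖) * (2 * ‖y - x‖) := by
      rw [mul_pow, mul_pow, hs]; ring
    rw [e]
    have := norm_nonneg (y - x)
    gcongr <;> linarith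
  have h3 := norm_exp_sub_exp_le_sqrt (by positivity) hq
  -- The increment telescopes into the two transports to `Z`, the second carried back from `y` to
  -- `x`, and the holonomy defect acting on `f Z`.
  have hD : covDiff (tangential A) (fun x => f (pt x 0)) x y
      = (Complex.exp (Complex.I * (intPot A (pt x 0) Z : ℂ)) * f Z - f (pt x 0))
        - Complex.exp (Complex.I * (intPot A (pt x 0) (pt y 0) : ℂ)) *
          (Complex.exp (Complex.I * (intPot A (pt y 0) Z : ℂ)) * f Z - f (pt y 0))
        + (Complex.exp (Complex.I * ((intPot A (pt x 0) (pt y 0) + intPot A (pt y 0) Z : ℝ) : ℂ))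
          - Complex.exp (Complex.I * (intPot A (pt x 0) Z : ℂ))) * f Z := by
    rw [covDiff, intPot_tangential]
    push_cast
    rw [mul_add Complex.I, Complex.exp_add]
    ring
  rw [hD]
  refine (enorm_add_le _ _).trans (add_le_add ((enorm_sub_le).trans (add_le_add h1 ?_)) ?_)
  · rw [enorm_mul]
    have : ‖Complex.exp (Complex.I * (intPot A (pt x 0) (pt y 0) : ℂ))‖ₑ = 1 := by
      rw [← ofReal_norm, norm_exp_I_mul]; simp
    rw [this, one_mul]
    exact h2
  · rw [enorm_mul]
    refine mul_le_mul_left ?_ _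
    have e4 : (4 : ℝ≥0∞) = ENNReal.ofReal 4 := by simp
    rw [← ofReal_norm, ← ofReal_norm, e4, ← ENNReal.ofReal_mul (by norm_num),
      ← ENNReal.ofReal_mul (by positivity)]
    refine ENNReal.ofReal_le_ofReal (h3.trans (le_of_eq ?_))
    ring

/-- The Gagliardo exponent is `d + p - 1`, so the factor `‖y - x‖ ^ p` gained by every term leaves
the weight suited to polar coordinates. -/
theorem rpow_div_rpow_eq {p : ℝ} (hp : 1 < p) {x y : EuclideanSpace ℝ (Fin d)} (h : y ≠ x) :
    ‖y - x‖ₑ ^ p / ‖y - x‖ₑ ^ ((d : ℝ) + (1 - 1 / p) * p) = ‖y - x‖ₑ ^ (1 - d : ℝ) := by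
  have h0 : ‖y - x‖ₑ ≠ 0 := by simpa [sub_eq_zero] using h
  rw [← ENNReal.rpow_sub _ _ h0 (by simp)]
  congr 1
  field_simp
  ring

theorem lintegral_covDiff_le (hd : 1 ≤ d) (hp : 1 < p) (hA : ContDiff ℝ 1 A)
    (hf : ContDiff ℝ 1 f) (hβ0 : 0 ≤ β) (hβ : FieldBound A β) :
    ∫⁻ x, ∫⁻ y, ‖covDiff (tangential A) (fun x => f (pt x 0)) x y‖ₑ ^ p
        / ‖y - x‖ₑ ^ ((d : ℝ) + (1 - 1 / p) * p)
      ≤ traceConst d p * ((∫⁻ X in halfSpace d, ‖covGradOf A f (grad f) X‖ₑ ^ p)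
        + ENNReal.ofReal (β ^ (1 / 2 : ℝ)) ^ p * ∫⁻ X in halfSpace d, ‖f X‖ₑ ^ p) := by
  have hp0 : 0 < p := by linarith
  have hG := continuous_covGradOf hA.continuous hf
  have hfc := hf.continuous
  obtain ⟨S, hS⟩ : ∃ S : EuclideanSpace ℝ (Fin d) → EuclideanSpace ℝ (Fin d) → ℝ≥0∞,
      ∀ x y, S x y = ∫⁻ s in Ioo (0 : ℝ) 1,
        ‖covGradOf A f (grad f) (pt (x + (s / 2) • (y - x)) (s * ‖y - x‖))‖ₑ :=
    ⟨_, fun _ _ => rfl⟩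
  obtain ⟨R, hR⟩ : ∃ R : EuclideanSpace ℝ (Fin d) → EuclideanSpace ℝ (Fin d) → ℝ≥0∞,
      ∀ x y, R x y = ‖f (pt (x + ((1 : ℝ) / 2) • (y - x)) (1 * ‖y - x‖))‖ₑ :=
    ⟨_, fun _ _ => rfl⟩
  set J : EuclideanSpace ℝ (Fin d) → EuclideanSpace ℝ (Fin d) → ℝ≥0∞ := fun x y =>
    ‖y - x‖ₑ ^ (1 - d : ℝ) * S x y ^ p with hJ
  set H : EuclideanSpace ℝ (Fin d) → EuclideanSpace ℝ (Fin d) → ℝ≥0∞ := fun x y =>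
    ‖y - x‖ₑ ^ (1 - d : ℝ) * R x y ^ p with hH
  set b := ENNReal.ofReal (β ^ (1 / 2 : ℝ)) with hb
  have key : ∀ x y, ‖covDiff (tangential A) (fun x => f (pt x 0)) x y‖ₑ ^ p
        / ‖y - x‖ₑ ^ ((d : ℝ) + (1 - 1 / p) * p)
      ≤ 3 ^ p * (2 ^ p * J x y + 2 ^ p * J y x + 4 ^ p * b ^ p * H x y) := by
    intro x y
    by_cases h : y = x
    · subst h
      simp [covDiff, intPot_self, hp0]
    · have h0 := enorm_covDiff_le hA hf hβ0 hβ x y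
      rw [← hS, ← hS, ← hR, ← hb] at h0
      have h1 := (ENNReal.rpow_le_rpow h0 hp0.le).trans (add_three_rpow_le hp0.le)
      refine (ENNReal.div_le_div_right h1 _).trans (le_of_eq ?_)
      simp only [ENNReal.mul_rpow_of_nonneg _ _ hp0.le, hJ, hH]
      rw [← enorm_neg (x - y), neg_sub, ← rpow_div_rpow_eq hp h]
      simp only [div_eq_mul_inv]
      generalize ‖y - x‖ₑ ^ p = a1
      generalize (‖y - x‖ₑ ^ ((d : ℝ) + (1 - 1 * p⁻¹) * p))⁻¹ = a2
      ring
  have hgm : Measurable fun X => ‖covGradOf A f (grad f) X‖ₑ := by fun_prop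
  have hSm : Measurable fun z : EuclideanSpace ℝ (Fin d) × EuclideanSpace ℝ (Fin d) =>
      S z.1 z.2 := by
    simp only [hS]
    exact Measurable.lintegral_prod_right'
      (f := fun w : (EuclideanSpace ℝ (Fin d) × EuclideanSpace ℝ (Fin d)) × ℝ =>
        ‖covGradOf A f (grad f)
          (pt (w.1.1 + (w.2 / 2) • (w.1.2 - w.1.1)) (w.2 * ‖w.1.2 - w.1.1‖))‖ₑ)
      (hgm.comp (by fun_prop : Measurable fun w : (EuclideanSpace ℝ (Fin d) ×
        EuclideanSpace ℝ (Fin d)) × ℝ =>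
          pt (w.1.1 + (w.2 / 2) • (w.1.2 - w.1.1)) (w.2 * ‖w.1.2 - w.1.1‖)))
  have hJm : Measurable fun z : EuclideanSpace ℝ (Fin d) × EuclideanSpace ℝ (Fin d) =>
      J z.1 z.2 := by
    exact Measurable.mul (by fun_prop) (hSm.pow_const p)
  have hJ1 : ∫⁻ x, ∫⁻ y, J x y ≤ weightConst p * (sphereMeasure d *
        ∫⁻ s in Ioo (0 : ℝ) 1, ENNReal.ofReal s ^ ((p - 3) / 2 : ℝ)) *
        ∫⁻ X in halfSpace d, ‖covGradOf A f (grad f) X‖ₑ ^ p := by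
    simp only [hJ, hS]
    exact lintegral_midpoint_segment_le hd hp hgm
  -- Exchanging `x` and `y` identifies the contributions of the two slanted segments.
  have hJ2 : ∫⁻ x, ∫⁻ y, J y x = ∫⁻ x, ∫⁻ y, J x y :=
    lintegral_lintegral_swap (hJm.comp measurable_swap).aemeasurable
  have hH1 : ∫⁻ x, ∫⁻ y, H x y = sphereMeasure d * (ENNReal.ofReal 1⁻¹ *
      ∫⁻ X in halfSpace d, ‖f X‖ₑ ^ p) := by
    simp only [hH, hR]
    exact lintegral_lintegral_midpoint hd one_pos (F := fun X => ‖f X‖ₑ ^ p) (by fun_prop)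
  have hHm : Measurable fun z : EuclideanSpace ℝ (Fin d) × EuclideanSpace ℝ (Fin d) =>
      H z.1 z.2 := by
    simp only [hH, hR]
    fun_prop
  clear_value J H
  have s1 : ∀ x, Measurable fun y => J x y := fun x => hJm.comp measurable_prodMk_left
  have s2 : ∀ x, Measurable fun y => J y x := fun x => hJm.comp measurable_prodMk_right
  have s3 : ∀ x, Measurable fun y => H x y := fun x => hHm.comp measurable_prodMk_left
  have t1 : Measurable fun x => ∫⁻ y, J x y := hJm.lintegral_prod_right'
  have t2 : Measurable fun x => ∫⁻ y, J y x := hJm.lintegral_prod_left'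
  have t3 : Measurable fun x => ∫⁻ y, H x y := hHm.lintegral_prod_right'
  refine (lintegral_mono fun x => lintegral_mono fun y => key x y).trans ?_
  have e : ∀ x, ∫⁻ y, 3 ^ p * (2 ^ p * J x y + 2 ^ p * J y x + 4 ^ p * b ^ p * H x y)
      = 3 ^ p * (2 ^ p * (∫⁻ y, J x y) + 2 ^ p * (∫⁻ y, J y x)
        + 4 ^ p * b ^ p * ∫⁻ y, H x y) := by
    intro x
    have r1 := s1 x
    have r2 := s2 x
    have r3 := s3 x
    rw [lintegral_const_mul _ (by fun_prop), lintegral_add_left (by fun_prop),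
      lintegral_add_left (by fun_prop), lintegral_const_mul _ r1, lintegral_const_mul _ r2,
      lintegral_const_mul _ r3]
  simp only [e]
  rw [lintegral_const_mul _ (by fun_prop), lintegral_add_left (by fun_prop),
    lintegral_add_left (by fun_prop), lintegral_const_mul _ t1, lintegral_const_mul _ t2,
    lintegral_const_mul _ t3, hJ2, hH1]
  rw [traceConst, mul_assoc (3 ^ p)]
  refine mul_le_mul_of_nonneg_left ?_ (zero_le : (0 : ℝ≥0∞) ≤ 3 ^ p)
  refine (add_le_add (add_le_add (mul_le_mul_right hJ1 (2 ^ p)) (mul_le_mul_right hJ1 (2 ^ p)))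
    le_rfl).trans ?_
  simp only [inv_one, ENNReal.ofReal_one, one_mul]
  rw [mul_add, ← two_mul, add_mul, add_mul]
  refine add_le_add (le_add_right (le_of_eq (by ring))) (le_add_left (le_of_eq (by ring)))

/-- The trace inequality for the seminorm. -/
theorem gagliardo_le (hd : 1 ≤ d) (hp : 1 < p) (hA : ContDiff ℝ 1 A)
    (hf : ContDiff ℝ 1 f) (hβ0 : 0 ≤ β) (hβ : FieldBound A β) :
    gagliardo (tangential A) (1 - 1 / p) p (fun x => f (pt x 0))
      ≤ traceConst d p ^ (1 / p) *
        (eLpNorm (covGradOf A f (grad f)) (ENNReal.ofReal p) (volume.restrict (halfSpace d))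
        + ENNReal.ofReal (β ^ (1 / 2 : ℝ)) *
          eLpNorm f (ENNReal.ofReal p) (volume.restrict (halfSpace d))) := by
  have hp0 : 0 < p := by linarith
  have hq : 0 ≤ 1 / p := by positivity
  refine (ENNReal.rpow_le_rpow (lintegral_covDiff_le hd hp hA hf hβ0 hβ) hq).trans ?_
  rw [ENNReal.mul_rpow_of_nonneg _ _ hq]
  -- The power `1 / p ≤ 1` is subadditive, which turns the sum of `p`-th powers into a sum of norms
  -- without any constant.
  refine mul_le_mul_right ((ENNReal.rpow_add_le_add_rpow _ _ hq ?_).trans (le_of_eq ?_)) _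
  · rw [div_le_one hp0]; exact hp.le
  · rw [eLpNorm_ofReal hp0, eLpNorm_ofReal hp0, ENNReal.mul_rpow_of_nonneg _ _ hq,
      ← ENNReal.rpow_mul, mul_one_div_cancel hp0.ne', ENNReal.rpow_one]

end classical

end MagneticTrace

end

noncomputable section

namespace MagneticTrace

/-! ### Real vectors as complex vectors -/

section cvec

variable {n : ℕ}

/-- A real vector seen as a complex vector. -/
def cvec (v : EuclideanSpace ℝ (Fin n)) : EuclideanSpace ℂ (Fin n) :=
  WithLp.toLp 2 (fun j => (v j : ℂ))

@[simp] theorem cvec_apply (v : EuclideanSpace ℝ (Fin n)) (j : Fin n) : cvec v j = (v j : ℂ) := rfl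

@[simp] theorem norm_cvec (v : EuclideanSpace ℝ (Fin n)) : ‖cvec v‖ = ‖v‖ := by
  rw [EuclideanSpace.norm_eq, EuclideanSpace.norm_eq]
  simp

@[fun_prop]
theorem continuous_cvec : Continuous (cvec (n := n)) :=
  (PiLp.continuous_toLp 2 _).comp (continuous_pi fun j => by fun_prop)

theorem covGradOf_eq (A : EuclideanSpace ℝ (Fin n) → EuclideanSpace ℝ (Fin n))
    (U : EuclideanSpace ℝ (Fin n) → ℂ)
    (V : EuclideanSpace ℝ (Fin n) → EuclideanSpace ℂ (Fin n)) (X : EuclideanSpace ℝ (Fin n)) :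
    covGradOf A U V X = V X + (Complex.I * U X) • cvec (A X) := by
  ext j
  simp [covGradOf]
  ring

theorem gradient_apply (η : EuclideanSpace ℝ (Fin n) → ℝ) (X : EuclideanSpace ℝ (Fin n))
    (j : Fin n) : gradient η X j = fderiv ℝ η X (EuclideanSpace.single j 1) := by
  rw [← toDual_gradient, InnerProductSpace.toDual_apply_apply, EuclideanSpace.inner_single_right]
  simp

theorem norm_gradient (η : EuclideanSpace ℝ (Fin n) → ℝ) (X : EuclideanSpace ℝ (Fin n)) :
    ‖gradient η X‖ = ‖fderiv ℝ η X‖ := by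
  rw [← toDual_gradient, LinearIsometryEquiv.norm_map]

theorem continuous_gradient {η : EuclideanSpace ℝ (Fin n) → ℝ} (hη : ContDiff ℝ 1 η) :
    Continuous (gradient η) :=
  (InnerProductSpace.toDual ℝ _).symm.continuous.comp (hη.continuous_fderiv one_ne_zero)

end cvec

/-! ### Weak gradients -/

section weak

variable {n : ℕ} {Ω : Set (EuclideanSpace ℝ (Fin n))}

theorem setIntegral_eq_integral_of_tsupport {F : Type*} [NormedAddCommGroup F] [NormedSpace ℝ F]
    {ψ : EuclideanSpace ℝ (Fin n) → ℝ} (hs : tsupport ψ ⊆ Ω) (g : EuclideanSpace ℝ (Fin n) → F) :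
    ∫ X in Ω, ψ X • g X = ∫ X, ψ X • g X := by
  refine setIntegral_eq_integral_of_forall_compl_eq_zero ?_
  intro X hX
  rw [image_eq_zero_of_notMem_tsupport (fun hh => hX (hs hh)), zero_smul]

/-- A function of class `C¹` has its classical gradient as a weak gradient. -/
theorem hasWeakGradient_grad {f : EuclideanSpace ℝ (Fin n) → ℂ} (hf : ContDiff ℝ 1 f)
    (Ω : Set (EuclideanSpace ℝ (Fin n))) : HasWeakGradient Ω f (grad f) := by
  have l1 : LocallyIntegrable f := hf.continuous.locallyIntegrable
  have l2 : LocallyIntegrable (grad f) := (continuous_grad hf).locallyIntegrable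
  refine ⟨l1.locallyIntegrableOn _, l2.locallyIntegrableOn _, fun φ h1 h2 h3 j => ?_⟩
  have h4 : tsupport (fun X => fderiv ℝ φ X (EuclideanSpace.single j 1)) ⊆ Ω :=
    (tsupport_fderiv_apply_subset ℝ _).trans h3
  rw [setIntegral_eq_integral_of_tsupport h4, setIntegral_eq_integral_of_tsupport h3]
  set v : EuclideanSpace ℝ (Fin n) := EuclideanSpace.single j 1 with hv
  have hc : HasCompactSupport fun X => fderiv ℝ φ X v := h2.fderiv_apply ℝ _
  have hd := continuous_fderiv_apply' h1 v
  have hgj : Continuous fun X => fderiv ℝ f X v :=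
    (hf.continuous_fderiv one_ne_zero).clm_apply continuous_const
  have i1 : Integrable fun X => fderiv ℝ φ X v • f X :=
    (hd.smul hf.continuous).integrable_of_hasCompactSupport hc.smul_right
  have i2 : Integrable fun X => φ X • fderiv ℝ f X v :=
    (h1.continuous.smul hgj).integrable_of_hasCompactSupport h2.smul_right
  have i3 : Integrable fun X => φ X • f X :=
    (h1.continuous.smul hf.continuous).integrable_of_hasCompactSupport h2.smul_right
  have := integral_smul_fderiv_eq_neg_fderiv_smul_of_integrable i1 i2 i3
    (fun X _ => (h1.differentiable (by simp)) X) (fun X _ => (hf.differentiable one_ne_zero) X)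
  simp only [grad_apply]
  rw [this, neg_neg]

/-- The product rule for weak gradients. -/
theorem HasWeakGradient.smul_contDiff (hΩ : IsOpen Ω) {U : EuclideanSpace ℝ (Fin n) → ℂ}
    {V : EuclideanSpace ℝ (Fin n) → EuclideanSpace ℂ (Fin n)} (h : HasWeakGradient Ω U V)
    {η : EuclideanSpace ℝ (Fin n) → ℝ} (hη : ContDiff ℝ ∞ η) :
    HasWeakGradient Ω (fun X => η X • U X) (fun X => η X • V X + U X • cvec (gradient η X)) := by
  have hη1 : ContDiff ℝ 1 η := hη.of_le (by simp)
  have lc := hΩ.isLocallyClosed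
  have hgr : Continuous fun X => cvec (gradient η X) :=
    continuous_cvec.comp (continuous_gradient hη1)
  refine ⟨h.1.continuousOn_smul lc hη.continuous.continuousOn,
    (h.2.1.continuousOn_smul lc hη.continuous.continuousOn).add
      (h.1.smul_continuousOn lc hgr.continuousOn), fun φ h1 h2 h3 j => ?_⟩
  set v : EuclideanSpace ℝ (Fin n) := EuclideanSpace.single j 1 with hv
  have hd := continuous_fderiv_apply' h1 v
  have hdη := continuous_fderiv_apply' hη v
  have hc : HasCompactSupport fun X => fderiv ℝ φ X v := h2.fderiv_apply ℝ _
  have h4 : tsupport (fun X => fderiv ℝ φ X v) ⊆ Ω :=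
    (tsupport_fderiv_apply_subset ℝ _).trans h3
  -- The weak gradient is tested against `φ η`; the term in which the derivative falls on `η`
  -- becomes the second part of the new gradient.
  have key := h.2.2 (fun X => φ X * η X) (h1.mul hη) h2.mul_right
    ((closure_mono (Function.support_mul_subset_left _ _)).trans h3) j
  rw [← hv] at key
  have e1 : ∀ X, fderiv ℝ (fun X => φ X * η X) X v = φ X * fderiv ℝ η X v + fderiv ℝ φ X v * η X := by
    intro X
    rw [fderiv_fun_mul (h1.differentiable (by simp) X) (hη.differentiable (by simp) X)]
    simp [mul_comm]
  have i1 : IntegrableOn (fun X => (φ X * fderiv ℝ η X v) • U X) Ω :=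
    integrableOn_smul_of_tsupport h.1 (h1.continuous.mul hdη) h2.mul_right
      ((closure_mono (Function.support_mul_subset_left _ _)).trans h3)
  have i2 : IntegrableOn (fun X => (fderiv ℝ φ X v * η X) • U X) Ω :=
    integrableOn_smul_of_tsupport h.1 (hd.mul hη.continuous) hc.mul_right
      ((closure_mono (Function.support_mul_subset_left _ _)).trans h4)
  have i3 : IntegrableOn (fun X => (φ X * η X) • V X j) Ω :=
    integrableOn_smul_of_tsupport (locallyIntegrableOn_coord h.2.1 j)
      (h1.continuous.mul hη.continuous) h2.mul_right
      ((closure_mono (Function.support_mul_subset_left _ _)).trans h3)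
  simp only [e1, add_smul] at key
  rw [integral_add i1 i2] at key
  have e2 : ∫ X in Ω, φ X • (η X • V X + U X • cvec (gradient η X)) j
      = (∫ X in Ω, (φ X * η X) • V X j) + ∫ X in Ω, (φ X * fderiv ℝ η X v) • U X := by
    rw [← integral_add i3 i1]
    refine integral_congr_ae (Filter.Eventually.of_forall fun X => ?_)
    simp only [PiLp.add_apply, PiLp.smul_apply, cvec_apply, gradient_apply, ← hv]
    simp only [Complex.real_smul, smul_eq_mul]
    push_cast
    ring
  have e3 : ∫ X in Ω, fderiv ℝ φ X v • η X • U X = ∫ X in Ω, (fderiv ℝ φ X v * η X) • U X := by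
    simp only [mul_smul]
  rw [e2, e3, neg_add, ← key]
  ring

/-- The Leibniz rule for the covariant gradient: the potential term commutes with multiplication by
a real function, so only the gradient of `η` is added. -/
theorem covGradOf_smul_contDiff (A : EuclideanSpace ℝ (Fin n) → EuclideanSpace ℝ (Fin n))
    (U : EuclideanSpace ℝ (Fin n) → ℂ)
    (V : EuclideanSpace ℝ (Fin n) → EuclideanSpace ℂ (Fin n))
    (η : EuclideanSpace ℝ (Fin n) → ℝ) (X : EuclideanSpace ℝ (Fin n)) :
    covGradOf A (fun X => η X • U X) (fun X => η X • V X + U X • cvec (gradient η X)) X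
      = η X • covGradOf A U V X + U X • cvec (gradient η X) := by
  ext j
  simp [covGradOf]
  ring

end weak

/-! ### Mollification in `L^p` -/

section mollify

variable {E F : Type*} [NormedAddCommGroup E] [NormedSpace ℝ E] [FiniteDimensional ℝ E]
  [MeasurableSpace E] [BorelSpace E] {μ : Measure E} [μ.IsAddHaarMeasure]
  [NormedAddCommGroup F]

/-- Translations are continuous in `L^p`. -/
theorem exists_eLpNorm_translate_le {q : ℝ≥0∞} (hq1 : 1 ≤ q) (hq : q ≠ ⊤) {f : E → F}
    (hf : MemLp f q μ) {ε : ℝ} (hε : 0 < ε) :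
    ∃ δ > 0, ∀ t : E, ‖t‖ < δ → eLpNorm (fun x => f (x - t) - f x) q μ ≤ ENNReal.ofReal ε := by
  have : Fact (1 ≤ q) := ⟨hq1⟩
  have hc : Continuous fun t : E => (⟨fun x => x - t, by fun_prop⟩ : C(E, E)) :=
    ContinuousMap.continuous_of_continuous_uncurry _
      (show Continuous fun z : E × E => z.2 - z.1 by fun_prop)
  have hmp : ∀ t : E, MeasurePreserving (fun x => x - t) μ μ := fun t =>
    measurePreserving_sub_right μ t
  have hcont := (continuous_const (y := hf.toLp f)).compMeasurePreservingLp hc hmp hq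
  have h0 := Metric.continuous_iff.1 hcont 0 ε hε
  obtain ⟨δ, hδ, h⟩ := h0
  refine ⟨δ, hδ, fun t ht => ?_⟩
  have h1 := (h t (by simpa using ht)).le
  rw [Lp.dist_def] at h1
  have e1 : (Lp.compMeasurePreserving (fun x => x - t) (hmp t) (hf.toLp f) : E → F)
      =ᵐ[μ] fun x => f (x - t) := by
    rw [Lp.toLp_compMeasurePreserving]
    exact MemLp.coeFn_toLp _
  have e2 : (Lp.compMeasurePreserving (fun x => x - 0) (hmp 0) (hf.toLp f) : E → F)
      =ᵐ[μ] fun x => f x := by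
    rw [Lp.toLp_compMeasurePreserving]
    refine (MemLp.coeFn_toLp _).trans (Filter.EventuallyEq.of_eq ?_)
    funext x
    simp
  have e3 := eLpNorm_congr_ae (p := q) (e1.sub e2)
  simp only [ContinuousMap.coe_mk] at h1
  rw [e3] at h1
  have h2 : eLpNorm ((fun x => f (x - t)) - fun x => f x) q μ ≠ ⊤ :=
    ((hf.comp_measurePreserving (hmp t)).sub hf).2.ne
  exact (ENNReal.le_ofReal_iff_toReal_le h2 hε.le).2 h1

/-- An average of translates is close to the function in `L^p`. -/
theorem eLpNorm_convolution_sub_le [NormedSpace ℝ F] {p : ℝ} (hp : 1 < p) {f : E → F}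
    (hf : MemLp f (ENNReal.ofReal p) μ) {ε δ : ℝ}
    (h : ∀ t : E, ‖t‖ < δ → eLpNorm (fun x => f (x - t) - f x) (ENNReal.ofReal p) μ
      ≤ ENNReal.ofReal ε)
    {ρ : E → ℝ} (hρ : Continuous ρ) (hρc : HasCompactSupport ρ) (hρ0 : ∀ t, 0 ≤ ρ t)
    (hρ1 : ∫ t, ρ t ∂μ = 1) (hρs : ∀ t, ρ t ≠ 0 → ‖t‖ < δ) [CompleteSpace F] :
    eLpNorm (fun x => (∫ t, ρ t • f (x - t) ∂μ) - f x) (ENNReal.ofReal p) μ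
      ≤ ENNReal.ofReal ε := by
  have hp0 : 0 < p := by linarith
  have hρi : Integrable ρ μ := hρ.integrable_of_hasCompactSupport hρc
  have hρl : ∫⁻ t, ENNReal.ofReal (ρ t) ∂μ = 1 := by
    rw [← ofReal_integral_eq_lintegral_ofReal hρi (Filter.Eventually.of_forall hρ0), hρ1]
    simp
  have hmeas : AEStronglyMeasurable (fun z : E × E => f (z.1 - z.2) - f z.1) (μ.prod μ) :=
    (hf.1.comp_quasiMeasurePreserving
      (quasiMeasurePreserving_sub_of_right_invariant μ μ)).sub hf.1.comp_fst
  set g : E → E → ℝ≥0∞ := fun x t => ‖f (x - t) - f x‖ₑ with hg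
  have hgm : AEMeasurable (fun z : E × E => ENNReal.ofReal (ρ z.2) * g z.1 z.2 ^ p) (μ.prod μ) :=
    AEMeasurable.mul (by fun_prop) (hmeas.enorm.pow_const p)
  have hgx : ∀ x, AEMeasurable (g x) μ := by
    intro x
    have : AEStronglyMeasurable (fun t => f (x - t)) μ :=
      hf.1.comp_quasiMeasurePreserving (quasiMeasurePreserving_sub_left_of_right_invariant μ x)
    exact (this.sub aestronglyMeasurable_const).enorm
  -- Jensen's inequality for the probability measure with density `ρ`; since `ρ` has integral one,
  -- `f x` may be taken inside the integral. Tonelli's theorem then reduces the matter to single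
  -- translations.
  have key : ∀ x, ‖(∫ t, ρ t • f (x - t) ∂μ) - f x‖ₑ ^ p
      ≤ ∫⁻ t, ENNReal.ofReal (ρ t) * g x t ^ p ∂μ := by
    intro x
    have hcm := hρ.measurable.ennreal_ofReal
    have i1 : Integrable (fun t => ρ t • f (x - t)) μ := by
      have hl : LocallyIntegrable (fun t => f (x - t)) μ :=
        (hf.comp_measurePreserving (Measure.measurePreserving_sub_left μ x)).locallyIntegrable
          (by simpa using hp.le)
      exact hl.integrable_smul_left_of_hasCompactSupport hρ hρc
    have e1 : (∫ t, ρ t • f (x - t) ∂μ) - f x = ∫ t, ρ t • (f (x - t) - f x) ∂μ := by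
      simp only [smul_sub]
      rw [integral_sub i1 (hρi.smul_const _), integral_smul_const, hρ1, one_smul]
    have h1 : ‖(∫ t, ρ t • f (x - t) ∂μ) - f x‖ₑ
        ≤ ∫⁻ t, g x t ∂(μ.withDensity fun t => ENNReal.ofReal (ρ t)) := by
      rw [e1, lintegral_withDensity_eq_lintegral_mul₀ hcm.aemeasurable (hgx x)]
      refine (enorm_integral_le_lintegral_enorm _).trans (lintegral_mono fun t => le_of_eq ?_)
      rw [enorm_smul, Real.enorm_eq_ofReal (hρ0 t)]
      rfl
    refine (ENNReal.rpow_le_rpow h1 hp0.le).trans ((lintegral_rpow_le hp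
      ((hgx x).mono_ac (withDensity_absolutelyContinuous _ _))).trans (le_of_eq ?_))
    rw [withDensity_apply _ MeasurableSet.univ, Measure.restrict_univ, hρl, ENNReal.one_rpow,
      one_mul, lintegral_withDensity_eq_lintegral_mul₀ hcm.aemeasurable ((hgx x).pow_const p)]
    rfl
  rw [← ENNReal.rpow_le_rpow_iff hp0, eLpNorm_ofReal_rpow hp0]
  refine (lintegral_mono key).trans ?_
  rw [lintegral_lintegral_swap hgm]
  calc ∫⁻ t, ∫⁻ x, ENNReal.ofReal (ρ t) * g x t ^ p ∂μ ∂μ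
      ≤ ∫⁻ t, ENNReal.ofReal (ρ t) * ENNReal.ofReal ε ^ p ∂μ := by
        refine lintegral_mono fun t => ?_
        simp only
        rw [lintegral_const_mul' _ _ (by simp)]
        by_cases ht : ρ t = 0
        · simp [ht]
        · refine mul_le_mul_right ?_ _
          rw [hg, ← eLpNorm_ofReal_rpow hp0]
          exact ENNReal.rpow_le_rpow (h t (hρs t ht)) hp0.le
    _ = ENNReal.ofReal ε ^ p := by
        rw [lintegral_mul_const _ hρ.measurable.ennreal_ofReal, hρl, one_mul]

end mollify

end MagneticTrace

end

noncomputable section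

namespace MagneticTrace

/-! ### Density of functions of class `C¹` with compact support -/

section density

variable {d : ℕ} {p : ℝ}

theorem abs_apply_le_norm {n : ℕ} (X : EuclideanSpace ℝ (Fin n)) (j : Fin n) : |X j| ≤ ‖X‖ := by
  simpa using PiLp.norm_apply_le X j

/-- A smooth probability density supported near the origin and below the half-space. -/
theorem exists_lower_kernel (d : ℕ) {δ : ℝ} (hδ : 0 < δ) :
    ∃ ρ : EuclideanSpace ℝ (Fin (d + 1)) → ℝ, ContDiff ℝ ∞ ρ ∧ HasCompactSupport ρ ∧
      (∀ t, 0 ≤ ρ t) ∧ ∫ t, ρ t = 1 ∧ (∀ t, ρ t ≠ 0 → ‖t‖ < δ) ∧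
      ∀ t ∈ tsupport ρ, t (Fin.last d) < 0 := by
  -- A ball of radius `δ / 4` about depth `δ / 2` stays within distance `3δ/4` of the origin and at
  -- depth at least `δ / 4`.
  set c : EuclideanSpace ℝ (Fin (d + 1)) := pt 0 (-(δ / 2)) with hc
  have hcn : ‖c‖ = δ / 2 := by
    rw [hc, norm_pt_zero_left, abs_neg, abs_of_pos (by positivity)]
  let b : ContDiffBump c := ⟨δ / 8, δ / 4, by positivity, by linarith⟩
  refine ⟨b.normed volume, b.contDiff_normed, b.hasCompactSupport_normed, b.nonneg_normed,
    b.integral_normed, fun t ht => ?_, fun t ht => ?_⟩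
  · have h1 : t ∈ Metric.ball c (δ / 4) := by
      have : t ∈ Function.support (b.normed volume) := ht
      rwa [b.support_normed_eq] at this
    rw [mem_ball_iff_norm] at h1
    have := norm_add_le (t - c) c
    rw [sub_add_cancel, hcn] at this
    linarith
  · rw [b.tsupport_normed_eq, mem_closedBall_iff_norm] at ht
    have h1 := (abs_le.1 ((abs_apply_le_norm (t - c) (Fin.last d)).trans ht)).2
    simp only [PiLp.sub_apply, hc, pt_last] at h1
    have : b.rOut = δ / 4 := rfl
    linarith

/-- The kernel lives strictly below the boundary, so for `X` in the half-space the function `Y ↦ ρ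
(X - Y)` is a test function supported in the open half-space. The definition of the weak gradient
applies to it, and the jump of the extension by zero across the boundary is never seen. -/
theorem grad_convolution {W : EuclideanSpace ℝ (Fin (d + 1)) → ℂ}
    {V : EuclideanSpace ℝ (Fin (d + 1)) → EuclideanSpace ℂ (Fin (d + 1))}
    (h : HasWeakGradient (halfSpace d) W V)
    (hW : LocallyIntegrable ((halfSpace d).indicator W))
    {ρ : EuclideanSpace ℝ (Fin (d + 1)) → ℝ} (hρ : ContDiff ℝ ∞ ρ) (hρc : HasCompactSupport ρ)
    (hρs : ∀ t ∈ tsupport ρ, t (Fin.last d) < 0)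
    {X : EuclideanSpace ℝ (Fin (d + 1))} (hX : X ∈ halfSpace d)
    (hV : Integrable fun t => ρ t • (halfSpace d).indicator V (X - t)) :
    grad (fun x => ∫ t, ρ t • (halfSpace d).indicator W (x - t)) X
      = ∫ t, ρ t • (halfSpace d).indicator V (X - t) := by
  ext j
  set v : EuclideanSpace ℝ (Fin (d + 1)) := EuclideanSpace.single j 1 with hv
  have hd := continuous_fderiv_apply' hρ v
  have hρ1 : ContDiff ℝ 1 ρ := hρ.of_le (by simp)
  have hρd : Continuous (fderiv ℝ ρ) := hρ1.continuous_fderiv one_ne_zero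
  have hX0 : 0 < X (Fin.last d) := hX
  have e1 : grad (fun x => ∫ t, ρ t • (halfSpace d).indicator W (x - t)) X j
      = ∫ t, fderiv ℝ ρ t v • (halfSpace d).indicator W (X - t) := by
    have h1 := hρc.hasFDerivAt_convolution_left (ContinuousLinearMap.lsmul ℝ ℝ) hρ1 hW X
    have h2 := (hρc.fderiv ℝ).convolutionExists_left
      ((ContinuousLinearMap.lsmul ℝ ℝ).precompL (EuclideanSpace ℝ (Fin (d + 1)))) hρd hW X
    rw [grad_apply, ← hv]
    refine (DFunLike.congr_fun h1.fderiv v).trans ?_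
    rw [convolution_def, ContinuousLinearMap.integral_apply h2]
    rfl
  have e2 : (∫ t, ρ t • (halfSpace d).indicator V (X - t)) j
      = ∫ t, ρ t • (halfSpace d).indicator V (X - t) j := by
    have := (EuclideanSpace.proj (𝕜 := ℂ) j :
      EuclideanSpace ℂ (Fin (d + 1)) →L[ℂ] ℂ).integral_comp_comm hV
    exact this.symm
  set φ : EuclideanSpace ℝ (Fin (d + 1)) → ℝ := fun Y => ρ (X - Y) with hφ
  have hφ1 : ContDiff ℝ ∞ φ := hρ.comp (contDiff_const.sub contDiff_id)
  have hφc : HasCompactSupport φ := hρc.comp_homeomorph (Homeomorph.subLeft X)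
  have hφt : tsupport φ ⊆ halfSpace d := by
    intro Y hY
    have h1 : X - Y ∈ tsupport ρ :=
      tsupport_comp_subset_preimage ρ (f := fun Y => X - Y) (by fun_prop) hY
    have h2 := hρs _ h1
    simp only [PiLp.sub_apply] at h2
    show 0 < Y (Fin.last d)
    linarith
  have hφd : ∀ Y, fderiv ℝ φ Y v = -fderiv ℝ ρ (X - Y) v := by
    intro Y
    have h1 : HasFDerivAt (fun Y => X - Y) (-ContinuousLinearMap.id ℝ _) Y :=
      (hasFDerivAt_id Y).const_sub X
    have h2 := ((hρ1.differentiable one_ne_zero (X - Y)).hasFDerivAt.comp Y h1).fderiv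
    have h3 : fderiv ℝ φ Y = (fderiv ℝ ρ (X - Y)).comp (-ContinuousLinearMap.id ℝ _) := h2
    rw [h3]
    simp
  have key := h.2.2 φ hφ1 hφc hφt j
  rw [← hv, ← integral_indicator measurableSet_halfSpace,
    ← integral_indicator measurableSet_halfSpace] at key
  rw [e1, e2, ← integral_sub_left_eq_self (fun t => fderiv ℝ ρ t v •
    (halfSpace d).indicator W (X - t)) volume X, ← integral_sub_left_eq_self (fun t => ρ t •
    (halfSpace d).indicator V (X - t) j) volume X, ← neg_inj]
  rw [← integral_neg]
  refine Eq.trans (integral_congr_ae (Filter.Eventually.of_forall fun Y => ?_))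
    (key.trans (congrArg _ (integral_congr_ae (Filter.Eventually.of_forall fun Y => ?_))))
  · by_cases hY : Y ∈ halfSpace d <;> simp [hY, hφd, sub_sub_cancel]
  · by_cases hY : Y ∈ halfSpace d <;> simp [hY, hφ, sub_sub_cancel]

theorem eLpNorm_restrict_indicator_le {F : Type*} [NormedAddCommGroup F] {q : ℝ≥0∞}
    {S : Set (EuclideanSpace ℝ (Fin (d + 1)))} (hS : MeasurableSet S)
    (g h k : EuclideanSpace ℝ (Fin (d + 1)) → F) (e : ∀ X ∈ S, g X = h X) :
    eLpNorm (fun X => g X - k X) q (volume.restrict S)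
      ≤ eLpNorm (fun X => h X - S.indicator k X) q volume := by
  refine le_trans (le_of_eq (eLpNorm_congr_ae ?_)) (eLpNorm_mono_measure _ Measure.restrict_le_self)
  filter_upwards [ae_restrict_mem hS] with X hX
  rw [e X hX, indicator_of_mem hX]

theorem exists_contDiff_approx_of_support (hp : 1 < p)
    {W : EuclideanSpace ℝ (Fin (d + 1)) → ℂ}
    {V : EuclideanSpace ℝ (Fin (d + 1)) → EuclideanSpace ℂ (Fin (d + 1))}
    (h : HasWeakGradient (halfSpace d) W V)
    (hW : MemLp W (ENNReal.ofReal p) (volume.restrict (halfSpace d)))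
    (hV : MemLp V (ENNReal.ofReal p) (volume.restrict (halfSpace d)))
    {R : ℝ} (hR : ∀ X, R < ‖X‖ → W X = 0) {ε : ℝ} (hε : 0 < ε) :
    ∃ g : EuclideanSpace ℝ (Fin (d + 1)) → ℂ, ContDiff ℝ 1 g ∧
      (∀ X, R + 1 < ‖X‖ → g X = 0) ∧
      eLpNorm (fun X => g X - W X) (ENNReal.ofReal p) (volume.restrict (halfSpace d))
        ≤ ENNReal.ofReal ε ∧
      eLpNorm (fun X => grad g X - V X) (ENNReal.ofReal p) (volume.restrict (halfSpace d))
        ≤ ENNReal.ofReal ε := by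
  have hp1 : 1 ≤ ENNReal.ofReal p := by simpa using hp.le
  have hW0 : MemLp ((halfSpace d).indicator W) (ENNReal.ofReal p) volume :=
    (memLp_indicator_iff_restrict measurableSet_halfSpace).2 hW
  have hV0 : MemLp ((halfSpace d).indicator V) (ENNReal.ofReal p) volume :=
    (memLp_indicator_iff_restrict measurableSet_halfSpace).2 hV
  obtain ⟨δ₁, hδ₁, h1⟩ := exists_eLpNorm_translate_le hp1 (by simp) hW0 hε
  obtain ⟨δ₂, hδ₂, h2⟩ := exists_eLpNorm_translate_le hp1 (by simp) hV0 hε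
  -- One kernel must serve both the function and its gradient, so its radius lies below both moduli
  -- of continuity; being also below `1`, it enlarges supports by at most `1`.
  obtain ⟨ρ, hρ, hρc, hρ0, hρ1, hρs, hρt⟩ := exists_lower_kernel d
    (lt_min one_pos (lt_min hδ₁ hδ₂))
  have hWl : LocallyIntegrable ((halfSpace d).indicator W) := hW0.locallyIntegrable hp1
  have hVi : ∀ X, Integrable fun t => ρ t • (halfSpace d).indicator V (X - t) := fun X =>
    ((hV0.comp_measurePreserving (Measure.measurePreserving_sub_left volume X)).locallyIntegrable
      hp1).integrable_smul_left_of_hasCompactSupport hρ.continuous hρc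
  refine ⟨fun x => ∫ t, ρ t • (halfSpace d).indicator W (x - t), ?_, ?_, ?_, ?_⟩
  · exact hρc.contDiff_convolution_left (ContinuousLinearMap.lsmul ℝ ℝ)
      (hρ.of_le (by simp) : ContDiff ℝ 1 ρ) hWl
  · intro X hX
    refine integral_eq_zero_of_ae (Filter.Eventually.of_forall fun t => ?_)
    by_cases ht : ρ t = 0
    · simp [ht]
    · have h3 := (hρs t ht).trans_le (min_le_left _ _)
      have h4 := norm_sub_norm_le X t
      have h5 : W (X - t) = 0 := hR _ (by linarith)
      simp only [indicator, h5, ite_self, smul_zero, Pi.zero_apply]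
  · refine (eLpNorm_restrict_indicator_le measurableSet_halfSpace _ _ W fun X _ => rfl).trans ?_
    exact eLpNorm_convolution_sub_le hp hW0
      (fun t ht => h1 t (ht.trans_le ((min_le_right _ _).trans (min_le_left _ _))))
      hρ.continuous hρc hρ0 hρ1 hρs
  · refine (eLpNorm_restrict_indicator_le measurableSet_halfSpace _ _ V fun X hX =>
      grad_convolution h hWl hρ hρc hρt hX (hVi X)).trans ?_
    exact eLpNorm_convolution_sub_le hp hV0
      (fun t ht => h2 t (ht.trans_le ((min_le_right _ _).trans (min_le_right _ _))))
      hρ.continuous hρc hρ0 hρ1 hρs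

theorem tendsto_eLpNorm_smul_zero {α F : Type*} [MeasurableSpace α] {μ : Measure α}
    [NormedAddCommGroup F] [NormedSpace ℝ F] (hp : 1 < p) {f : α → F}
    (hf : MemLp f (ENNReal.ofReal p) μ) {c : ℕ → α → ℝ} (hcm : ∀ k, Measurable (c k))
    (hc1 : ∀ k a, |c k a| ≤ 1) (hc0 : ∀ a, ∀ᶠ k in Filter.atTop, c k a = 0) :
    Filter.Tendsto (fun k => eLpNorm (fun a => c k a • f a) (ENNReal.ofReal p) μ)
      Filter.atTop (nhds 0) := by
  have hp0 : 0 < p := by linarith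
  have h : Filter.Tendsto (fun k => ∫⁻ a, ‖c k a • f a‖ₑ ^ p ∂μ) Filter.atTop
      (nhds (∫⁻ _, 0 ∂μ)) := by
    refine tendsto_lintegral_of_dominated_convergence' (fun a => ‖f a‖ₑ ^ p) (fun k => ?_)
      (fun k => Filter.Eventually.of_forall fun a => ?_) ?_
      (Filter.Eventually.of_forall fun a => ?_)
    · exact (((hcm k).aestronglyMeasurable).smul hf.1).enorm.pow_const p
    · refine ENNReal.rpow_le_rpow ?_ hp0.le
      rw [enorm_smul]
      refine (mul_le_mul_left (?_ : ‖c k a‖ₑ ≤ 1) _).trans (one_mul _).le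
      rw [← ofReal_norm, ← ENNReal.ofReal_one]
      exact ENNReal.ofReal_le_ofReal (hc1 k a)
    · rw [← eLpNorm_ofReal_rpow hp0]
      exact (ENNReal.rpow_lt_top_of_nonneg hp0.le hf.2.ne).ne
    · refine tendsto_const_nhds.congr' ?_
      filter_upwards [hc0 a] with k hk
      simp [hk, hp0]
  rw [lintegral_zero] at h
  have h2 := (ENNReal.continuous_rpow_const (y := 1 / p)).continuousAt.tendsto.comp h
  rw [ENNReal.zero_rpow_of_pos (by positivity)] at h2
  refine h2.congr fun k => ?_
  simp only [Function.comp_apply]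
  rw [eLpNorm_ofReal hp0]

/-- Smooth cut-off functions at scale `k + 1`. -/
theorem exists_cutoff (d : ℕ) : ∃ (η : ℕ → EuclideanSpace ℝ (Fin (d + 1)) → ℝ) (C : ℝ), 0 ≤ C ∧
    (∀ k, ContDiff ℝ ∞ (η k)) ∧ (∀ k X, 0 ≤ η k X) ∧ (∀ k X, η k X ≤ 1) ∧
    (∀ (k : ℕ) X, ‖X‖ ≤ (k : ℝ) + 1 → η k X = 1) ∧
    (∀ (k : ℕ) X, 2 * ((k : ℝ) + 1) < ‖X‖ → η k X = 0) ∧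
    (∀ (k : ℕ) X, ‖gradient (η k) X‖ ≤ C / ((k : ℝ) + 1)) ∧
    (∀ (k : ℕ) X, 2 * ((k : ℝ) + 1) < ‖X‖ → gradient (η k) X = 0) := by
  let b : ContDiffBump (0 : EuclideanSpace ℝ (Fin (d + 1))) := ⟨1, 2, one_pos, one_lt_two⟩
  have hb : ContDiff ℝ ∞ b := b.contDiff
  have hbd : Continuous (fderiv ℝ b) := hb.continuous_fderiv (by simp)
  obtain ⟨C, hC⟩ := hbd.bounded_above_of_compact_support (b.hasCompactSupport.fderiv ℝ)
  have hC0 : 0 ≤ C := (norm_nonneg _).trans (hC 0)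
  have hk : ∀ k : ℕ, (0 : ℝ) < (k : ℝ) + 1 := fun k => by positivity
  have hn : ∀ (k : ℕ) (X : EuclideanSpace ℝ (Fin (d + 1))),
      ‖((k : ℝ) + 1)⁻¹ • X‖ = ‖X‖ / ((k : ℝ) + 1) := by
    intro k X
    rw [norm_smul, norm_inv, Real.norm_of_nonneg (hk k).le, inv_mul_eq_div]
  have hfd : ∀ (k : ℕ) X, fderiv ℝ (fun X => b (((k : ℝ) + 1)⁻¹ • X)) X
      = ((k : ℝ) + 1)⁻¹ • fderiv ℝ b (((k : ℝ) + 1)⁻¹ • X) := by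
    intro k X
    have h1 : HasFDerivAt (fun X : EuclideanSpace ℝ (Fin (d + 1)) => ((k : ℝ) + 1)⁻¹ • X)
        (((k : ℝ) + 1)⁻¹ • ContinuousLinearMap.id ℝ _) X := (hasFDerivAt_id X).fun_const_smul _
    have h2 := ((hb.differentiable (by simp) (((k : ℝ) + 1)⁻¹ • X)).hasFDerivAt.comp X h1).fderiv
    refine Eq.trans h2 ?_
    ext v
    simp
  have hz : ∀ (k : ℕ) (X : EuclideanSpace ℝ (Fin (d + 1))), 2 * ((k : ℝ) + 1) < ‖X‖ →
      ((k : ℝ) + 1)⁻¹ • X ∉ tsupport b := by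
    intro k X hX hmem
    rw [b.tsupport_eq, mem_closedBall_zero_iff, hn, div_le_iff₀ (hk k)] at hmem
    exact absurd hmem (not_le.2 hX)
  refine ⟨fun k X => b (((k : ℝ) + 1)⁻¹ • X), C, hC0, fun k => ?_, fun k X => b.nonneg,
    fun k X => b.le_one, fun k X hX => ?_, fun k X hX => ?_, fun k X => ?_, fun k X hX => ?_⟩
  · exact hb.comp (contDiff_const_smul _)
  · refine b.one_of_mem_closedBall ?_
    rw [mem_closedBall_zero_iff, hn, div_le_iff₀ (hk k)]
    exact hX.trans (one_mul _).ge
  · exact image_eq_zero_of_notMem_tsupport (hz k X hX)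
  · rw [norm_gradient, hfd, norm_smul, norm_inv, Real.norm_of_nonneg (hk k).le, inv_mul_eq_div]
    exact div_le_div_of_nonneg_right (hC _) (hk k).le
  · rw [← norm_eq_zero, norm_gradient, hfd]
    have : fderiv ℝ b (((k : ℝ) + 1)⁻¹ • X) = 0 := by
      by_contra hcon
      exact hz k X hX (support_fderiv_subset ℝ hcon)
    rw [this]
    simp

/-- Functions of class `C¹` with compact support are dense in the magnetic Sobolev space. -/
theorem exists_contDiff_approx (hp : 1 < p)
    {A : EuclideanSpace ℝ (Fin (d + 1)) → EuclideanSpace ℝ (Fin (d + 1))} (hA : Continuous A)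
    {U : EuclideanSpace ℝ (Fin (d + 1)) → ℂ}
    {V : EuclideanSpace ℝ (Fin (d + 1)) → EuclideanSpace ℂ (Fin (d + 1))}
    (h : HasWeakGradient (halfSpace d) U V)
    (hU : MemLp U (ENNReal.ofReal p) (volume.restrict (halfSpace d)))
    (hG : MemLp (covGradOf A U V) (ENNReal.ofReal p) (volume.restrict (halfSpace d)))
    {ε : ℝ} (hε : 0 < ε) :
    ∃ g : EuclideanSpace ℝ (Fin (d + 1)) → ℂ, ContDiff ℝ 1 g ∧ HasCompactSupport g ∧
      eLpNorm (fun X => g X - U X) (ENNReal.ofReal p) (volume.restrict (halfSpace d))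
        ≤ ENNReal.ofReal ε ∧
      eLpNorm (fun X => covGradOf A g (grad g) X - covGradOf A U V X) (ENNReal.ofReal p)
        (volume.restrict (halfSpace d)) ≤ ENNReal.ofReal ε := by
  set μ := volume.restrict (halfSpace d) with hμ
  set q := ENNReal.ofReal p with hq
  have hp1 : 1 ≤ q := by simpa [hq] using hp.le
  obtain ⟨η, C, hC, hη, hη0, hη1, hηone, hηzero, hηg, hηgz⟩ := exists_cutoff d
  set c : ℕ → EuclideanSpace ℝ (Fin (d + 1)) → ℝ := fun k X => η k X - 1 with hc
  have hcm : ∀ k, Measurable (c k) := fun k => by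
    have := (hη k).continuous.measurable
    fun_prop
  have hc1 : ∀ k X, |c k X| ≤ 1 := fun k X =>
    abs_le.2 ⟨by linarith [hη0 k X], by linarith [hη1 k X]⟩
  have hc0 : ∀ X, ∀ᶠ k in Filter.atTop, c k X = 0 := by
    intro X
    filter_upwards [Filter.eventually_ge_atTop ⌈‖X‖⌉₊] with k hk
    have : ‖X‖ ≤ (k : ℝ) + 1 := by
      have := (Nat.le_ceil ‖X‖).trans (Nat.cast_le.2 hk)
      linarith
    simp [hc, hηone k X this]
  have t1 := tendsto_eLpNorm_smul_zero hp hU hcm hc1 hc0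
  have t2 := tendsto_eLpNorm_smul_zero hp hG hcm hc1 hc0
  -- The commutator of the cutoff with the gradient has size `‖U‖ / k`, which vanishes as the scale
  -- grows.
  have t3 : Filter.Tendsto (fun k : ℕ => ENNReal.ofReal (C / ((k : ℝ) + 1)) * eLpNorm U q μ)
      Filter.atTop (nhds 0) := by
    have h1 : Filter.Tendsto (fun k : ℕ => C / ((k : ℝ) + 1)) Filter.atTop (nhds 0) :=
      tendsto_const_div_atTop_nhds_zero_nat C |>.comp (Filter.tendsto_add_atTop_nat 1) |>.congr
        fun k => by simp
    have h2 := ENNReal.Tendsto.mul_const (b := eLpNorm U q μ) (ENNReal.tendsto_ofReal h1)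
      (Or.inr hU.2.ne)
    simpa using h2
  have hε4 : 0 < ENNReal.ofReal (ε / 4) := by simpa using hε
  obtain ⟨k, hk1, hk2, hk3⟩ := ((t1.eventually_lt_const hε4).and
    ((t2.eventually_lt_const hε4).and (t3.eventually_lt_const hε4))).exists
  set W : EuclideanSpace ℝ (Fin (d + 1)) → ℂ := fun X => η k X • U X with hWdef
  set V' : EuclideanSpace ℝ (Fin (d + 1)) → EuclideanSpace ℂ (Fin (d + 1)) :=
    fun X => η k X • V X + U X • cvec (gradient (η k) X) with hV'
  have hWV : HasWeakGradient (halfSpace d) W V' := h.smul_contDiff (isOpen_halfSpace d) (hη k)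
  have hcov : ∀ X, covGradOf A W V' X
      = η k X • covGradOf A U V X + U X • cvec (gradient (η k) X) :=
    covGradOf_smul_contDiff A U V (η k)
  have hgc : Continuous (gradient (η k)) := continuous_gradient ((hη k).of_le (by simp))
  have hUg : AEStronglyMeasurable (fun X => U X • cvec (gradient (η k) X)) μ :=
    hU.1.smul (continuous_cvec.comp hgc).aestronglyMeasurable
  have hUgn : eLpNorm (fun X => U X • cvec (gradient (η k) X)) q μ
      ≤ ENNReal.ofReal (C / ((k : ℝ) + 1)) * eLpNorm U q μ := by
    refine eLpNorm_le_mul_eLpNorm_of_ae_le_mul (Filter.Eventually.of_forall fun X => ?_) q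
    rw [norm_smul, norm_cvec, mul_comm]
    exact mul_le_mul_of_nonneg_right (hηg k X) (norm_nonneg _)
  have hWL : MemLp W q μ := by
    refine hU.of_le ((hη k).continuous.aestronglyMeasurable.smul hU.1)
      (Filter.Eventually.of_forall fun X => ?_)
    rw [hWdef, norm_smul, Real.norm_of_nonneg (hη0 k X)]
    exact mul_le_of_le_one_left (norm_nonneg _) (hη1 k X)
  have hGL : MemLp (covGradOf A W V') q μ := by
    have e : covGradOf A W V' = fun X => η k X • covGradOf A U V X + U X • cvec (gradient (η k) X) :=
      funext hcov
    rw [e]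
    refine MemLp.add (hG.of_le ((hη k).continuous.aestronglyMeasurable.smul hG.1)
      (Filter.Eventually.of_forall fun X => ?_)) ⟨hUg, hUgn.trans_lt (hk3.trans (by simp))⟩
    rw [norm_smul, Real.norm_of_nonneg (hη0 k X)]
    exact mul_le_of_le_one_left (norm_nonneg _) (hη1 k X)
  -- The potential may be unbounded at infinity, but it is bounded on the ball that contains the
  -- supports of the truncated function and of its mollification, whence the extra `1` in the
  -- radius.
  obtain ⟨M, hM⟩ := (isCompact_closedBall (0 : EuclideanSpace ℝ (Fin (d + 1)))
    (2 * ((k : ℝ) + 1) + 1)).exists_bound_of_continuousOn hA.continuousOn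
  have hM0 : 0 ≤ M := (norm_nonneg _).trans (hM 0 (by simp; positivity))
  have hpot : ∀ w : EuclideanSpace ℝ (Fin (d + 1)) → ℂ,
      (∀ X, 2 * ((k : ℝ) + 1) + 1 < ‖X‖ → w X = 0) →
      ∀ X, ‖(Complex.I * w X) • cvec (A X)‖ ≤ M * ‖w X‖ := by
    intro w hw X
    rw [norm_smul, norm_cvec, norm_mul, Complex.norm_I, one_mul, mul_comm]
    by_cases hX : 2 * ((k : ℝ) + 1) + 1 < ‖X‖
    · simp [hw X hX]
    · exact mul_le_mul_of_nonneg_right (hM X (by simpa using hX)) (norm_nonneg _)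
  have hWz : ∀ X, 2 * ((k : ℝ) + 1) < ‖X‖ → W X = 0 := fun X hX => by
    simp [hWdef, hηzero k X hX]
  have hWz' : ∀ X, 2 * ((k : ℝ) + 1) + 1 < ‖X‖ → W X = 0 := fun X hX => hWz X (by linarith)
  have hpotm : ∀ w : EuclideanSpace ℝ (Fin (d + 1)) → ℂ, AEStronglyMeasurable w μ →
      AEStronglyMeasurable (fun X => (Complex.I * w X) • cvec (A X)) μ := fun w hw =>
    (hw.const_mul Complex.I).smul (continuous_cvec.comp hA).aestronglyMeasurable
  -- Mollification commutes with the ordinary gradient only. After truncation the potential is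
  -- bounded where it matters, so the ordinary gradient is in `L^p` along with the covariant one.
  have hVL : MemLp V' q μ := by
    have h1 : MemLp (fun X => (Complex.I * W X) • cvec (A X)) q μ :=
      hWL.of_le_mul (hpotm W hWL.1) (Filter.Eventually.of_forall (hpot W hWz'))
    have h2 := hGL.sub h1
    refine (memLp_congr_ae (Filter.Eventually.of_forall fun X => ?_)).1 h2
    simp [covGradOf_eq]
  -- The potential multiplies the mollification error by at most `M`, so the tolerance is divided by
  -- `1 + M`. Truncation of the covariant gradient, the commutator, and mollification then cost at
  -- most `ε / 4` each.
  obtain ⟨g, hg1, hgz, hgW, hgV⟩ := exists_contDiff_approx_of_support hp hWV hWL hVL hWz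
    (ε := ε / (4 * (1 + M))) (by positivity)
  have hgm : AEStronglyMeasurable g μ := hg1.continuous.aestronglyMeasurable
  have hM4 : ε / (4 * (1 + M)) ≤ ε / 4 := by
    apply div_le_div_of_nonneg_left hε.le (by norm_num)
    linarith
  refine ⟨g, hg1, HasCompactSupport.intro (isCompact_closedBall 0 (2 * ((k : ℝ) + 1) + 1))
    fun X hX => hgz X (by simpa using hX), ?_, ?_⟩
  · have e : (fun X => g X - U X) = (fun X => g X - W X) + fun X => c k X • U X := by
      funext X
      simp [hWdef, hc, sub_mul]
    rw [e]
    refine (eLpNorm_add_le (hgm.sub hWL.1) ((hcm k).aestronglyMeasurable.smul hU.1) hp1).trans ?_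
    refine (add_le_add (hgW.trans (ENNReal.ofReal_le_ofReal hM4)) hk1.le).trans ?_
    rw [← ENNReal.ofReal_add (by positivity) (by positivity)]
    exact ENNReal.ofReal_le_ofReal (by linarith)
  · have e : (fun X => covGradOf A g (grad g) X - covGradOf A U V X)
        = ((fun X => grad g X - V' X) + fun X => (Complex.I * (g X - W X)) • cvec (A X))
          + ((fun X => c k X • covGradOf A U V X) + fun X => U X • cvec (gradient (η k) X)) := by
      funext X
      have h1 : covGradOf A g (grad g) X - covGradOf A W V' X
          = (grad g X - V' X) + (Complex.I * (g X - W X)) • cvec (A X) := by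
        rw [covGradOf_eq, covGradOf_eq, mul_sub, sub_smul]
        abel
      have h2 : covGradOf A W V' X - covGradOf A U V X
          = c k X • covGradOf A U V X + U X • cvec (gradient (η k) X) := by
        rw [hcov, hc, sub_smul, one_smul]
        abel
      simp only [Pi.add_apply]
      rw [← h1, ← h2]
      abel
    have m1 : AEStronglyMeasurable (fun X => grad g X - V' X) μ :=
      (continuous_grad hg1).aestronglyMeasurable.sub hVL.1
    have m2 := hpotm (fun X => g X - W X) (hgm.sub hWL.1)
    have m3 : AEStronglyMeasurable (fun X => c k X • covGradOf A U V X) μ :=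
      (hcm k).aestronglyMeasurable.smul hG.1
    have b2 : eLpNorm (fun X => (Complex.I * (g X - W X)) • cvec (A X)) q μ
        ≤ ENNReal.ofReal M * ENNReal.ofReal (ε / (4 * (1 + M))) := by
      refine (eLpNorm_le_mul_eLpNorm_of_ae_le_mul (Filter.Eventually.of_forall
        (hpot (fun X => g X - W X) fun X hX => ?_)) q).trans (mul_le_mul_right hgW _)
      simp [hgz X hX, hWz' X hX]
    rw [e]
    refine (eLpNorm_add_le (m1.add m2) (m3.add hUg) hp1).trans ?_
    refine (add_le_add (eLpNorm_add_le m1 m2 hp1) (eLpNorm_add_le m3 hUg hp1)).trans ?_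
    refine (add_le_add (add_le_add hgV b2) (add_le_add hk2.le (hUgn.trans hk3.le))).trans ?_
    rw [← ENNReal.ofReal_mul hM0, ← ENNReal.ofReal_add (by positivity) (by positivity),
      ← ENNReal.ofReal_add (by positivity) (by positivity),
      ← ENNReal.ofReal_add (by positivity) (by positivity)]
    refine ENNReal.ofReal_le_ofReal ?_
    have e2 : ε / (4 * (1 + M)) + M * (ε / (4 * (1 + M))) = ε / 4 := by
      field_simp
    linarith

end density

end MagneticTrace

end

noncomputable section

namespace MagneticTrace

/-! ### Functions defined by integration against a kernel -/

section kernel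

variable {d : ℕ}

/-- The kernel `c(X, y)` vanishes when `y` is farther from the projection of `X` than the height
of `X`. -/
def KernelSupport {F : Type*} [Zero F]
    (c : EuclideanSpace ℝ (Fin (d + 1)) → EuclideanSpace ℝ (Fin d) → F) : Prop :=
  ∀ X ∈ halfSpace d, ∀ y, X (Fin.last d) < ‖base X - y‖ → c X y = 0

/-- The kernel `c` is jointly continuous over the half-space. -/
def KernelContinuous {F : Type*} [TopologicalSpace F]
    (c : EuclideanSpace ℝ (Fin (d + 1)) → EuclideanSpace ℝ (Fin d) → F) : Prop :=
  ContinuousOn (fun z : EuclideanSpace ℝ (Fin (d + 1)) × EuclideanSpace ℝ (Fin d) => c z.1 z.2)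
    (halfSpace d ×ˢ univ)

variable {F : Type*} [NormedAddCommGroup F]
  {c : EuclideanSpace ℝ (Fin (d + 1)) → EuclideanSpace ℝ (Fin d) → F}
  {u : EuclideanSpace ℝ (Fin d) → ℂ}

theorem KernelContinuous.continuous_right (hc : KernelContinuous c)
    {X : EuclideanSpace ℝ (Fin (d + 1))} (hX : X ∈ halfSpace d) : Continuous (c X) := by
  have hc' : ContinuousOn (fun z : EuclideanSpace ℝ (Fin (d + 1)) × EuclideanSpace ℝ (Fin d) =>
    c z.1 z.2) (halfSpace d ×ˢ univ) := hc
  rw [← continuousOn_univ]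
  have h := ContinuousOn.comp (f := fun y => (X, y)) (s := univ) hc'
    (continuousOn_const.prodMk continuousOn_id) fun y _ => ⟨hX, mem_univ y⟩
  exact h

theorem KernelContinuous.continuousOn_left (hc : KernelContinuous c)
    (y : EuclideanSpace ℝ (Fin d)) : ContinuousOn (fun X => c X y) (halfSpace d) := by
  have hc' : ContinuousOn (fun z : EuclideanSpace ℝ (Fin (d + 1)) × EuclideanSpace ℝ (Fin d) =>
    c z.1 z.2) (halfSpace d ×ˢ univ) := hc
  have h := ContinuousOn.comp (f := fun X => (X, y)) (s := halfSpace d) hc'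
    (continuousOn_id.prodMk continuousOn_const) fun X hX => ⟨hX, mem_univ y⟩
  exact h

variable [NormedSpace ℂ F]

/-- For `X` in a compact set of radius `r`, the support condition confines `y` to the ball of radius
`‖base X‖ + X (Fin.last d) ≤ 2 r`. The kernel is bounded there by continuity, and `u` is integrable.
-/
theorem integrable_kernel_prod (hc : KernelContinuous c) (hs : KernelSupport c)
    (hu : LocallyIntegrable u) {K : Set (EuclideanSpace ℝ (Fin (d + 1)))} (hK : IsCompact K)
    (hKs : K ⊆ halfSpace d) :
    Integrable (fun z : EuclideanSpace ℝ (Fin (d + 1)) × EuclideanSpace ℝ (Fin d) =>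
      u z.2 • c z.1 z.2) ((volume.restrict K).prod volume) := by
  obtain ⟨r, hr⟩ := hK.isBounded.subset_closedBall 0
  have hK' : IsCompact (Metric.closedBall (0 : EuclideanSpace ℝ (Fin d)) (2 * r)) :=
    isCompact_closedBall _ _
  set K' := Metric.closedBall (0 : EuclideanSpace ℝ (Fin d)) (2 * r) with hK'def
  have : IsFiniteMeasure (volume.restrict K) := ⟨by
    rw [Measure.restrict_apply_univ]; exact hK.measure_lt_top⟩
  have h1 : IntegrableOn (fun z : EuclideanSpace ℝ (Fin (d + 1)) × EuclideanSpace ℝ (Fin d) =>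
      u z.2) (K ×ˢ K') (volume.prod volume) := by
    rw [IntegrableOn, ← Measure.prod_restrict]
    exact Integrable.comp_snd (hu.integrableOn_isCompact hK') _
  have h2 := h1.smul_continuousOn
    (ContinuousOn.mono hc (prod_mono hKs (subset_univ K'))) (hK.prod hK')
  have h3 := h2.of_forall_sdiff_eq_zero (t := K ×ˢ univ)
    (hK.measurableSet.prod MeasurableSet.univ) ?_
  · rwa [IntegrableOn, ← Measure.prod_restrict, Measure.restrict_univ] at h3
  · rintro ⟨X, y⟩ ⟨⟨hX, _⟩, h4⟩
    have hy : 2 * r < ‖y‖ := by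
      by_contra hcon
      exact h4 ⟨hX, by simpa [hK'def] using hcon⟩
    have hX1 : ‖X‖ ≤ r := by simpa using hr hX
    have h5 := norm_base_le X
    have h6 := (abs_le.1 (abs_apply_le_norm X (Fin.last d))).2
    have h7 := norm_sub_norm_le y (base X)
    rw [norm_sub_rev] at h7
    simp only [hs X (hKs hX) y (by linarith), smul_zero]

theorem integrable_kernel (hc : KernelContinuous c) (hs : KernelSupport c)
    (hu : LocallyIntegrable u) {X : EuclideanSpace ℝ (Fin (d + 1))} (hX : X ∈ halfSpace d) :
    Integrable fun y => u y • c X y := by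
  refine LocallyIntegrable.integrable_smul_right_of_hasCompactSupport (f := u) hu
    (hc.continuous_right hX) ?_
  refine HasCompactSupport.intro (isCompact_closedBall (base X) (X (Fin.last d))) fun y hy => ?_
  refine hs X hX y ?_
  rw [Metric.mem_closedBall, not_le, dist_comm, dist_eq_norm] at hy
  exact hy

theorem locallyIntegrableOn_kernel (hc : KernelContinuous c) (hs : KernelSupport c)
    (hu : LocallyIntegrable u) :
    LocallyIntegrableOn (fun X => ∫ y, u y • c X y) (halfSpace d) := by
  rw [locallyIntegrableOn_iff (isOpen_halfSpace d).isLocallyClosed]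
  intro K hKs hK
  exact (integrable_kernel_prod hc hs hu hK hKs).integral_prod_left

/-- A function defined by integration against a differentiable kernel is weakly differentiable. -/
theorem hasWeakGradient_kernel
    {k : EuclideanSpace ℝ (Fin (d + 1)) → EuclideanSpace ℝ (Fin d) → ℂ}
    {k' : EuclideanSpace ℝ (Fin (d + 1)) → EuclideanSpace ℝ (Fin d) →
      EuclideanSpace ℂ (Fin (d + 1))}
    (hk : KernelContinuous k) (hk' : KernelContinuous k') (hs : KernelSupport k)
    (hs' : KernelSupport k')
    (hd : ∀ X ∈ halfSpace d, ∀ y, DifferentiableAt ℝ (fun X => k X y) X ∧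
      grad (fun X => k X y) X = k' X y)
    (hu : LocallyIntegrable u) :
    HasWeakGradient (halfSpace d) (fun X => ∫ y, u y • k X y) (fun X => ∫ y, u y • k' X y) := by
  refine ⟨locallyIntegrableOn_kernel hk hs hu, locallyIntegrableOn_kernel hk' hs' hu,
    fun φ h1 h2 h3 j => ?_⟩
  set v : EuclideanSpace ℝ (Fin (d + 1)) := EuclideanSpace.single j 1 with hv
  have hdφ := continuous_fderiv_apply' h1 v
  have hc : HasCompactSupport fun X => fderiv ℝ φ X v := h2.fderiv_apply ℝ _
  have h4 : tsupport (fun X => fderiv ℝ φ X v) ⊆ tsupport φ := tsupport_fderiv_apply_subset ℝ _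
  set K := tsupport φ with hKdef
  have hK : IsCompact K := h2
  rw [setIntegral_eq_integral_of_tsupport (h4.trans h3), setIntegral_eq_integral_of_tsupport h3,
    ← setIntegral_eq_integral_of_tsupport h4,
    ← setIntegral_eq_integral_of_tsupport (Ω := K) (ψ := φ) subset_rfl]
  have p1 := integrable_kernel_prod hk hs hu hK h3
  have p2 : Integrable (fun z : EuclideanSpace ℝ (Fin (d + 1)) × EuclideanSpace ℝ (Fin d) =>
      u z.2 * k' z.1 z.2 j) ((volume.restrict K).prod volume) :=
    (EuclideanSpace.proj (𝕜 := ℂ) j : EuclideanSpace ℂ (Fin (d + 1)) →L[ℂ] ℂ).integrable_comp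
      (integrable_kernel_prod hk' hs' hu hK h3)
  have q1 : Integrable (fun z : EuclideanSpace ℝ (Fin (d + 1)) × EuclideanSpace ℝ (Fin d) =>
      fderiv ℝ φ z.1 v • (u z.2 * k z.1 z.2)) ((volume.restrict K).prod volume) := by
    obtain ⟨C, hC⟩ := hdφ.bounded_above_of_compact_support hc
    exact p1.bdd_smul C (hdφ.comp continuous_fst).aestronglyMeasurable
      (Filter.Eventually.of_forall fun z => hC z.1)
  have q2 : Integrable (fun z : EuclideanSpace ℝ (Fin (d + 1)) × EuclideanSpace ℝ (Fin d) =>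
      φ z.1 • (u z.2 * k' z.1 z.2 j)) ((volume.restrict K).prod volume) := by
    obtain ⟨C, hC⟩ := h1.continuous.bounded_above_of_compact_support h2
    exact p2.bdd_smul C (h1.continuous.comp continuous_fst).aestronglyMeasurable
      (Filter.Eventually.of_forall fun z => hC z.1)
  -- Fubini's theorem reduces the identity to a classical integration by parts in `X` at each fixed
  -- `y`, so `u` needs no regularity.
  have e1 : ∫ X in K, fderiv ℝ φ X v • ∫ y, u y • k X y
      = ∫ y, ∫ X in K, fderiv ℝ φ X v • (u y * k X y) := by
    rw [← integral_integral_swap q1]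
    simp only [integral_smul, smul_eq_mul]
  have e2 : ∫ X in K, φ X • (∫ y, u y • k' X y) j
      = ∫ y, ∫ X in K, φ X • (u y * k' X y j) := by
    rw [← integral_integral_swap q2]
    refine setIntegral_congr_fun hK.measurableSet fun X hX => ?_
    have := (EuclideanSpace.proj (𝕜 := ℂ) j :
      EuclideanSpace ℂ (Fin (d + 1)) →L[ℂ] ℂ).integral_comp_comm
        (integrable_kernel hk' hs' hu (h3 hX))
    simp only [integral_smul]
    congr 1
    exact this.symm
  rw [e1, e2, ← integral_neg]
  refine integral_congr_ae (Filter.Eventually.of_forall fun y => ?_)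
  simp only
  have l1 : LocallyIntegrableOn (fun X => k X y) (halfSpace d) :=
    (hk.continuousOn_left y).locallyIntegrableOn measurableSet_halfSpace
  have l2 : LocallyIntegrableOn (fun X => k' X y j) (halfSpace d) :=
    locallyIntegrableOn_coord ((hk'.continuousOn_left y).locallyIntegrableOn
      measurableSet_halfSpace) j
  have full : ∀ {ψ : EuclideanSpace ℝ (Fin (d + 1)) → ℝ}
      {g : EuclideanSpace ℝ (Fin (d + 1)) → ℂ}, LocallyIntegrableOn g (halfSpace d) →
      Continuous ψ → HasCompactSupport ψ → tsupport ψ ⊆ halfSpace d →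
      Integrable fun X => ψ X • g X := by
    intro ψ g hg g1 g2 g3
    refine (integrableOn_iff_integrable_of_support_subset ?_).1
      (integrableOn_smul_of_tsupport hg g1 g2 g3)
    intro X hX
    by_contra hcon
    exact hX (by simp [image_eq_zero_of_notMem_tsupport fun hh => hcon (g3 hh)])
  have i1 := full l1 hdφ hc (h4.trans h3)
  have i2 := full l2 h1.continuous h2 h3
  have i3 := full l1 h1.continuous h2 h3
  have e3 : ∀ X, φ X • k' X y j = φ X • fderiv ℝ (fun X => k X y) X v := by
    intro X
    by_cases hX : X ∈ K
    · rw [← (hd X (h3 hX) y).2, grad_apply]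
    · rw [image_eq_zero_of_notMem_tsupport hX, zero_smul, zero_smul]
  have key := integral_smul_fderiv_eq_neg_fderiv_smul_of_integrable i1
    (i2.congr (Filter.Eventually.of_forall e3)) i3
    (fun X _ => (h1.differentiable (by simp)) X) (fun X hX => (hd X (h3 hX) y).1)
  rw [setIntegral_eq_integral_of_tsupport h4,
    setIntegral_eq_integral_of_tsupport (Ω := K) (ψ := φ) subset_rfl]
  have m1 : ∀ (a : ℝ) (b : ℂ), a • (u y * b) = u y * (a • b) := fun a b => (mul_smul_comm a _ b).symm
  simp only [m1]
  rw [integral_const_mul, integral_const_mul, ← mul_neg]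
  congr 1
  rw [integral_congr_ae (Filter.Eventually.of_forall e3), key, neg_neg]

end kernel

end MagneticTrace

end

noncomputable section

namespace MagneticTrace

/-! ### A smooth mollifier whose scale is the height -/

section mollifier

variable {d : ℕ}

/-- A smooth probability density supported in the unit ball. -/
def bump (d : ℕ) : EuclideanSpace ℝ (Fin d) → ℝ :=
  (⟨1 / 2, 1, by norm_num, by norm_num⟩ : ContDiffBump (0 : EuclideanSpace ℝ (Fin d))).normed volume

theorem contDiff_bump : ContDiff ℝ ∞ (bump d) := ContDiffBump.contDiff_normed _

theorem hasCompactSupport_bump : HasCompactSupport (bump d) := ContDiffBump.hasCompactSupport_normed _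

theorem integral_bump : ∫ z, bump d z = 1 := ContDiffBump.integral_normed _

theorem tsupport_bump : tsupport (bump d) = Metric.closedBall 0 1 :=
  ContDiffBump.tsupport_normed_eq _

theorem bump_eq_zero {z : EuclideanSpace ℝ (Fin d)} (hz : 1 < ‖z‖) : bump d z = 0 :=
  image_eq_zero_of_notMem_tsupport (by rw [tsupport_bump]; simpa using hz)

theorem fderiv_bump_eq_zero {z : EuclideanSpace ℝ (Fin d)} (hz : 1 < ‖z‖) :
    fderiv ℝ (bump d) z = 0 :=
  image_eq_zero_of_notMem_tsupport fun h => by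
    have := tsupport_fderiv_subset ℝ h
    rw [tsupport_bump] at this
    exact absurd (by simpa using this) (not_le.2 hz)

theorem continuous_fderiv_bump : Continuous (fderiv ℝ (bump d)) :=
  contDiff_bump.continuous_fderiv (by simp)

theorem exists_bump_bound (d : ℕ) : ∃ M : ℝ, 0 ≤ M ∧ (∀ z, |bump d z| ≤ M) ∧
    ∀ z, ‖fderiv ℝ (bump d) z‖ ≤ M := by
  obtain ⟨C1, h1⟩ := (contDiff_bump (d := d)).continuous.bounded_above_of_compact_support
    hasCompactSupport_bump
  obtain ⟨C2, h2⟩ := (continuous_fderiv_bump (d := d)).bounded_above_of_compact_support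
    (hasCompactSupport_bump.fderiv ℝ)
  exact ⟨max C1 C2, (norm_nonneg _).trans ((h1 0).trans (le_max_left _ _)),
    fun z => (h1 z).trans (le_max_left _ _), fun z => (h2 z).trans (le_max_right _ _)⟩

/-- A bound for the mollifier and its derivative at unit scale. -/
def kernelConst (d : ℕ) : ℝ := (2 + d) * (exists_bump_bound d).choose

theorem kernelConst_nonneg (d : ℕ) : 0 ≤ kernelConst d :=
  mul_nonneg (by positivity) (exists_bump_bound d).choose_spec.1

/-- The mollifier at the point `X`, of scale the height of `X`. -/
def mollifier (X : EuclideanSpace ℝ (Fin (d + 1))) (y : EuclideanSpace ℝ (Fin d)) : ℝ :=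
  (X (Fin.last d))⁻¹ ^ d * bump d ((X (Fin.last d))⁻¹ • (base X - y))

/-- The last coordinate as a continuous linear form. -/
def lastL (d : ℕ) : EuclideanSpace ℝ (Fin (d + 1)) →L[ℝ] ℝ := EuclideanSpace.proj (Fin.last d)

theorem norm_lastL_le : ‖lastL d‖ ≤ 1 :=
  ContinuousLinearMap.opNorm_le_bound _ zero_le_one fun X => by
    rw [one_mul]; exact abs_apply_le_norm X _

theorem norm_baseL_le : ‖baseL (d := d)‖ ≤ 1 :=
  ContinuousLinearMap.opNorm_le_bound _ zero_le_one fun X => by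
    rw [one_mul]; exact norm_base_le X

/-- The derivative of the mollifier with respect to the point. -/
def mollifierDeriv (X : EuclideanSpace ℝ (Fin (d + 1))) (y : EuclideanSpace ℝ (Fin d)) :
    EuclideanSpace ℝ (Fin (d + 1)) →L[ℝ] ℝ :=
  (X (Fin.last d))⁻¹ ^ d • (fderiv ℝ (bump d) ((X (Fin.last d))⁻¹ • (base X - y))).comp
      ((X (Fin.last d))⁻¹ • baseL
        - (X (Fin.last d))⁻¹ ^ 2 • (lastL d).smulRight (base X - y))
    - (bump d ((X (Fin.last d))⁻¹ • (base X - y)) * (d * (X (Fin.last d))⁻¹ ^ (d + 1))) • lastL d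

theorem hasFDerivAt_mollifier {X : EuclideanSpace ℝ (Fin (d + 1))} (hX : X ∈ halfSpace d)
    (y : EuclideanSpace ℝ (Fin d)) :
    HasFDerivAt (fun X => mollifier X y) (mollifierDeriv X y) X := by
  have hX0 : X (Fin.last d) ≠ 0 := (show 0 < X (Fin.last d) from hX).ne'
  have h1 : HasFDerivAt (fun X : EuclideanSpace ℝ (Fin (d + 1)) => (X (Fin.last d))⁻¹)
      (-((X (Fin.last d))⁻¹ ^ 2 • lastL d)) X := by
    have h := (hasDerivAt_inv hX0).comp_hasFDerivAt X (lastL d).hasFDerivAt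
    refine h.congr_fderiv ?_
    rw [inv_pow, neg_smul]
  have h2 : HasFDerivAt (fun X : EuclideanSpace ℝ (Fin (d + 1)) => base X - y) baseL X :=
    (baseL.hasFDerivAt).sub_const y
  have h3 := h1.smul h2
  have h4 := ((contDiff_bump (d := d)).differentiable (by simp)
    ((X (Fin.last d))⁻¹ • (base X - y))).hasFDerivAt.comp X h3
  have h5 := (h1.pow d).mul h4
  refine h5.congr_fderiv ?_
  ext v
  simp only [mollifierDeriv, add_apply, sub_apply,
    smul_apply, ContinuousLinearMap.comp_apply, neg_apply,
    ContinuousLinearMap.smulRight_apply, smul_eq_mul, map_sub, map_smul, map_add,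
    map_neg, nsmul_eq_mul, neg_smul, smul_smul, Function.comp, Pi.smul_apply']
  -- The derivative of a `d`-th power involves the exponent `d - 1`, truncated at `0`; dimension
  -- zero is therefore separate.
  rcases d with _ | d
  · simp
    ring
  · simp only [Nat.add_sub_cancel]
    ring

theorem mollifier_eq_zero {X : EuclideanSpace ℝ (Fin (d + 1))} (hX : X ∈ halfSpace d)
    {y : EuclideanSpace ℝ (Fin d)} (h : X (Fin.last d) < ‖base X - y‖) :
    1 < ‖(X (Fin.last d))⁻¹ • (base X - y)‖ := by
  have hX0 : 0 < X (Fin.last d) := hX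
  rw [norm_smul, norm_inv, Real.norm_of_nonneg hX0.le, inv_mul_eq_div, one_lt_div hX0]
  exact h

theorem kernelSupport_mollifier : KernelSupport (mollifier (d := d)) := by
  intro X hX y h
  rw [mollifier, bump_eq_zero (mollifier_eq_zero hX h), mul_zero]

theorem kernelSupport_mollifierDeriv : KernelSupport (mollifierDeriv (d := d)) := by
  intro X hX y h
  have := mollifier_eq_zero hX h
  rw [mollifierDeriv, bump_eq_zero this, fderiv_bump_eq_zero this]
  simp

theorem continuousOn_inv_last : ContinuousOn
    (fun z : EuclideanSpace ℝ (Fin (d + 1)) × EuclideanSpace ℝ (Fin d) => (z.1 (Fin.last d))⁻¹)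
    (halfSpace d ×ˢ univ) :=
  ContinuousOn.inv₀ (by fun_prop) fun z hz => (show 0 < z.1 (Fin.last d) from hz.1).ne'

theorem continuousOn_scaled : ContinuousOn
    (fun z : EuclideanSpace ℝ (Fin (d + 1)) × EuclideanSpace ℝ (Fin d) =>
      (z.1 (Fin.last d))⁻¹ • (base z.1 - z.2)) (halfSpace d ×ˢ univ) :=
  continuousOn_inv_last.smul (by fun_prop)

theorem kernelContinuous_mollifier : KernelContinuous (mollifier (d := d)) :=
  (continuousOn_inv_last.pow d).mul
    ((contDiff_bump (d := d)).continuous.comp_continuousOn continuousOn_scaled)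

theorem kernelContinuous_mollifierDeriv : KernelContinuous (mollifierDeriv (d := d)) := by
  have h1 := continuousOn_inv_last (d := d)
  have h2 := (contDiff_bump (d := d)).continuous.comp_continuousOn continuousOn_scaled
  have h3 := (continuous_fderiv_bump (d := d)).comp_continuousOn continuousOn_scaled
  have h4 : Continuous fun z : EuclideanSpace ℝ (Fin (d + 1)) × EuclideanSpace ℝ (Fin d) =>
      (lastL d).smulRight (base z.1 - z.2) :=
    (ContinuousLinearMap.smulRightL ℝ (EuclideanSpace ℝ (Fin (d + 1)))
      (EuclideanSpace ℝ (Fin d)) (lastL d)).continuous.comp (by fun_prop)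
  exact ((h1.pow d).smul (h3.clm_comp ((h1.smul continuousOn_const).sub
    ((h1.pow 2).smul h4.continuousOn)))).sub
      ((h2.mul (continuousOn_const.mul (h1.pow (d + 1)))).smul continuousOn_const)

theorem abs_mollifier_le {X : EuclideanSpace ℝ (Fin (d + 1))} (hX : X ∈ halfSpace d)
    (y : EuclideanSpace ℝ (Fin d)) :
    |mollifier X y| ≤ kernelConst d * (X (Fin.last d))⁻¹ ^ d := by
  have hX0 : 0 < X (Fin.last d) := hX
  obtain ⟨hM, h1, -⟩ := (exists_bump_bound d).choose_spec
  rw [mollifier, abs_mul, abs_of_nonneg (by positivity : 0 ≤ (X (Fin.last d))⁻¹ ^ d), mul_comm]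
  refine mul_le_mul_of_nonneg_right ((h1 _).trans ?_) (by positivity)
  rw [kernelConst]
  nlinarith [mul_nonneg (Nat.cast_nonneg (α := ℝ) d) hM]

/-- Differentiating in the height brings out the factor `base X - y`, which is harmless because the
kernel vanishes once `‖base X - y‖` exceeds the height. Each derivative therefore costs one inverse
power of the height. -/
theorem norm_mollifierDeriv_le {X : EuclideanSpace ℝ (Fin (d + 1))} (hX : X ∈ halfSpace d)
    (y : EuclideanSpace ℝ (Fin d)) :
    ‖mollifierDeriv X y‖ ≤ kernelConst d * (X (Fin.last d))⁻¹ ^ (d + 1) := by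
  have hX0 : 0 < X (Fin.last d) := hX
  set τ := (X (Fin.last d))⁻¹ with hτ
  have hτ0 : 0 < τ := by positivity
  obtain ⟨hM, h1, h2⟩ := (exists_bump_bound d).choose_spec
  set M := (exists_bump_bound d).choose with hMdef
  by_cases hy : X (Fin.last d) < ‖base X - y‖
  · rw [kernelSupport_mollifierDeriv X hX y hy, norm_zero]
    exact mul_nonneg (kernelConst_nonneg d) (by positivity)
  rw [not_lt] at hy
  have hw : τ * ‖base X - y‖ ≤ 1 := by
    rw [hτ, inv_mul_le_one₀ hX0]; exact hy
  have e1 : ‖τ • baseL - τ ^ 2 • (lastL d).smulRight (base X - y)‖ ≤ 2 * τ := by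
    refine (norm_sub_le _ _).trans ?_
    rw [norm_smul, norm_smul, ContinuousLinearMap.norm_smulRight_apply, norm_pow,
      Real.norm_of_nonneg hτ0.le]
    have a1 : τ * ‖baseL (d := d)‖ ≤ τ * 1 := by gcongr; exact norm_baseL_le
    have a2 : τ ^ 2 * (‖lastL d‖ * ‖base X - y‖) ≤ τ ^ 2 * (1 * ‖base X - y‖) := by
      gcongr; exact norm_lastL_le
    nlinarith
  rw [mollifierDeriv]
  refine (norm_sub_le _ _).trans ?_
  have b1 : ‖τ ^ d • (fderiv ℝ (bump d) (τ • (base X - y))).comp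
      (τ • baseL - τ ^ 2 • (lastL d).smulRight (base X - y))‖ ≤ τ ^ d * (M * (2 * τ)) := by
    rw [norm_smul, norm_pow, Real.norm_of_nonneg hτ0.le]
    gcongr
    exact (ContinuousLinearMap.opNorm_comp_le _ _).trans (by gcongr; exact h2 _)
  have b2 : ‖(bump d (τ • (base X - y)) * (d * τ ^ (d + 1))) • lastL d‖
      ≤ (M * (d * τ ^ (d + 1))) * 1 := by
    rw [norm_smul, norm_mul, Real.norm_of_nonneg (by positivity : 0 ≤ (d : ℝ) * τ ^ (d + 1))]
    gcongr
    · exact h1 _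
    · exact norm_lastL_le
  -- In the constant, `2` comes from differentiating the rescaled argument and `d` from the
  -- normalizing power of the height.
  refine (add_le_add b1 b2).trans (le_of_eq ?_)
  rw [kernelConst]
  ring

theorem integral_mollifier {X : EuclideanSpace ℝ (Fin (d + 1))} (hX : X ∈ halfSpace d) :
    ∫ y, mollifier X y = 1 := by
  have hX0 : 0 < X (Fin.last d) := hX
  simp only [mollifier]
  rw [integral_const_mul,
    integral_sub_left_eq_self (fun z => bump d ((X (Fin.last d))⁻¹ • z)) volume (base X),
    Measure.integral_comp_smul, integral_bump, finrank_euclideanSpace_fin, smul_eq_mul, mul_one,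
    abs_of_nonneg (by positivity)]
  field_simp

end mollifier

end MagneticTrace

end

noncomputable section

namespace MagneticTrace

/-! ### Gauge covariant averages -/

section gauge

variable {d : ℕ}

/-- A real linear form seen as a complex vector. -/
def dualVec {n : ℕ} (L : EuclideanSpace ℝ (Fin n) →L[ℝ] ℝ) : EuclideanSpace ℂ (Fin n) :=
  cvec ((InnerProductSpace.toDual ℝ (EuclideanSpace ℝ (Fin n))).symm L)

@[simp] theorem dualVec_apply {n : ℕ} (L : EuclideanSpace ℝ (Fin n) →L[ℝ] ℝ) (j : Fin n) :
    dualVec L j = (L (EuclideanSpace.single j 1) : ℂ) := by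
  have h := InnerProductSpace.toDual_symm_apply (𝕜 := ℝ) (x := EuclideanSpace.single j (1 : ℝ))
    (y := L)
  rw [EuclideanSpace.inner_single_right] at h
  rw [dualVec, cvec_apply, ← h]
  simp

theorem norm_dualVec {n : ℕ} (L : EuclideanSpace ℝ (Fin n) →L[ℝ] ℝ) : ‖dualVec L‖ = ‖L‖ := by
  rw [dualVec, norm_cvec, LinearIsometryEquiv.norm_map]

theorem continuous_dualVec {n : ℕ} : Continuous (dualVec (n := n)) :=
  continuous_cvec.comp (LinearIsometryEquiv.continuous _)

variable {A : EuclideanSpace ℝ (Fin (d + 1)) → EuclideanSpace ℝ (Fin (d + 1))} {β : ℝ}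
  {u : EuclideanSpace ℝ (Fin d) → ℂ}

/-- The phase of the parallel transport from `(y, 0)` to `X`. -/
def phase (A : EuclideanSpace ℝ (Fin (d + 1)) → EuclideanSpace ℝ (Fin (d + 1)))
    (X : EuclideanSpace ℝ (Fin (d + 1))) (y : EuclideanSpace ℝ (Fin d)) : ℂ :=
  Complex.exp (Complex.I * (intPot A X (pt y 0) : ℂ))

theorem norm_phase (X : EuclideanSpace ℝ (Fin (d + 1))) (y : EuclideanSpace ℝ (Fin d)) :
    ‖phase A X y‖ = 1 := norm_exp_I_mul _

/-- The mollifier twisted by the parallel transport. -/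
def gaugeKernel (A : EuclideanSpace ℝ (Fin (d + 1)) → EuclideanSpace ℝ (Fin (d + 1)))
    (X : EuclideanSpace ℝ (Fin (d + 1))) (y : EuclideanSpace ℝ (Fin d)) : ℂ :=
  mollifier X y * phase A X y

/-- The gradient of `gaugeKernel` with respect to the point. -/
def gaugeKernelGrad (A : EuclideanSpace ℝ (Fin (d + 1)) → EuclideanSpace ℝ (Fin (d + 1)))
    (X : EuclideanSpace ℝ (Fin (d + 1))) (y : EuclideanSpace ℝ (Fin d)) :
    EuclideanSpace ℂ (Fin (d + 1)) :=
  phase A X y • (dualVec (mollifierDeriv X y)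
    + (Complex.I * mollifier X y) • dualVec (intPotDeriv A X (pt y 0)))

theorem continuous_phase (hA : ContDiff ℝ 1 A) :
    Continuous fun z : EuclideanSpace ℝ (Fin (d + 1)) × EuclideanSpace ℝ (Fin d) =>
      phase A z.1 z.2 := by
  have h := continuous_intPot_comp (α := EuclideanSpace ℝ (Fin (d + 1)) × EuclideanSpace ℝ (Fin d))
    (f := fun z => z.1) (g := fun z => pt z.2 0) hA.continuous
    (by fun_prop) (by fun_prop)
  unfold phase
  exact Complex.continuous_exp.comp (continuous_const.mul (Complex.continuous_ofReal.comp h))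

theorem kernelContinuous_gaugeKernel (hA : ContDiff ℝ 1 A) :
    KernelContinuous (gaugeKernel A) :=
  (Complex.continuous_ofReal.comp_continuousOn kernelContinuous_mollifier).mul
    (continuous_phase hA).continuousOn

theorem kernelContinuous_gaugeKernelGrad (hA : ContDiff ℝ 1 A) :
    KernelContinuous (gaugeKernelGrad A) := by
  have h1 := Continuous.comp (continuous_intPotDeriv hA)
    (f := fun z : EuclideanSpace ℝ (Fin (d + 1)) × EuclideanSpace ℝ (Fin d) => (z.1, pt z.2 0))
    (by fun_prop)
  have h2 := continuous_dualVec.comp h1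
  have h3 := continuous_dualVec.comp_continuousOn (kernelContinuous_mollifierDeriv (d := d))
  have h4 := Complex.continuous_ofReal.comp_continuousOn (kernelContinuous_mollifier (d := d))
  exact (continuous_phase hA).continuousOn.smul
    (h3.add ((continuousOn_const.mul h4).smul h2.continuousOn))

theorem kernelSupport_gaugeKernel : KernelSupport (gaugeKernel A) := by
  intro X hX y h
  rw [gaugeKernel, kernelSupport_mollifier X hX y h, Complex.ofReal_zero, zero_mul]

theorem dualVec_zero {n : ℕ} : dualVec (0 : EuclideanSpace ℝ (Fin n) →L[ℝ] ℝ) = 0 := by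
  rw [← norm_eq_zero, norm_dualVec, norm_zero]

theorem kernelSupport_gaugeKernelGrad : KernelSupport (gaugeKernelGrad A) := by
  intro X hX y h
  rw [gaugeKernelGrad, kernelSupport_mollifier X hX y h, kernelSupport_mollifierDeriv X hX y h,
    dualVec_zero]
  simp

theorem hasFDerivAt_phase (hA : ContDiff ℝ 1 A) (X : EuclideanSpace ℝ (Fin (d + 1)))
    (y : EuclideanSpace ℝ (Fin d)) :
    HasFDerivAt (fun X => phase A X y)
      (phase A X y • (Complex.I • Complex.ofRealCLM.comp (intPotDeriv A X (pt y 0)))) X := by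
  have h1 := Complex.ofRealCLM.hasFDerivAt.comp X (hasFDerivAt_intPot hA X (pt y 0))
  exact (h1.const_mul Complex.I).cexp

theorem grad_gaugeKernel (hA : ContDiff ℝ 1 A) {X : EuclideanSpace ℝ (Fin (d + 1))}
    (hX : X ∈ halfSpace d) (y : EuclideanSpace ℝ (Fin d)) :
    DifferentiableAt ℝ (fun X => gaugeKernel A X y) X ∧
      grad (fun X => gaugeKernel A X y) X = gaugeKernelGrad A X y := by
  have h1 := Complex.ofRealCLM.hasFDerivAt.comp X (hasFDerivAt_mollifier hX y)
  have h2 : HasFDerivAt (fun X => gaugeKernel A X y) _ X := h1.mul (hasFDerivAt_phase hA X y)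
  refine ⟨h2.differentiableAt, ?_⟩
  ext j
  rw [grad_apply, h2.fderiv]
  simp only [gaugeKernelGrad, add_apply, smul_apply, ContinuousLinearMap.comp_apply,
    Complex.ofRealCLM_apply, smul_eq_mul, PiLp.smul_apply, PiLp.add_apply, dualVec_apply,
    Function.comp]
  ring

/-- The covariant average of `u` at the scale of the height. -/
def gaugeAverage (A : EuclideanSpace ℝ (Fin (d + 1)) → EuclideanSpace ℝ (Fin (d + 1)))
    (u : EuclideanSpace ℝ (Fin d) → ℂ) (X : EuclideanSpace ℝ (Fin (d + 1))) : ℂ :=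
  ∫ y, u y • gaugeKernel A X y

/-- The gradient of `gaugeAverage`. -/
def gaugeAverageGrad (A : EuclideanSpace ℝ (Fin (d + 1)) → EuclideanSpace ℝ (Fin (d + 1)))
    (u : EuclideanSpace ℝ (Fin d) → ℂ) (X : EuclideanSpace ℝ (Fin (d + 1))) :
    EuclideanSpace ℂ (Fin (d + 1)) :=
  ∫ y, u y • gaugeKernelGrad A X y

theorem hasWeakGradient_gaugeAverage (hA : ContDiff ℝ 1 A) (hu : LocallyIntegrable u) :
    HasWeakGradient (halfSpace d) (gaugeAverage A u) (gaugeAverageGrad A u) :=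
  hasWeakGradient_kernel (kernelContinuous_gaugeKernel hA) (kernelContinuous_gaugeKernelGrad hA)
    kernelSupport_gaugeKernel kernelSupport_gaugeKernelGrad
    (fun _ hX y => grad_gaugeKernel hA hX y) hu

theorem kernelContinuous_dualVec :
    KernelContinuous fun (X : EuclideanSpace ℝ (Fin (d + 1))) (y : EuclideanSpace ℝ (Fin d)) =>
      dualVec (mollifierDeriv X y) :=
  continuous_dualVec.comp_continuousOn kernelContinuous_mollifierDeriv

theorem kernelSupport_dualVec :
    KernelSupport fun (X : EuclideanSpace ℝ (Fin (d + 1))) (y : EuclideanSpace ℝ (Fin d)) =>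
      dualVec (mollifierDeriv X y) := by
  intro X hX y h
  simp only [kernelSupport_mollifierDeriv X hX y h, dualVec_zero]

theorem kernelContinuous_ofReal_mollifier :
    KernelContinuous fun (X : EuclideanSpace ℝ (Fin (d + 1))) (y : EuclideanSpace ℝ (Fin d)) =>
      (mollifier X y : ℂ) :=
  Complex.continuous_ofReal.comp_continuousOn kernelContinuous_mollifier

theorem kernelSupport_ofReal_mollifier :
    KernelSupport fun (X : EuclideanSpace ℝ (Fin (d + 1))) (y : EuclideanSpace ℝ (Fin d)) =>
      (mollifier X y : ℂ) := by
  intro X hX y h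
  simp only [kernelSupport_mollifier X hX y h, Complex.ofReal_zero]

/-- The average of the constant `1` is `1`, whose weak gradient is zero. Uniqueness of weak
gradients makes the averaged derivative vanish almost everywhere, which suffices for norm estimates.
-/
theorem integral_mollifierDeriv_ae :
    ∀ᵐ X ∂volume.restrict (halfSpace d), ∫ y, dualVec (mollifierDeriv X y) = 0 := by
  have hd : ∀ X ∈ halfSpace d, ∀ y, DifferentiableAt ℝ (fun X => (mollifier X y : ℂ)) X ∧
      grad (fun X => (mollifier X y : ℂ)) X = dualVec (mollifierDeriv X y) := by
    intro X hX y
    have h1 := Complex.ofRealCLM.hasFDerivAt.comp X (hasFDerivAt_mollifier hX y)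
    have h2 : HasFDerivAt (fun X => (mollifier X y : ℂ)) _ X := h1
    refine ⟨h2.differentiableAt, ?_⟩
    ext j
    rw [grad_apply, h2.fderiv]
    simp
  have h1 := hasWeakGradient_kernel (u := fun _ => 1) kernelContinuous_ofReal_mollifier
    kernelContinuous_dualVec kernelSupport_ofReal_mollifier kernelSupport_dualVec hd
    (locallyIntegrable_const 1)
  have h2 : HasWeakGradient (halfSpace d) (fun _ => (1 : ℂ)) 0 := by
    have := hasWeakGradient_grad (f := fun _ => (1 : ℂ)) contDiff_const (halfSpace d)
    have e : grad (fun _ : EuclideanSpace ℝ (Fin (d + 1)) => (1 : ℂ)) = 0 := by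
      funext X; ext j; simp
    rwa [e] at this
  have h3 : (fun X => ∫ y, (1 : ℂ) • (mollifier X y : ℂ))
      =ᵐ[volume.restrict (halfSpace d)] fun _ => 1 := by
    filter_upwards [ae_restrict_mem measurableSet_halfSpace] with X hX
    simp only [one_smul, integral_complex_ofReal, integral_mollifier hX, Complex.ofReal_one]
  filter_upwards [(h1.congr h3).unique (isOpen_halfSpace d) h2] with X hX
  simpa using hX

theorem enorm_integral_le_ball {F : Type*} [NormedAddCommGroup F] [NormedSpace ℝ F]
    {f : EuclideanSpace ℝ (Fin d) → F} {h : EuclideanSpace ℝ (Fin d) → ℝ} {x : EuclideanSpace ℝ (Fin d)}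
    {t c : ℝ} (hc : 0 ≤ c) (h0 : ∀ y, t < ‖x - y‖ → f y = 0)
    (h1 : ∀ y, ‖x - y‖ ≤ t → ‖f y‖ ≤ c * h y) :
    ‖∫ y, f y‖ₑ ≤ ENNReal.ofReal c * ∫⁻ y in Metric.closedBall x t, ENNReal.ofReal (h y) := by
  refine (enorm_integral_le_lintegral_enorm _).trans ?_
  rw [← lintegral_const_mul' _ _ ENNReal.ofReal_ne_top,
    ← lintegral_indicator Metric.isClosed_closedBall.measurableSet]
  refine lintegral_mono fun y => ?_
  by_cases hy : ‖x - y‖ ≤ t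
  · rw [indicator_of_mem (by rwa [Metric.mem_closedBall, dist_comm, dist_eq_norm]),
      ← ENNReal.ofReal_mul hc, ← ofReal_norm]
    exact ENNReal.ofReal_le_ofReal (h1 y hy)
  · rw [h0 y (not_le.1 hy)]
    simp

/-- A bound for the covariant oscillation of `u` between `y` and the projection of `X`. -/
def oscBound (A : EuclideanSpace ℝ (Fin (d + 1)) → EuclideanSpace ℝ (Fin (d + 1))) (β : ℝ)
    (u : EuclideanSpace ℝ (Fin d) → ℂ) (X : EuclideanSpace ℝ (Fin (d + 1)))
    (y : EuclideanSpace ℝ (Fin d)) : ℝ :=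
  ‖covDiff (tangential A) u (base X) y‖ + 4 * β * X (Fin.last d) ^ 2 * ‖u y‖

theorem norm_pt_sub_le {X : EuclideanSpace ℝ (Fin (d + 1))} (hX : X ∈ halfSpace d)
    {y : EuclideanSpace ℝ (Fin d)} (hy : ‖base X - y‖ ≤ X (Fin.last d)) :
    ‖pt y 0 - X‖ ≤ 2 * X (Fin.last d) := by
  have hX0 : 0 < X (Fin.last d) := hX
  have e : pt y 0 - X = pt (y - base X) (0 - X (Fin.last d)) := by rw [pt_sub, pt_base]
  rw [e]
  refine (norm_pt_le _ _).trans ?_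
  rw [norm_sub_rev, zero_sub, abs_neg, abs_of_pos hX0]
  linarith

/-- The values of `u` at `y` and at `base X`, both transported to `X`, are compared through a
triangle. Its vertical side has the height `t` as length and the slanted one at most `2 t`, so its
flux is at most `2 β t²`. The linear bound on phases suffices, the height being kept of order at
most `β^{-1/2}` later. -/
theorem norm_transport_sub_le (hA : ContDiff ℝ 1 A) (hβ : FieldBound A β) (hβ0 : 0 ≤ β)
    {X : EuclideanSpace ℝ (Fin (d + 1))} (hX : X ∈ halfSpace d) {y : EuclideanSpace ℝ (Fin d)}
    (hy : ‖base X - y‖ ≤ X (Fin.last d)) :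
    ‖phase A X y * u y - phase A X (base X) * u (base X)‖
      ≤ ‖covDiff (tangential A) u (base X) y‖ + 2 * β * X (Fin.last d) ^ 2 * ‖u y‖ := by
  have hX0 : 0 < X (Fin.last d) := hX
  set I1 := intPot A X (pt y 0) with h1
  set I2 := intPot A X (pt (base X) 0) with h2
  set I3 := intPot A (pt (base X) 0) (pt y 0) with h3
  have hc : |I3 + I2 - I1| ≤ 2 * β * X (Fin.last d) ^ 2 := by
    have h := abs_circulation_le hA hβ (X := pt (base X) 0) (Y := pt y 0) (W := X)
      (pt_mem_closedHalfSpace le_rfl) (pt_mem_closedHalfSpace le_rfl)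
      (halfSpace_subset_closedHalfSpace hX)
    rw [← h3, ← h2, intPot_symm X (pt y 0), ← h1] at h
    have e : pt (base X) 0 - X = pt 0 (-X (Fin.last d)) := by
      conv_lhs => rw [← pt_base X, ← pt_sub]
      simp
    rw [e, norm_pt_zero_left, abs_neg, abs_of_pos hX0] at h
    have h5 := norm_pt_sub_le hX hy
    calc |I3 + I2 - I1| = |I3 + -I1 + I2| := by ring_nf
      _ ≤ _ := h
      _ ≤ β * X (Fin.last d) * (2 * X (Fin.last d)) := by gcongr
      _ = _ := by ring
  have e1 : phase A X y * u y - phase A X (base X) * u (base X)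
      = phase A X (base X) * covDiff (tangential A) u (base X) y
        + (phase A X y - Complex.exp (Complex.I * ((I3 + I2 : ℝ) : ℂ))) * u y := by
    rw [covDiff, intPot_tangential, ← h3, Complex.ofReal_add, mul_add, Complex.exp_add]
    simp only [phase, ← h1, ← h2]
    ring
  rw [e1]
  refine (norm_add_le _ _).trans ?_
  rw [norm_mul, norm_mul, norm_phase, one_mul]
  gcongr
  rw [norm_sub_rev]
  exact (norm_exp_sub_exp_le _ _).trans hc

theorem enorm_gaugeAverage_le {X : EuclideanSpace ℝ (Fin (d + 1))} (hX : X ∈ halfSpace d) :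
    ‖gaugeAverage A u X‖ₑ ≤ ENNReal.ofReal (kernelConst d * (X (Fin.last d))⁻¹ ^ d) *
      ∫⁻ y in Metric.closedBall (base X) (X (Fin.last d)), ‖u y‖ₑ := by
  have hX0 : 0 < X (Fin.last d) := hX
  simp only [← ofReal_norm (u _)]
  refine enorm_integral_le_ball (mul_nonneg (kernelConst_nonneg d) (by positivity))
    (fun y hy => ?_) fun y hy => ?_
  · rw [kernelSupport_gaugeKernel X hX y hy, smul_zero]
  · rw [norm_smul, gaugeKernel, norm_mul, norm_phase, mul_one, Complex.norm_real, mul_comm]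
    gcongr
    exact abs_mollifier_le hX y

/-- The mollifier has mass one, so the boundary value can be put inside the average. Up to a phase,
the strip difference is then an average of differences of transports. -/
theorem enorm_stripDiff_gaugeAverage_le (hA : ContDiff ℝ 1 A) (hβ : FieldBound A β)
    (hβ0 : 0 ≤ β) (hu : LocallyIntegrable u)
    {X : EuclideanSpace ℝ (Fin (d + 1))} (hX : X ∈ halfSpace d) :
    ‖stripDiff A (gaugeAverage A u) u X‖ₑ
      ≤ ENNReal.ofReal (kernelConst d * (X (Fin.last d))⁻¹ ^ d) *
      ∫⁻ y in Metric.closedBall (base X) (X (Fin.last d)), ENNReal.ofReal (oscBound A β u X y) := by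
  have hX0 : 0 < X (Fin.last d) := hX
  have i1 := integrable_kernel (kernelContinuous_gaugeKernel hA) kernelSupport_gaugeKernel hu hX
  have i2 := integrable_kernel (u := fun _ => phase A X (base X) * u (base X))
    kernelContinuous_ofReal_mollifier kernelSupport_ofReal_mollifier (locallyIntegrable_const _) hX
  have e : stripDiff A (gaugeAverage A u) u X
      = Complex.exp (Complex.I * (intPot A (pt (base X) 0) X : ℂ)) *
        ∫ y, (u y • gaugeKernel A X y
          - (phase A X (base X) * u (base X)) • (mollifier X y : ℂ)) := by
    rw [integral_sub i1 i2, integral_smul, integral_complex_ofReal, integral_mollifier hX,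
      stripDiff, gaugeAverage, mul_sub, smul_eq_mul, Complex.ofReal_one, mul_one, ← mul_assoc,
      phase, ← Complex.exp_add, intPot_symm X (pt (base X) 0)]
    simp
  rw [e, enorm_mul, ← ofReal_norm (Complex.exp _), norm_exp_I_mul, ENNReal.ofReal_one, one_mul]
  refine enorm_integral_le_ball (mul_nonneg (kernelConst_nonneg d) (by positivity))
    (fun y hy => ?_) fun y hy => ?_
  · simp only [kernelSupport_gaugeKernel X hX y hy, kernelSupport_mollifier X hX y hy, smul_zero,
      Complex.ofReal_zero, sub_zero]
  · have e2 : u y • gaugeKernel A X y - (phase A X (base X) * u (base X)) • (mollifier X y : ℂ)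
        = mollifier X y * (phase A X y * u y - phase A X (base X) * u (base X)) := by
      simp only [gaugeKernel, smul_eq_mul]; ring
    rw [e2, norm_mul, Complex.norm_real]
    refine mul_le_mul (abs_mollifier_le hX y)
      ((norm_transport_sub_le hA hβ hβ0 hX hy).trans ?_) (norm_nonneg _)
      (mul_nonneg (kernelConst_nonneg d) (by positivity))
    rw [oscBound]
    gcongr
    norm_num

/-- Two cancellations are displayed. The derivative of the mollifier has integral zero, so a value
independent of `y` may be subtracted from the transported `u y`. The derivative of the phase
combines with `A(X)` into the remainder of `intPotDeriv_apply`, which only involves `dA`. -/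
theorem covGradOf_gaugeAverage_eq (hA : ContDiff ℝ 1 A) (hu : LocallyIntegrable u)
    {X : EuclideanSpace ℝ (Fin (d + 1))} (hX : X ∈ halfSpace d)
    (h0 : ∫ y, dualVec (mollifierDeriv X y) = 0) :
    covGradOf A (gaugeAverage A u) (gaugeAverageGrad A u) X
      = ∫ y, ((phase A X y * u y - phase A X (base X) * u (base X)) • dualVec (mollifierDeriv X y)
        + (u y * phase A X y * Complex.I * mollifier X y) •
          dualVec (intPotDeriv A X (pt y 0) + innerSL ℝ (A X))) := by
  have i1 := integrable_kernel (kernelContinuous_gaugeKernel hA) kernelSupport_gaugeKernel hu hX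
  have i2 := integrable_kernel (kernelContinuous_gaugeKernelGrad hA) kernelSupport_gaugeKernelGrad
    hu hX
  have i3 := integrable_kernel (u := fun _ => phase A X (base X) * u (base X))
    kernelContinuous_dualVec kernelSupport_dualVec (locallyIntegrable_const _) hX
  have i4 : Integrable fun y => (Complex.I * (u y • gaugeKernel A X y)) • cvec (A X) :=
    (i1.const_mul Complex.I).smul_const _
  have e : covGradOf A (gaugeAverage A u) (gaugeAverageGrad A u) X
      = (∫ y, u y • gaugeKernelGrad A X y)
        + (∫ y, (Complex.I * (u y • gaugeKernel A X y)) • cvec (A X))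
        - ∫ y, (phase A X (base X) * u (base X)) • dualVec (mollifierDeriv X y) := by
    rw [integral_smul_const, integral_const_mul, integral_smul, h0, smul_zero, sub_zero,
      covGradOf_eq]
    rfl
  rw [e, ← integral_add i2 i4]
  refine (integral_sub (i2.add i4) i3).symm.trans ?_
  congr 1
  funext y
  ext j
  simp only [Pi.add_apply, gaugeKernelGrad, gaugeKernel, PiLp.sub_apply, PiLp.add_apply, PiLp.smul_apply,
    smul_eq_mul, dualVec_apply, cvec_apply, add_apply, innerSL_apply_apply,
    EuclideanSpace.inner_single_right, Complex.ofReal_add]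
  simp
  ring

/-- With `t` the height, the derivative of the mollifier costs `t^{-(d+1)}` against an oscillation
containing `2 β t² |u|`. The derivative of the phase costs only `t^{-d}` against `2 β t |u|`, which
is the same size; together they make the `4 β t²` of `oscBound`. -/
theorem enorm_covGradOf_gaugeAverage_le (hA : ContDiff ℝ 1 A) (hβ : FieldBound A β)
    (hβ0 : 0 ≤ β) (hu : LocallyIntegrable u) :
    ∀ᵐ X ∂volume.restrict (halfSpace d),
      ‖covGradOf A (gaugeAverage A u) (gaugeAverageGrad A u) X‖ₑ
        ≤ ENNReal.ofReal (kernelConst d * (X (Fin.last d))⁻¹ ^ (d + 1)) *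
      ∫⁻ y in Metric.closedBall (base X) (X (Fin.last d)), ENNReal.ofReal (oscBound A β u X y) := by
  filter_upwards [integral_mollifierDeriv_ae, ae_restrict_mem measurableSet_halfSpace]
    with X h0 hX
  have hX0 : 0 < X (Fin.last d) := hX
  rw [covGradOf_gaugeAverage_eq hA hu hX h0]
  refine enorm_integral_le_ball (mul_nonneg (kernelConst_nonneg d) (by positivity))
    (fun y hy => ?_) fun y hy => ?_
  · simp only [kernelSupport_mollifier X hX y hy, kernelSupport_mollifierDeriv X hX y hy,
      dualVec_zero, smul_zero, Complex.ofReal_zero, mul_zero, zero_smul, add_zero]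
  · refine (norm_add_le _ _).trans ?_
    have hC := kernelConst_nonneg d
    have b1 := mul_le_mul (norm_transport_sub_le (u := u) hA hβ hβ0 hX hy)
      (norm_mollifierDeriv_le hX y) (norm_nonneg _) (by positivity)
    have b2 : ‖intPotDeriv A X (pt y 0) + innerSL ℝ (A X)‖ ≤ β * (2 * X (Fin.last d)) := by
      refine ContinuousLinearMap.opNorm_le_bound _ (by positivity) fun v => ?_
      rw [add_apply, innerSL_apply_apply, Real.norm_eq_abs]
      refine (abs_intPotDeriv_add_le hA hβ (halfSpace_subset_closedHalfSpace hX)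
        (pt_mem_closedHalfSpace le_rfl) v).trans ?_
      have := norm_pt_sub_le hX hy
      calc β * ‖v‖ * ‖pt y 0 - X‖ ≤ β * ‖v‖ * (2 * X (Fin.last d)) := by gcongr
        _ = _ := by ring
    have b3 := mul_le_mul (abs_mollifier_le hX y) b2 (norm_nonneg _)
      (mul_nonneg hC (by positivity))
    have e3 : (X (Fin.last d))⁻¹ ^ d = (X (Fin.last d))⁻¹ ^ (d + 1) * X (Fin.last d) := by
      rw [pow_succ, mul_assoc, inv_mul_cancel₀ hX0.ne', mul_one]
    rw [norm_smul, norm_smul, norm_dualVec, norm_dualVec, norm_mul, norm_mul, norm_mul, norm_phase,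
      Complex.norm_I, Complex.norm_real, mul_one, mul_one, mul_assoc, Real.norm_eq_abs]
    refine (add_le_add b1 (mul_le_mul_of_nonneg_left b3 (norm_nonneg (u y)))).trans (le_of_eq ?_)
    rw [e3, oscBound]
    ring

end gauge

end MagneticTrace

end

noncomputable section

namespace MagneticTrace

/-! ### Integrability of averages at the scale of the height -/

section averages

variable {d : ℕ} {p : ℝ}

/-- The volume of the unit ball. -/
def ballVol (d : ℕ) : ℝ≥0∞ := volume (Metric.ball (0 : EuclideanSpace ℝ (Fin d)) 1)

theorem ballVol_lt_top : ballVol d < ⊤ := measure_ball_lt_top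

theorem volume_closedBall_eq (x : EuclideanSpace ℝ (Fin d)) {t : ℝ} (ht : 0 ≤ t) :
    volume (Metric.closedBall x t) = ENNReal.ofReal (t ^ d) * ballVol d := by
  rw [Measure.addHaar_closedBall _ _ ht, finrank_euclideanSpace_fin, ballVol]

/-- The integral of `G (x, ·)` over the ball of radius `t` about `x`, for `X = (x, t)`. -/
def ballIntegral (G : EuclideanSpace ℝ (Fin d) → EuclideanSpace ℝ (Fin d) → ℝ≥0∞)
    (X : EuclideanSpace ℝ (Fin (d + 1))) : ℝ≥0∞ :=
  ∫⁻ y in Metric.closedBall (base X) (X (Fin.last d)), G (base X) y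

/-- The ball in `y` is rewritten as the condition `‖x - y‖ ≤ t` on the height, ready for integrating
in `t` first. -/
theorem ballIntegral_pt (G : EuclideanSpace ℝ (Fin d) → EuclideanSpace ℝ (Fin d) → ℝ≥0∞)
    (x : EuclideanSpace ℝ (Fin d)) (t : ℝ) : ballIntegral G (pt x t)
      = ∫⁻ y, (Ici ‖x - y‖).indicator (fun _ => G x y) t := by
  rw [ballIntegral, base_pt, pt_last, ← lintegral_indicator Metric.isClosed_closedBall.measurableSet]
  refine lintegral_congr fun y => ?_
  by_cases h : ‖x - y‖ ≤ t
  · rw [indicator_of_mem (by rwa [Metric.mem_closedBall, dist_comm, dist_eq_norm]),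
      indicator_of_mem (by exact h)]
  · rw [indicator_of_notMem (by rwa [Metric.mem_closedBall, dist_comm, dist_eq_norm]),
      indicator_of_notMem (by exact h)]

variable {G : EuclideanSpace ℝ (Fin d) → EuclideanSpace ℝ (Fin d) → ℝ≥0∞}

theorem measurable_indicator_Ici (hG : Measurable (Function.uncurry G)) :
    Measurable fun z : (EuclideanSpace ℝ (Fin d) × ℝ) × EuclideanSpace ℝ (Fin d) =>
      (Ici ‖z.1.1 - z.2‖).indicator (fun _ => G z.1.1 z.2) z.1.2 := by
  have hs : MeasurableSet {z : (EuclideanSpace ℝ (Fin d) × ℝ) × EuclideanSpace ℝ (Fin d) |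
      ‖z.1.1 - z.2‖ ≤ z.1.2} := measurableSet_le (by fun_prop) (by fun_prop)
  have hg : Measurable fun z : (EuclideanSpace ℝ (Fin d) × ℝ) × EuclideanSpace ℝ (Fin d) =>
      G z.1.1 z.2 := by
    have h : Measurable fun z : (EuclideanSpace ℝ (Fin d) × ℝ) × EuclideanSpace ℝ (Fin d) =>
      (z.1.1, z.2) := by fun_prop
    exact hG.comp h
  exact hg.indicator hs

theorem measurable_ballIntegral (hG : Measurable (Function.uncurry G)) :
    Measurable (ballIntegral G) := by
  have h : Measurable fun z : EuclideanSpace ℝ (Fin d) × ℝ =>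
      ∫⁻ y, (Ici ‖z.1 - y‖).indicator (fun _ => G z.1 y) z.2 :=
    (measurable_indicator_Ici hG).lintegral_prod_right'
  have h2 : Measurable fun X : EuclideanSpace ℝ (Fin (d + 1)) => (base X, X (Fin.last d)) := by
    fun_prop
  have h3 := h.comp h2
  convert h3 using 1
  funext X
  conv_lhs => rw [← pt_base X]
  exact ballIntegral_pt G _ _

/-- Hölder's inequality on the ball contributes its volume to the power `p - 1`, hence `t^{d(p-1)}`,
against `t^{-mp}` from the prefactor. -/
theorem rpow_ballIntegral_le (hp : 1 < p) (hG : Measurable (Function.uncurry G)) (m : ℕ)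
    (x : EuclideanSpace ℝ (Fin d)) {t : ℝ} (ht : 0 < t) :
    (ENNReal.ofReal (t⁻¹ ^ m) * ballIntegral G (pt x t)) ^ p
      ≤ ballVol d ^ (p - 1) * (ENNReal.ofReal (t ^ (d * (p - 1) - m * p)) *
        ballIntegral (fun x y => G x y ^ p) (pt x t)) := by
  have hp0 : 0 < p := by linarith
  have h := lintegral_rpow_le (μ := volume.restrict (Metric.closedBall x t)) hp
    (g := G x) (hG.comp (by fun_prop : Measurable fun y => (x, y))).aemeasurable
  rw [Measure.restrict_apply_univ, volume_closedBall_eq x ht.le,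
    ENNReal.mul_rpow_of_nonneg _ _ (by linarith)] at h
  simp only [ballIntegral, base_pt, pt_last]
  rw [ENNReal.mul_rpow_of_nonneg _ _ hp0.le]
  refine (mul_le_mul_right h _).trans (le_of_eq ?_)
  have e : ENNReal.ofReal (t⁻¹ ^ m) ^ p * ENNReal.ofReal (t ^ d) ^ (p - 1)
      = ENNReal.ofReal (t ^ (d * (p - 1) - m * p)) := by
    rw [ENNReal.ofReal_rpow_of_pos (by positivity), ENNReal.ofReal_rpow_of_pos (by positivity),
      ← ENNReal.ofReal_mul (by positivity)]
    congr 1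
    rw [← Real.rpow_natCast, ← Real.rpow_natCast, ← Real.rpow_mul (by positivity),
      ← Real.rpow_mul ht.le, Real.inv_rpow ht.le, ← Real.rpow_neg ht.le, ← Real.rpow_add ht]
    congr 1
    ring
  rw [← e]
  ring

/-- The weight `t ^ e` on `t ≥ r`. -/
def coneWeight (e r t : ℝ) : ℝ≥0∞ := (Ici r).indicator (fun t => ENNReal.ofReal (t ^ e)) t

theorem coneWeight_of_le {e r t : ℝ} (h : r ≤ t) : coneWeight e r t = ENNReal.ofReal (t ^ e) :=
  indicator_of_mem (by exact h) _

theorem coneWeight_of_not_le {e r t : ℝ} (h : ¬ r ≤ t) : coneWeight e r t = 0 :=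
  indicator_of_notMem (by exact h) _

@[fun_prop]
theorem measurable_coneWeight {α : Type*} [MeasurableSpace α] {r t : α → ℝ} (hr : Measurable r)
    (ht : Measurable t) (e : ℝ) : Measurable fun a => coneWeight e (r a) (t a) := by
  have h : Measurable fun a => ENNReal.ofReal (t a ^ e) := by fun_prop
  exact h.indicator (measurableSet_le hr ht)

/-- After Hölder's inequality, Tonelli's theorem gathers for each pair `x, y` all heights `t ≥ ‖x -
y‖`. The case `m = d + 1` on the whole half-line produces the Gagliardo kernel; the case `m = d` on
`(0, T)` produces an `L^p` norm. -/
theorem lintegral_slab_ballIntegral_le (hp : 1 < p) (hG : Measurable (Function.uncurry G)) (m : ℕ)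
    {S : Set ℝ} (hS : MeasurableSet S) (hS0 : S ⊆ Ioi 0) :
    ∫⁻ X in slab d S, (ENNReal.ofReal ((X (Fin.last d))⁻¹ ^ m) * ballIntegral G X) ^ p
      ≤ ballVol d ^ (p - 1) * ∫⁻ x, ∫⁻ y, G x y ^ p *
        ∫⁻ t in S, coneWeight (d * (p - 1) - m * p) ‖x - y‖ t := by
  have hm : Measurable fun X : EuclideanSpace ℝ (Fin (d + 1)) =>
      (ENNReal.ofReal ((X (Fin.last d))⁻¹ ^ m) * ballIntegral G X) ^ p := by
    have h1 := measurable_ballIntegral hG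
    have h2 : Measurable fun X : EuclideanSpace ℝ (Fin (d + 1)) =>
      ENNReal.ofReal ((X (Fin.last d))⁻¹ ^ m) := by fun_prop
    exact (h2.mul h1).pow_const p
  rw [lintegral_slab hS hm, ← lintegral_const_mul' _ _
    (ENNReal.rpow_lt_top_of_nonneg (by linarith) ballVol_lt_top.ne).ne]
  refine lintegral_mono fun x => ?_
  calc ∫⁻ t in S, (ENNReal.ofReal ((pt x t (Fin.last d))⁻¹ ^ m) * ballIntegral G (pt x t)) ^ p
      ≤ ∫⁻ t in S, ballVol d ^ (p - 1) * ∫⁻ y, G x y ^ p *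
          coneWeight (d * (p - 1) - m * p) ‖x - y‖ t := by
        refine setLIntegral_mono' hS fun t ht => ?_
        rw [pt_last]
        refine (rpow_ballIntegral_le hp hG m x (hS0 ht)).trans (le_of_eq ?_)
        rw [ballIntegral_pt, ← lintegral_const_mul' _ _ ENNReal.ofReal_ne_top]
        congr 1
        refine lintegral_congr fun y => ?_
        by_cases h : ‖x - y‖ ≤ t
        · rw [coneWeight_of_le h, indicator_of_mem (by exact h), mul_comm]
        · rw [coneWeight_of_not_le h, indicator_of_notMem (by exact h), mul_zero, mul_zero]
    _ = _ := by
        rw [lintegral_const_mul' _ _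
          (ENNReal.rpow_lt_top_of_nonneg (by linarith) ballVol_lt_top.ne).ne]
        congr 1
        have hw : Measurable fun z : ℝ × EuclideanSpace ℝ (Fin d) =>
            coneWeight (d * (p - 1) - m * p) ‖x - z.2‖ z.1 := by fun_prop
        have hg : Measurable fun z : ℝ × EuclideanSpace ℝ (Fin d) => G x z.2 ^ p := by
          have h : Measurable fun z : ℝ × EuclideanSpace ℝ (Fin d) => (x, z.2) := by fun_prop
          exact (hG.comp h).pow_const p
        rw [lintegral_lintegral_swap (hg.mul hw).aemeasurable]
        refine lintegral_congr fun y => ?_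
        exact lintegral_const_mul _ (by fun_prop)

theorem lintegral_Ici_rpow_le {q : ℝ} (hq : 1 < q) {r : ℝ} (hr : 0 < r) :
    ∫⁻ t in Ioi (0 : ℝ), coneWeight (-q) r t
      = ENNReal.ofReal (1 / (q - 1)) / ENNReal.ofReal r ^ (q - 1) := by
  unfold coneWeight
  rw [lintegral_indicator measurableSet_Ici, Measure.restrict_restrict measurableSet_Ici,
    inter_eq_left.2 (Ici_subset_Ioi.2 hr), setLIntegral_congr Ioi_ae_eq_Ici.symm,
    ← ofReal_integral_eq_lintegral_ofReal (integrableOn_Ioi_rpow_of_lt (by linarith) hr),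
    integral_Ioi_rpow_of_lt (by linarith) hr, ENNReal.ofReal_rpow_of_pos hr,
    ← ENNReal.ofReal_div_of_pos (by positivity)]
  · congr 1
    rw [show -q + 1 = -(q - 1) by ring, Real.rpow_neg hr.le]
    field_simp
  · filter_upwards [ae_restrict_mem measurableSet_Ioi] with t ht
    exact Real.rpow_nonneg (hr.le.trans (le_of_lt ht)) _

/-- The averages of the increments of `u` are controlled by the Gagliardo seminorm. -/
theorem lintegral_average_increment_le (hp : 1 < p) (hG : Measurable (Function.uncurry G))
    (hG0 : ∀ x, G x x = 0) :
    ∫⁻ X in halfSpace d, (ENNReal.ofReal ((X (Fin.last d))⁻¹ ^ (d + 1)) * ballIntegral G X) ^ p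
      ≤ ballVol d ^ (p - 1) * ENNReal.ofReal (1 / (d + p - 1)) *
        ∫⁻ x, ∫⁻ y, G x y ^ p / ‖y - x‖ₑ ^ ((d : ℝ) + (1 - 1 / p) * p) := by
  have hp0 : 0 < p := by linarith
  have hd0 : (0 : ℝ) ≤ d := Nat.cast_nonneg d
  rw [halfSpace_eq_slab]
  refine (lintegral_slab_ballIntegral_le hp hG (d + 1) measurableSet_Ioi subset_rfl).trans
    (le_of_eq ?_)
  rw [mul_assoc, ← lintegral_const_mul' _ _ ENNReal.ofReal_ne_top]
  congr 1
  refine lintegral_congr fun x => ?_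
  rw [← lintegral_const_mul' _ _ ENNReal.ofReal_ne_top]
  refine lintegral_congr fun y => ?_
  by_cases h : y = x
  · subst h
    simp [hG0, hp0]
  · have hr : 0 < ‖x - y‖ := norm_pos_iff.2 (sub_ne_zero.2 (Ne.symm h))
    -- The weight is `t^{-(d+p)}`, whose integral over `t ≥ r` is `r^{-(d+p-1)} / (d + p - 1)`: the
    -- Gagliardo kernel, exactly.
    have e1 : (d : ℝ) * (p - 1) - ((d + 1 : ℕ) : ℝ) * p = -(d + p) := by push_cast; ring
    have e2 : (d : ℝ) + (1 - 1 / p) * p = d + p - 1 := by field_simp; ring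
    rw [e1, lintegral_Ici_rpow_le (by linarith) hr, e2, ← ofReal_norm (y - x), norm_sub_rev y x]
    simp only [div_eq_mul_inv]
    ring

/-- The weight is now `t^{-d}`, the reciprocal of the volume of a ball up to a constant. Integrating
in `x` at fixed `y` and `t` gives the volume of the unit ball, and the heights contribute `T`. -/
theorem lintegral_average_le (hp : 1 < p) {g : EuclideanSpace ℝ (Fin d) → ℝ≥0∞} (hg : Measurable g)
    {T : ℝ} :
    ∫⁻ X in slab d (Ioo 0 T),
        (ENNReal.ofReal ((X (Fin.last d))⁻¹ ^ d) * ballIntegral (fun _ => g) X) ^ p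
      ≤ ballVol d ^ p * ENNReal.ofReal T * ∫⁻ y, g y ^ p := by
  have hp0 : 0 < p := by linarith
  refine (lintegral_slab_ballIntegral_le hp (G := fun _ => g) (hg.comp measurable_snd) d
    measurableSet_Ioo fun t ht => ht.1).trans ?_
  have e1 : (d : ℝ) * (p - 1) - d * p = -d := by ring
  rw [e1]
  have hw : Measurable fun z : (EuclideanSpace ℝ (Fin d) × EuclideanSpace ℝ (Fin d)) × ℝ =>
      coneWeight (-(d : ℝ)) ‖z.1.1 - z.1.2‖ z.2 := by fun_prop
  have hw1 : Measurable fun z : EuclideanSpace ℝ (Fin d) × EuclideanSpace ℝ (Fin d) =>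
      ∫⁻ t in Ioo 0 T, coneWeight (-(d : ℝ)) ‖z.1 - z.2‖ t :=
    hw.lintegral_prod_right' (ν := volume.restrict (Ioo 0 T))
  rw [lintegral_lintegral_swap ((hg.comp measurable_snd).pow_const p |>.mul hw1).aemeasurable]
  have key : ∀ y : EuclideanSpace ℝ (Fin d), ∫⁻ x, ∫⁻ t in Ioo 0 T,
      coneWeight (-(d : ℝ)) ‖x - y‖ t
        = ballVol d * ENNReal.ofReal T := by
    intro y
    have hw2 : Measurable fun z : EuclideanSpace ℝ (Fin d) × ℝ =>
        coneWeight (-(d : ℝ)) ‖z.1 - y‖ z.2 := by fun_prop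
    rw [lintegral_lintegral_swap hw2.aemeasurable]
    have : ∀ t ∈ Ioo 0 T, ∫⁻ x : EuclideanSpace ℝ (Fin d),
        coneWeight (-(d : ℝ)) ‖x - y‖ t = ballVol d := by
      intro t ht
      have e : ∀ x : EuclideanSpace ℝ (Fin d),
          coneWeight (-(d : ℝ)) ‖x - y‖ t
            = (Metric.closedBall y t).indicator (fun _ => ENNReal.ofReal (t ^ (-(d : ℝ)))) x := by
        intro x
        by_cases h : ‖x - y‖ ≤ t
        · rw [coneWeight_of_le h, indicator_of_mem (by rwa [Metric.mem_closedBall, dist_eq_norm])]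
        · rw [coneWeight_of_not_le h,
            indicator_of_notMem (by rwa [Metric.mem_closedBall, dist_eq_norm])]
      simp only [e]
      rw [lintegral_indicator_const Metric.isClosed_closedBall.measurableSet,
        volume_closedBall_eq y ht.1.le, ← mul_assoc, ← ENNReal.ofReal_mul (Real.rpow_nonneg ht.1.le _),
        Real.rpow_neg ht.1.le, Real.rpow_natCast, inv_mul_cancel₀ (pow_pos ht.1 d).ne',
        ENNReal.ofReal_one, one_mul]
    rw [setLIntegral_congr_fun measurableSet_Ioo this, lintegral_const,
      Measure.restrict_apply_univ, Real.volume_Ioo, sub_zero]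
  have e2 : ∀ y : EuclideanSpace ℝ (Fin d), ∫⁻ x, g y ^ p * ∫⁻ t in Ioo 0 T,
      coneWeight (-(d : ℝ)) ‖x - y‖ t
        = g y ^ p * (ballVol d * ENNReal.ofReal T) := by
    intro y
    have h : Measurable fun x : EuclideanSpace ℝ (Fin d) => ∫⁻ t in Ioo 0 T,
        coneWeight (-(d : ℝ)) ‖x - y‖ t :=
      Measurable.lintegral_prod_right' (f := fun z : EuclideanSpace ℝ (Fin d) × ℝ =>
        coneWeight (-(d : ℝ)) ‖z.1 - y‖ z.2) (by fun_prop)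
    rw [lintegral_const_mul _ h, key y]
  simp only [e2]
  rw [lintegral_mul_const _ (hg.pow_const p)]
  have e3 : ballVol d ^ p = ballVol d ^ (p - 1) * ballVol d := by
    have := ENNReal.rpow_add_of_nonneg (x := ballVol d) (p - 1) 1 (by linarith) zero_le_one
    rwa [sub_add_cancel, ENNReal.rpow_one] at this
  rw [e3]
  exact le_of_eq (by ring)

end averages

end MagneticTrace

end

noncomputable section

namespace MagneticTrace

/-! ### Estimates for the covariant average -/

section estimates

variable {d : ℕ} {p : ℝ} {A : EuclideanSpace ℝ (Fin (d + 1)) → EuclideanSpace ℝ (Fin (d + 1))}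
  {β : ℝ} {u : EuclideanSpace ℝ (Fin d) → ℂ}

theorem continuous_tangential (hA : Continuous A) : Continuous (tangential A) := by
  have e : tangential A = fun x => base (A (pt x 0)) := rfl
  rw [e]
  fun_prop

theorem measurable_covDiff {n : ℕ} {a : EuclideanSpace ℝ (Fin n) → EuclideanSpace ℝ (Fin n)}
    (ha : Continuous a) {u : EuclideanSpace ℝ (Fin n) → ℂ} (hu : Measurable u) :
    Measurable (Function.uncurry (covDiff a u)) := by
  have h := (continuous_intPot ha).measurable
  unfold Function.uncurry covDiff
  fun_prop

/-- The average increment of `u` divided by the height. -/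
def averageIncrement (A : EuclideanSpace ℝ (Fin (d + 1)) → EuclideanSpace ℝ (Fin (d + 1)))
    (u : EuclideanSpace ℝ (Fin d) → ℂ) (X : EuclideanSpace ℝ (Fin (d + 1))) : ℝ≥0∞ :=
  ENNReal.ofReal ((X (Fin.last d))⁻¹ ^ (d + 1)) *
    ballIntegral (fun x y => ‖covDiff (tangential A) u x y‖ₑ) X

/-- The average size of `u` at the scale of the height. -/
def averageSize (u : EuclideanSpace ℝ (Fin d) → ℂ) (X : EuclideanSpace ℝ (Fin (d + 1))) : ℝ≥0∞ :=
  ENNReal.ofReal ((X (Fin.last d))⁻¹ ^ d) * ballIntegral (fun _ y => ‖u y‖ₑ) X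

theorem measurable_averageIncrement (hA : Continuous A) (hu : Measurable u) :
    Measurable (averageIncrement A u) := by
  have h1 : Measurable (ballIntegral fun x y => ‖covDiff (tangential A) u x y‖ₑ) :=
    measurable_ballIntegral (measurable_covDiff (continuous_tangential hA) hu).enorm
  have h2 : Measurable fun X : EuclideanSpace ℝ (Fin (d + 1)) =>
      ENNReal.ofReal ((X (Fin.last d))⁻¹ ^ (d + 1)) := by fun_prop
  exact h2.mul h1

theorem measurable_averageSize (hu : Measurable u) : Measurable (averageSize u) := by
  have h1 : Measurable (ballIntegral fun (_ : EuclideanSpace ℝ (Fin d)) y => ‖u y‖ₑ) :=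
    measurable_ballIntegral (hu.comp measurable_snd).enorm
  have h2 : Measurable fun X : EuclideanSpace ℝ (Fin (d + 1)) =>
      ENNReal.ofReal ((X (Fin.last d))⁻¹ ^ d) := by fun_prop
  exact h2.mul h1

/-- The constant in the estimates of the covariant average. -/
def averageConst (d : ℕ) (p : ℝ) : ℝ≥0∞ :=
  (ballVol d ^ (p - 1) * ENNReal.ofReal (1 / (d + p - 1))) ^ (1 / p) + ballVol d

theorem averageConst_lt_top (d : ℕ) (hp : 1 < p) : averageConst d p < ⊤ := by
  have hp0 : 0 < p := by linarith
  refine ENNReal.add_lt_top.2 ⟨ENNReal.rpow_lt_top_of_nonneg (by positivity) ?_, ballVol_lt_top⟩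
  exact (ENNReal.mul_lt_top (ENNReal.rpow_lt_top_of_nonneg (by linarith) ballVol_lt_top.ne)
    ENNReal.ofReal_lt_top).ne

theorem averageIncrement_Lp_le (hp : 1 < p) (hA : Continuous A) (hu : Measurable u) :
    (∫⁻ X in halfSpace d, averageIncrement A u X ^ p) ^ (1 / p)
      ≤ averageConst d p * gagliardo (tangential A) (1 - 1 / p) p u := by
  have hp0 : 0 < p := by linarith
  have h := lintegral_average_increment_le hp
    (G := fun x y => ‖covDiff (tangential A) u x y‖ₑ)
    (measurable_covDiff (continuous_tangential hA) hu).enorm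
    (fun x => by simp [covDiff, intPot_self])
  refine (ENNReal.rpow_le_rpow h (by positivity)).trans ?_
  rw [ENNReal.mul_rpow_of_nonneg _ _ (by positivity), gagliardo]
  gcongr
  exact le_self_add

theorem averageSize_Lp_le (hp : 1 < p) (hu : Measurable u) {T : ℝ} :
    (∫⁻ X in slab d (Ioo 0 T), averageSize u X ^ p) ^ (1 / p)
      ≤ averageConst d p * (ENNReal.ofReal T ^ (1 / p) * eLpNorm u (ENNReal.ofReal p) volume) := by
  have hp0 : 0 < p := by linarith
  have h := lintegral_average_le hp (g := fun y => ‖u y‖ₑ) hu.enorm (T := T)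
  refine (ENNReal.rpow_le_rpow h (by positivity)).trans ?_
  rw [ENNReal.mul_rpow_of_nonneg _ _ (by positivity), ENNReal.mul_rpow_of_nonneg _ _ (by positivity),
    ← ENNReal.rpow_mul, mul_one_div_cancel hp0.ne', ENNReal.rpow_one, ← eLpNorm_ofReal hp0,
    mul_assoc]
  gcongr
  exact le_add_self

theorem eLpNorm_le_of_enorm_le {α F : Type*} [MeasurableSpace α] [NormedAddCommGroup F]
    {μ : Measure α} (hp : 0 < p) {f : α → F} {g : α → ℝ≥0∞} (h : ∀ᵐ a ∂μ, ‖f a‖ₑ ≤ g a) :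
    eLpNorm f (ENNReal.ofReal p) μ ≤ (∫⁻ a, g a ^ p ∂μ) ^ (1 / p) := by
  rw [eLpNorm_ofReal hp]
  refine ENNReal.rpow_le_rpow (lintegral_mono_ae ?_) (by positivity)
  filter_upwards [h] with a ha
  gcongr

theorem lintegral_const_mul_rpow {α : Type*} [MeasurableSpace α] {μ : Measure α} (hp : 0 < p)
    {c : ℝ≥0∞} (hc : c ≠ ⊤) (g : α → ℝ≥0∞) :
    (∫⁻ a, (c * g a) ^ p ∂μ) ^ (1 / p) = c * (∫⁻ a, g a ^ p ∂μ) ^ (1 / p) := by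
  simp only [ENNReal.mul_rpow_of_nonneg _ _ hp.le]
  rw [lintegral_const_mul' _ _ (ENNReal.rpow_lt_top_of_nonneg hp.le hc).ne,
    ENNReal.mul_rpow_of_nonneg _ _ (by positivity), ← ENNReal.rpow_mul, mul_one_div_cancel hp.ne',
    ENNReal.rpow_one]

theorem lintegral_oscBound (hβ0 : 0 ≤ β) (hu : Measurable u)
    {X : EuclideanSpace ℝ (Fin (d + 1))} :
    ∫⁻ y in Metric.closedBall (base X) (X (Fin.last d)), ENNReal.ofReal (oscBound A β u X y)
      = ballIntegral (fun x y => ‖covDiff (tangential A) u x y‖ₑ) X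
        + ENNReal.ofReal (4 * β * X (Fin.last d) ^ 2) * ballIntegral (fun _ y => ‖u y‖ₑ) X := by
  rw [ballIntegral, ballIntegral, ← lintegral_const_mul' _ _ ENNReal.ofReal_ne_top,
    ← lintegral_add_right _ (hu.enorm.const_mul _)]
  refine lintegral_congr fun y => ?_
  rw [oscBound, ENNReal.ofReal_add (norm_nonneg _) (by positivity),
    ENNReal.ofReal_mul (by positivity), ofReal_norm, ofReal_norm]

/-- The flux term carries two powers of the height and the kernel removes `d + 1`. One power is left
over beside the normalized average, and it is bounded by `T`. -/
theorem oscillation_le (hβ0 : 0 ≤ β) (hu : Measurable u)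
    {X : EuclideanSpace ℝ (Fin (d + 1))} {T : ℝ} (hX : X ∈ slab d (Ioo 0 T)) :
    ENNReal.ofReal (kernelConst d * (X (Fin.last d))⁻¹ ^ (d + 1)) *
      ∫⁻ y in Metric.closedBall (base X) (X (Fin.last d)), ENNReal.ofReal (oscBound A β u X y)
      ≤ ENNReal.ofReal (kernelConst d) *
        (averageIncrement A u X + ENNReal.ofReal (4 * β * T) * averageSize u X) := by
  have hX0 : 0 < X (Fin.last d) := hX.1
  have hT : X (Fin.last d) < T := hX.2
  have hT0 : 0 < T := hX0.trans hT
  have key : (X (Fin.last d))⁻¹ ^ (d + 1) * (4 * β * X (Fin.last d) ^ 2)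
      ≤ 4 * β * T * (X (Fin.last d))⁻¹ ^ d := by
    calc (X (Fin.last d))⁻¹ ^ (d + 1) * (4 * β * X (Fin.last d) ^ 2)
        = 4 * β * X (Fin.last d) * (X (Fin.last d))⁻¹ ^ d := by
          rw [pow_succ]; field_simp
      _ ≤ _ := by gcongr
  rw [lintegral_oscBound hβ0 hu, ENNReal.ofReal_mul (kernelConst_nonneg d), mul_assoc, mul_add,
    averageIncrement, averageSize, ← mul_assoc (ENNReal.ofReal _) (ENNReal.ofReal _) (ballIntegral _ X),
    ← mul_assoc (ENNReal.ofReal (4 * β * T)), ← ENNReal.ofReal_mul (by positivity),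
    ← ENNReal.ofReal_mul (by positivity)]
  gcongr

theorem oscillation_Lp_le (hp : 1 < p) (hA : Continuous A) (hu : Measurable u) (β : ℝ) (T : ℝ) :
    (∫⁻ X in slab d (Ioo 0 T), (ENNReal.ofReal (kernelConst d) *
        (averageIncrement A u X + ENNReal.ofReal (4 * β * T) * averageSize u X)) ^ p) ^ (1 / p)
      ≤ ENNReal.ofReal (kernelConst d) * averageConst d p *
        (gagliardo (tangential A) (1 - 1 / p) p u + ENNReal.ofReal (4 * β * T) *
          (ENNReal.ofReal T ^ (1 / p) * eLpNorm u (ENNReal.ofReal p) volume)) := by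
  have hp0 : 0 < p := by linarith
  rw [lintegral_const_mul_rpow hp0 ENNReal.ofReal_ne_top, mul_assoc (ENNReal.ofReal (kernelConst d))]
  refine mul_le_mul_right ?_ (ENNReal.ofReal (kernelConst d))
  refine (ENNReal.lintegral_Lp_add_le (measurable_averageIncrement hA hu).aemeasurable
    ((measurable_averageSize hu).const_mul _).aemeasurable hp.le).trans ?_
  rw [mul_add]
  refine add_le_add ?_ ?_
  · refine le_trans (ENNReal.rpow_le_rpow (lintegral_mono_set ?_) (by positivity))
      (averageIncrement_Lp_le hp hA hu)
    exact fun X hX => hX.1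
  · rw [lintegral_const_mul_rpow hp0 ENNReal.ofReal_ne_top]
    refine (mul_le_mul_right (averageSize_Lp_le hp hu) _).trans (le_of_eq ?_)
    ring

theorem eLpNorm_gaugeAverage_le (hp : 1 < p) (hu : Measurable u) (T : ℝ) :
    eLpNorm (gaugeAverage A u) (ENNReal.ofReal p) (volume.restrict (slab d (Ioo 0 T)))
      ≤ ENNReal.ofReal (kernelConst d) * averageConst d p *
        (ENNReal.ofReal T ^ (1 / p) * eLpNorm u (ENNReal.ofReal p) volume) := by
  have hp0 : 0 < p := by linarith
  refine (eLpNorm_le_of_enorm_le hp0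
    (g := fun X => ENNReal.ofReal (kernelConst d) * averageSize u X) ?_).trans ?_
  · filter_upwards [ae_restrict_mem (measurableSet_slab measurableSet_Ioo)] with X hX
    refine (enorm_gaugeAverage_le (X := X) hX.1).trans (le_of_eq ?_)
    rw [averageSize, ENNReal.ofReal_mul (kernelConst_nonneg d), mul_assoc]
    rfl
  · rw [lintegral_const_mul_rpow hp0 ENNReal.ofReal_ne_top, mul_assoc]
    exact mul_le_mul_right (averageSize_Lp_le hp hu) _

theorem eLpNorm_covGradOf_gaugeAverage_le (hp : 1 < p) (hA : ContDiff ℝ 1 A)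
    (hβ : FieldBound A β) (hβ0 : 0 ≤ β) (hu : Measurable u) (hul : LocallyIntegrable u) (T : ℝ) :
    eLpNorm (covGradOf A (gaugeAverage A u) (gaugeAverageGrad A u)) (ENNReal.ofReal p)
        (volume.restrict (slab d (Ioo 0 T)))
      ≤ ENNReal.ofReal (kernelConst d) * averageConst d p *
        (gagliardo (tangential A) (1 - 1 / p) p u + ENNReal.ofReal (4 * β * T) *
          (ENNReal.ofReal T ^ (1 / p) * eLpNorm u (ENNReal.ofReal p) volume)) := by
  refine (eLpNorm_le_of_enorm_le (by linarith) ?_).trans (oscillation_Lp_le hp hA.continuous hu β T)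
  have hsub : slab d (Ioo 0 T) ⊆ halfSpace d := fun X hX => hX.1
  filter_upwards [ae_restrict_mem (measurableSet_slab measurableSet_Ioo),
    ae_restrict_of_ae_restrict_of_subset hsub (enorm_covGradOf_gaugeAverage_le hA hβ hβ0 hul)]
    with X hX h
  exact h.trans (oscillation_le hβ0 hu hX)

/-- Compared with the covariant gradient, one inverse power of the height is missing, and the height
is below `T`. This is the rate demanded by `IsTrace`. -/
theorem eLpNorm_stripDiff_gaugeAverage_le (hp : 1 < p) (hA : ContDiff ℝ 1 A)
    (hβ : FieldBound A β) (hβ0 : 0 ≤ β) (hu : Measurable u) (hul : LocallyIntegrable u) (T : ℝ) :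
    eLpNorm (stripDiff A (gaugeAverage A u) u) (ENNReal.ofReal p)
        (volume.restrict (slab d (Ioo 0 T)))
      ≤ ENNReal.ofReal T * (ENNReal.ofReal (kernelConst d) * averageConst d p *
        (gagliardo (tangential A) (1 - 1 / p) p u + ENNReal.ofReal (4 * β * T) *
          (ENNReal.ofReal T ^ (1 / p) * eLpNorm u (ENNReal.ofReal p) volume))) := by
  have hp0 : 0 < p := by linarith
  refine (eLpNorm_le_of_enorm_le hp0 (g := fun X => ENNReal.ofReal T *
    (ENNReal.ofReal (kernelConst d) *
        (averageIncrement A u X + ENNReal.ofReal (4 * β * T) * averageSize u X))) ?_).trans ?_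
  · filter_upwards [ae_restrict_mem (measurableSet_slab measurableSet_Ioo)] with X hX
    have hX0 : 0 < X (Fin.last d) := hX.1
    have hT : X (Fin.last d) < T := hX.2
    refine (enorm_stripDiff_gaugeAverage_le hA hβ hβ0 hul hX.1).trans ?_
    refine le_trans ?_ (mul_le_mul_right (oscillation_le (A := A) hβ0 hu hX) _)
    rw [← mul_assoc, ← ENNReal.ofReal_mul (hX0.trans hT).le]
    have hk := kernelConst_nonneg d
    have key : kernelConst d * (X (Fin.last d))⁻¹ ^ d
        ≤ T * (kernelConst d * (X (Fin.last d))⁻¹ ^ (d + 1)) := by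
      calc kernelConst d * (X (Fin.last d))⁻¹ ^ d
          = X (Fin.last d) * (kernelConst d * (X (Fin.last d))⁻¹ ^ (d + 1)) := by
            rw [pow_succ]; field_simp
        _ ≤ _ := by gcongr
    gcongr
  · rw [lintegral_const_mul_rpow hp0 ENNReal.ofReal_ne_top]
    exact mul_le_mul_right (oscillation_Lp_le hp hA.continuous hu β T) _

end estimates

end MagneticTrace

end

noncomputable section

namespace MagneticTrace

/-! ### The extension operator -/

section extension

variable {d : ℕ} {p : ℝ} {A : EuclideanSpace ℝ (Fin (d + 1)) → EuclideanSpace ℝ (Fin (d + 1))}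
  {b : ℝ} {u : EuclideanSpace ℝ (Fin d) → ℂ}

/-- A smooth cutoff on the line. -/
def cutoff : ContDiffBump (0 : ℝ) := ⟨1 / 4, 1 / 2, by norm_num, by norm_num⟩

theorem exists_cutoff_bound : ∃ M : ℝ, 0 ≤ M ∧ ∀ t, ‖fderiv ℝ cutoff t‖ ≤ M := by
  obtain ⟨M, hM⟩ := (cutoff.contDiff.continuous_fderiv (by simp :
    (1 : WithTop ℕ∞) ≠ 0)).bounded_above_of_compact_support (cutoff.hasCompactSupport.fderiv ℝ)
  exact ⟨M, (norm_nonneg _).trans (hM 0), hM⟩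

/-- A bound for the derivative of the cutoff. -/
def cutoffConst : ℝ := exists_cutoff_bound.choose

theorem cutoffConst_nonneg : 0 ≤ cutoffConst := exists_cutoff_bound.choose_spec.1

/-- The cutoff at height `b⁻¹`. -/
def heightCutoff (b : ℝ) (X : EuclideanSpace ℝ (Fin (d + 1))) : ℝ := cutoff (b * X (Fin.last d))

theorem contDiff_heightCutoff : ContDiff ℝ ∞ (heightCutoff (d := d) b) :=
  cutoff.contDiff.comp (by fun_prop)

theorem hasFDerivAt_heightCutoff (X : EuclideanSpace ℝ (Fin (d + 1))) :
    HasFDerivAt (heightCutoff b)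
      ((fderiv ℝ cutoff (b * X (Fin.last d))).comp (b • lastL d)) X := by
  have h1 : HasFDerivAt (fun X : EuclideanSpace ℝ (Fin (d + 1)) => b * X (Fin.last d))
      (b • lastL d) X := (b • lastL d).hasFDerivAt
  have h2 := ((cutoff.contDiff (n := 1)).differentiable one_ne_zero
    (b * X (Fin.last d))).hasFDerivAt
  exact h2.comp X h1

theorem norm_gradient_heightCutoff_le (hb : 0 ≤ b) (X : EuclideanSpace ℝ (Fin (d + 1))) :
    ‖gradient (heightCutoff b) X‖ ≤ b * cutoffConst := by
  rw [norm_gradient, (hasFDerivAt_heightCutoff X).fderiv]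
  refine (ContinuousLinearMap.opNorm_comp_le _ _).trans ?_
  rw [norm_smul, Real.norm_of_nonneg hb, mul_comm]
  have h1 := exists_cutoff_bound.choose_spec.2 (b * X (Fin.last d))
  calc b * ‖lastL d‖ * ‖fderiv ℝ cutoff (b * X (Fin.last d))‖
      ≤ b * 1 * cutoffConst := by
        gcongr
        · exact norm_lastL_le
        · exact h1
    _ = _ := by ring

theorem heightCutoff_eq_one (hb : 0 < b) {T : ℝ} (hT : T ≤ (4 * b)⁻¹)
    {X : EuclideanSpace ℝ (Fin (d + 1))} (hX : X ∈ slab d (Ioo 0 T)) : heightCutoff b X = 1 := by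
  have hX0 : 0 < X (Fin.last d) := hX.1
  have hX1 : X (Fin.last d) < T := hX.2
  refine cutoff.one_of_mem_closedBall ?_
  rw [mem_closedBall_zero_iff, Real.norm_of_nonneg (by positivity)]
  show b * X (Fin.last d) ≤ 1 / 4
  calc b * X (Fin.last d) ≤ b * (4 * b)⁻¹ := by gcongr; linarith
    _ = 1 / 4 := by field_simp

theorem notMem_tsupport_cutoff (hb : 0 < b) {X : EuclideanSpace ℝ (Fin (d + 1))}
    (hX : b⁻¹ ≤ X (Fin.last d)) : b * X (Fin.last d) ∉ tsupport cutoff := by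
  rw [cutoff.tsupport_eq, mem_closedBall_zero_iff, not_le]
  show 1 / 2 < _
  have h1 : 1 ≤ b * X (Fin.last d) := by
    calc 1 = b * b⁻¹ := (mul_inv_cancel₀ hb.ne').symm
      _ ≤ _ := by gcongr
  rw [Real.norm_of_nonneg (by linarith)]
  linarith

theorem heightCutoff_eq_zero (hb : 0 < b) {X : EuclideanSpace ℝ (Fin (d + 1))}
    (hX : b⁻¹ ≤ X (Fin.last d)) : heightCutoff b X = 0 :=
  image_eq_zero_of_notMem_tsupport (f := cutoff) (notMem_tsupport_cutoff hb hX)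

theorem gradient_heightCutoff_eq_zero (hb : 0 < b) {X : EuclideanSpace ℝ (Fin (d + 1))}
    (hX : b⁻¹ ≤ X (Fin.last d)) : gradient (heightCutoff b) X = 0 := by
  rw [← norm_eq_zero, norm_gradient, (hasFDerivAt_heightCutoff X).fderiv,
    image_eq_zero_of_notMem_tsupport fun h =>
      notMem_tsupport_cutoff hb hX (tsupport_fderiv_subset ℝ h)]
  simp

/-- The extension of `u` to the half-space. -/
def extend (A : EuclideanSpace ℝ (Fin (d + 1)) → EuclideanSpace ℝ (Fin (d + 1))) (b : ℝ)
    (u : EuclideanSpace ℝ (Fin d) → ℂ) (X : EuclideanSpace ℝ (Fin (d + 1))) : ℂ :=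
  heightCutoff b X • gaugeAverage A u X

/-- The gradient of `extend`. -/
def extendGrad (A : EuclideanSpace ℝ (Fin (d + 1)) → EuclideanSpace ℝ (Fin (d + 1))) (b : ℝ)
    (u : EuclideanSpace ℝ (Fin d) → ℂ) (X : EuclideanSpace ℝ (Fin (d + 1))) :
    EuclideanSpace ℂ (Fin (d + 1)) :=
  heightCutoff b X • gaugeAverageGrad A u X
    + gaugeAverage A u X • cvec (gradient (heightCutoff b) X)

theorem hasWeakGradient_extend (hA : ContDiff ℝ 1 A) (hul : LocallyIntegrable u) (b : ℝ) :
    HasWeakGradient (halfSpace d) (extend A b u) (extendGrad A b u) :=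
  (hasWeakGradient_gaugeAverage hA hul).smul_contDiff (isOpen_halfSpace d) contDiff_heightCutoff

theorem eLpNorm_halfSpace_eq_slab {F : Type*} [NormedAddCommGroup F] {q : ℝ≥0∞} {T : ℝ}
    {f : EuclideanSpace ℝ (Fin (d + 1)) → F} (hf : ∀ X, T ≤ X (Fin.last d) → f X = 0) :
    eLpNorm f q (volume.restrict (halfSpace d))
      = eLpNorm f q (volume.restrict (slab d (Ioo 0 T))) := by
  have e : f = (slab d (Iio T)).indicator f := by
    funext X
    by_cases h : X (Fin.last d) < T
    · rw [indicator_of_mem (by exact h)]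
    · rw [indicator_of_notMem (by exact h), hf X (not_lt.1 h)]
  conv_lhs => rw [e]
  rw [eLpNorm_indicator_eq_eLpNorm_restrict (measurableSet_slab measurableSet_Iio),
    Measure.restrict_restrict (measurableSet_slab measurableSet_Iio)]
  congr 2
  ext X
  exact and_comm

theorem HasWeakGradient.aestronglyMeasurable {n : ℕ} {Ω : Set (EuclideanSpace ℝ (Fin n))}
    {U : EuclideanSpace ℝ (Fin n) → ℂ}
    {V : EuclideanSpace ℝ (Fin n) → EuclideanSpace ℂ (Fin n)} (h : HasWeakGradient Ω U V) :
    AEStronglyMeasurable U (volume.restrict Ω) := h.1.aestronglyMeasurable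

theorem HasWeakGradient.aestronglyMeasurable_covGradOf {n : ℕ}
    {A : EuclideanSpace ℝ (Fin n) → EuclideanSpace ℝ (Fin n)} (hA : Continuous A)
    {Ω : Set (EuclideanSpace ℝ (Fin n))} {U : EuclideanSpace ℝ (Fin n) → ℂ}
    {V : EuclideanSpace ℝ (Fin n) → EuclideanSpace ℂ (Fin n)} (h : HasWeakGradient Ω U V) :
    AEStronglyMeasurable (covGradOf A U V) (volume.restrict Ω) := by
  have e : covGradOf A U V = fun X => V X + (Complex.I * U X) • cvec (A X) :=
    funext (covGradOf_eq A U V)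
  rw [e]
  exact h.2.1.aestronglyMeasurable.add ((h.aestronglyMeasurable.const_mul _).smul
    (continuous_cvec.comp hA).aestronglyMeasurable)

/-- The constant in the estimate of the extension. -/
def extendConst (d : ℕ) (p : ℝ) : ℝ≥0∞ :=
  ENNReal.ofReal (kernelConst d) * averageConst d p * ENNReal.ofReal (5 + cutoffConst)

theorem extendConst_lt_top (d : ℕ) (hp : 1 < p) : extendConst d p < ⊤ :=
  ENNReal.mul_lt_top (ENNReal.mul_lt_top ENNReal.ofReal_lt_top (averageConst_lt_top d hp))
    ENNReal.ofReal_lt_top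

theorem eLpNorm_extend_le_slab (hb : 0 < b) :
    eLpNorm (extend A b u) (ENNReal.ofReal p) (volume.restrict (halfSpace d))
      ≤ eLpNorm (gaugeAverage A u) (ENNReal.ofReal p)
        (volume.restrict (slab d (Ioo 0 b⁻¹))) := by
  rw [eLpNorm_halfSpace_eq_slab (T := b⁻¹) fun X hX => by
    rw [extend, heightCutoff_eq_zero hb hX, zero_smul]]
  refine eLpNorm_mono fun X => ?_
  rw [extend, norm_smul]
  refine mul_le_of_le_one_left (norm_nonneg _) ?_
  rw [heightCutoff, Real.norm_of_nonneg cutoff.nonneg]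
  exact cutoff.le_one

theorem eLpNorm_covGradOf_extend_le_slab (hp : 1 < p) (hA : ContDiff ℝ 1 A) (hb : 0 < b)
    (hul : LocallyIntegrable u) :
    eLpNorm (covGradOf A (extend A b u) (extendGrad A b u)) (ENNReal.ofReal p)
        (volume.restrict (halfSpace d))
      ≤ eLpNorm (covGradOf A (gaugeAverage A u) (gaugeAverageGrad A u)) (ENNReal.ofReal p)
          (volume.restrict (slab d (Ioo 0 b⁻¹)))
        + ENNReal.ofReal (b * cutoffConst) * eLpNorm (gaugeAverage A u) (ENNReal.ofReal p)
          (volume.restrict (slab d (Ioo 0 b⁻¹))) := by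
  have hw := hasWeakGradient_gaugeAverage hA hul
  have hsub : slab d (Ioo 0 b⁻¹) ⊆ halfSpace d := fun X hX => hX.1
  have e : covGradOf A (extend A b u) (extendGrad A b u)
      = (fun X => heightCutoff b X • covGradOf A (gaugeAverage A u) (gaugeAverageGrad A u) X)
        + fun X => gaugeAverage A u X • cvec (gradient (heightCutoff b) X) :=
    funext fun X => covGradOf_smul_contDiff A _ _ _ X
  rw [eLpNorm_halfSpace_eq_slab (T := b⁻¹) fun X hX => by
    rw [e, Pi.add_apply, heightCutoff_eq_zero hb hX, gradient_heightCutoff_eq_zero hb hX, zero_smul,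
      zero_add, (norm_eq_zero.1 (by simp) : cvec (0 : EuclideanSpace ℝ (Fin (d + 1))) = 0),
      smul_zero], e]
  have hη := (contDiff_heightCutoff (d := d) (b := b))
  refine (eLpNorm_add_le ?_ ?_ (by simpa using hp.le)).trans (add_le_add ?_ ?_)
  · exact hη.continuous.aestronglyMeasurable.smul
      ((hw.aestronglyMeasurable_covGradOf hA.continuous).mono_measure
        (Measure.restrict_mono hsub le_rfl))
  · exact (hw.aestronglyMeasurable.mono_measure (Measure.restrict_mono hsub le_rfl)).smul
      (continuous_cvec.comp (continuous_gradient (hη.of_le (by simp)))).aestronglyMeasurable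
  · refine eLpNorm_mono fun X => ?_
    rw [norm_smul]
    refine mul_le_of_le_one_left (norm_nonneg _) ?_
    rw [heightCutoff, Real.norm_of_nonneg cutoff.nonneg]
    exact cutoff.le_one
  · refine eLpNorm_le_mul_eLpNorm_of_ae_le_mul (Filter.Eventually.of_forall fun X => ?_) _
    rw [norm_smul, norm_cvec, mul_comm]
    gcongr
    exact norm_gradient_heightCutoff_le hb.le X

/-- The norm estimate for the extension. -/
theorem eLpNorm_extend_le (hp : 1 < p) (hA : ContDiff ℝ 1 A) (hb : 0 < b)
    (hβ : FieldBound A (b ^ 2)) (hu : Measurable u) (hul : LocallyIntegrable u) :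
    eLpNorm (covGradOf A (extend A b u) (extendGrad A b u)) (ENNReal.ofReal p)
        (volume.restrict (halfSpace d))
      + ENNReal.ofReal b * eLpNorm (extend A b u) (ENNReal.ofReal p)
        (volume.restrict (halfSpace d))
      ≤ extendConst d p * (gagliardo (tangential A) (1 - 1 / p) p u
        + ENNReal.ofReal (b ^ (1 - 1 / p)) * eLpNorm u (ENNReal.ofReal p) volume) := by
  have hp0 : 0 < p := by linarith
  have hM := cutoffConst_nonneg
  have h1 := eLpNorm_gaugeAverage_le (A := A) hp hu b⁻¹
  have h2 := eLpNorm_covGradOf_gaugeAverage_le hp hA hβ (sq_nonneg b) hu hul b⁻¹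
  have h3 := eLpNorm_extend_le_slab (A := A) (u := u) (p := p) hb
  have h4 := eLpNorm_covGradOf_extend_le_slab hp hA hb hul
  -- At height `T = b⁻¹` with field bound `b ^ 2`, the flux coefficient `4 β T` is `4 b`, of the
  -- same order as the gradient of the cutoff.
  rw [show 4 * b ^ 2 * b⁻¹ = 4 * b by field_simp] at h2
  set K := ENNReal.ofReal (kernelConst d) * averageConst d p with hK
  set N := gagliardo (tangential A) (1 - 1 / p) p u
  set L := eLpNorm u (ENNReal.ofReal p) volume
  have hY : ENNReal.ofReal b * (ENNReal.ofReal b⁻¹ ^ (1 / p) * L)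
      = ENNReal.ofReal (b ^ (1 - 1 / p)) * L := by
    rw [← mul_assoc, ENNReal.ofReal_rpow_of_pos (by positivity), ← ENNReal.ofReal_mul hb.le,
      Real.inv_rpow hb.le, Real.rpow_sub hb, Real.rpow_one,
      ← div_eq_mul_inv b]
  set Z := ENNReal.ofReal b⁻¹ ^ (1 / p) * L
  rw [← hY]
  have e4 : ENNReal.ofReal (4 * b) = 4 * ENNReal.ofReal b := by
    rw [ENNReal.ofReal_mul (by norm_num)]; norm_num
  have eM : ENNReal.ofReal (b * cutoffConst) = ENNReal.ofReal cutoffConst * ENNReal.ofReal b := by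
    rw [mul_comm, ENNReal.ofReal_mul hM]
  have e5 : ENNReal.ofReal (5 + cutoffConst) = 5 + ENNReal.ofReal cutoffConst := by
    rw [ENNReal.ofReal_add (by norm_num) hM]; norm_num
  rw [eM] at h4
  rw [e4] at h2
  rw [extendConst, ← hK, e5]
  refine (add_le_add (h4.trans (add_le_add h2 (mul_le_mul_right h1 _)))
    (mul_le_mul_right (h3.trans h1) _)).trans ?_
  -- The factor `5 + cutoffConst` collects `4` from the flux, `1` from the zeroth-order term and
  -- `cutoffConst` from the gradient of the cutoff.
  calc K * (N + 4 * ENNReal.ofReal b * Z) + ENNReal.ofReal cutoffConst * ENNReal.ofReal b * (K * Z)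
        + ENNReal.ofReal b * (K * Z)
      = K * N + K * (5 + ENNReal.ofReal cutoffConst) * (ENNReal.ofReal b * Z) := by ring
    _ ≤ K * (5 + ENNReal.ofReal cutoffConst) * N
        + K * (5 + ENNReal.ofReal cutoffConst) * (ENNReal.ofReal b * Z) := by
      gcongr
      refine le_mul_of_one_le_right' ?_
      exact (by norm_num : (1 : ℝ≥0∞) ≤ 5).trans le_self_add
    _ = _ := by ring

/-- Near the boundary, the extension stays close to `u`. -/
theorem eLpNorm_stripDiff_extend_le (hp : 1 < p) (hA : ContDiff ℝ 1 A) (hb : 0 < b)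
    (hβ : FieldBound A (b ^ 2)) (hu : Measurable u) (hul : LocallyIntegrable u) {T : ℝ}
    (hT : T ≤ (4 * b)⁻¹) (hT1 : T ≤ 1) :
    eLpNorm (stripDiff A (extend A b u) u) (ENNReal.ofReal p)
        (volume.restrict (slab d (Ioo 0 T)))
      ≤ ENNReal.ofReal T * (ENNReal.ofReal (kernelConst d) * averageConst d p *
        (gagliardo (tangential A) (1 - 1 / p) p u + ENNReal.ofReal (4 * b ^ 2) *
          eLpNorm u (ENNReal.ofReal p) volume)) := by
  have hp0 : 0 < p := by linarith
  have e : eLpNorm (stripDiff A (extend A b u) u) (ENNReal.ofReal p)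
        (volume.restrict (slab d (Ioo 0 T)))
      = eLpNorm (stripDiff A (gaugeAverage A u) u) (ENNReal.ofReal p)
        (volume.restrict (slab d (Ioo 0 T))) := by
    refine eLpNorm_congr_ae ?_
    filter_upwards [ae_restrict_mem (measurableSet_slab measurableSet_Ioo)] with X hX
    rw [stripDiff, stripDiff, extend, heightCutoff_eq_one hb hT hX, one_smul]
  rw [e]
  refine (eLpNorm_stripDiff_gaugeAverage_le hp hA hβ (sq_nonneg b) hu hul T).trans ?_
  -- For `T ≤ 1` the powers of `T` inside the bracket are dropped, leaving a constant that does not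
  -- depend on `T`.
  have h1 : ENNReal.ofReal (4 * b ^ 2 * T) ≤ ENNReal.ofReal (4 * b ^ 2) :=
    ENNReal.ofReal_le_ofReal (mul_le_of_le_one_right (by positivity) hT1)
  have h2 : ENNReal.ofReal T ^ (1 / p) ≤ 1 :=
    ENNReal.rpow_le_one (by simpa using hT1) (by positivity)
  have h3 : ENNReal.ofReal T ^ (1 / p) * eLpNorm u (ENNReal.ofReal p) volume
      ≤ eLpNorm u (ENNReal.ofReal p) volume := mul_le_of_le_one_left' h2
  gcongr

end extension

end MagneticTrace

end

noncomputable section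

namespace MagneticTrace

/-! ### The trace of a Sobolev function -/

section trace

variable {d : ℕ} {p β : ℝ} {A : EuclideanSpace ℝ (Fin (d + 1)) → EuclideanSpace ℝ (Fin (d + 1))}
  {U U' : EuclideanSpace ℝ (Fin (d + 1)) → ℂ} {u u' : EuclideanSpace ℝ (Fin d) → ℂ} {T : ℝ}

theorem slab_Ioo_subset_halfSpace : slab d (Ioo 0 T) ⊆ halfSpace d := fun _ hX => hX.1

/-- The preimage of a null set under the projection is a product with a line, hence null: strip
differences do not depend on the representative of `u`. -/
theorem ae_comp_base {P : EuclideanSpace ℝ (Fin d) → Prop} (h : ∀ᵐ x, P x) :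
    ∀ᵐ X : EuclideanSpace ℝ (Fin (d + 1)), P (base X) := by
  obtain ⟨N, hN, hNm, hN0⟩ := exists_measurable_superset_of_null (ae_iff.1 h)
  refine ae_iff.2 (measure_mono_null (t := base ⁻¹' N) (fun X hX => hN hX) ?_)
  have hm : MeasurableSet (base (d := d) ⁻¹' N) := measurable_base hNm
  rw [← measurePreserving_pt.measure_preimage hm.nullMeasurableSet]
  have e : (fun z : EuclideanSpace ℝ (Fin d) × ℝ => pt z.1 z.2) ⁻¹' (base ⁻¹' N) = N ×ˢ univ := by
    ext z
    simp
  rw [e, Measure.prod_prod, hN0, zero_mul]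

theorem eLpNorm_comp_base (hp : 0 < p) (hu : Measurable u) :
    eLpNorm (fun X => u (base X)) (ENNReal.ofReal p) (volume.restrict (slab d (Ioo 0 T)))
      = ENNReal.ofReal T ^ (1 / p) * eLpNorm u (ENNReal.ofReal p) volume := by
  have hm : Measurable fun X : EuclideanSpace ℝ (Fin (d + 1)) => ‖u (base X)‖ₑ ^ p := by fun_prop
  rw [eLpNorm_ofReal hp, eLpNorm_ofReal hp, lintegral_slab measurableSet_Ioo hm,
    ← ENNReal.mul_rpow_of_nonneg _ _ (by positivity)]
  congr 1
  simp only [base_pt, lintegral_const, Measure.restrict_apply_univ, Real.volume_Ioo, sub_zero]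
  rw [lintegral_mul_const' _ _ ENNReal.ofReal_ne_top, mul_comm]

theorem continuous_stripPhase (hA : Continuous A) :
    Continuous fun X : EuclideanSpace ℝ (Fin (d + 1)) =>
      Complex.exp (Complex.I * (intPot A (pt (base X) 0) X : ℂ)) := by
  have h := continuous_intPot_comp hA
      (f := fun X : EuclideanSpace ℝ (Fin (d + 1)) => pt (base X) 0) (g := fun X => X)
      (by fun_prop) (by fun_prop)
  exact Complex.continuous_exp.comp (continuous_const.mul (Complex.continuous_ofReal.comp h))

theorem aestronglyMeasurable_stripPhase_mul (hA : Continuous A)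
    (hU : AEStronglyMeasurable U (volume.restrict (halfSpace d))) :
    AEStronglyMeasurable
      (fun X => Complex.exp (Complex.I * (intPot A (pt (base X) 0) X : ℂ)) * U X)
      (volume.restrict (slab d (Ioo 0 T))) :=
  (continuous_stripPhase hA).aestronglyMeasurable.mul
    (hU.mono_measure (Measure.restrict_mono slab_Ioo_subset_halfSpace le_rfl))

theorem aestronglyMeasurable_stripDiff (hA : Continuous A)
    (hU : AEStronglyMeasurable U (volume.restrict (halfSpace d))) (hu : Measurable u) :
    AEStronglyMeasurable (stripDiff A U u) (volume.restrict (slab d (Ioo 0 T))) :=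
  (aestronglyMeasurable_stripPhase_mul hA hU).sub (hu.comp measurable_base).aestronglyMeasurable

theorem eLpNorm_stripPhase_mul_le :
    eLpNorm (fun X => Complex.exp (Complex.I * (intPot A (pt (base X) 0) X : ℂ)) * U X)
      (ENNReal.ofReal p) (volume.restrict (slab d (Ioo 0 T)))
      ≤ eLpNorm U (ENNReal.ofReal p) (volume.restrict (halfSpace d)) := by
  refine (eLpNorm_mono fun X => ?_).trans
    (eLpNorm_mono_measure U (Measure.restrict_mono slab_Ioo_subset_halfSpace le_rfl))
  rw [norm_mul, norm_exp_I_mul, one_mul]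

/-- The size of the trace is controlled by the function near the boundary. -/
theorem rpow_mul_eLpNorm_le (hp : 1 < p) (hA : Continuous A)
    (hU : AEStronglyMeasurable U (volume.restrict (halfSpace d))) (hu : Measurable u) :
    ENNReal.ofReal T ^ (1 / p) * eLpNorm u (ENNReal.ofReal p) volume
      ≤ eLpNorm U (ENNReal.ofReal p) (volume.restrict (halfSpace d))
        + eLpNorm (stripDiff A U u) (ENNReal.ofReal p) (volume.restrict (slab d (Ioo 0 T))) := by
  rw [← eLpNorm_comp_base (by linarith) hu]
  have e : (fun X => u (base X))
      = (fun X => Complex.exp (Complex.I * (intPot A (pt (base X) 0) X : ℂ)) * U X)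
        - stripDiff A U u := by
    funext X
    simp [stripDiff]
  rw [e]
  refine (eLpNorm_sub_le (aestronglyMeasurable_stripPhase_mul hA hU)
    (aestronglyMeasurable_stripDiff hA hU hu) (by simpa using hp.le)).trans ?_
  gcongr
  exact eLpNorm_stripPhase_mul_le

/-- `u` is the trace of `U`: in `L^p` of the strip of width `T`, the transport of `U` to the
boundary differs from `u` by `O(T)`. -/
def IsTrace (A : EuclideanSpace ℝ (Fin (d + 1)) → EuclideanSpace ℝ (Fin (d + 1))) (p : ℝ)
    (U : EuclideanSpace ℝ (Fin (d + 1)) → ℂ) (u : EuclideanSpace ℝ (Fin d) → ℂ) : Prop :=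
  ∃ K : ℝ≥0∞, K ≠ ⊤ ∧ ∃ T₀ : ℝ, 0 < T₀ ∧ ∀ T, 0 < T → T ≤ T₀ →
    eLpNorm (stripDiff A U u) (ENNReal.ofReal p) (volume.restrict (slab d (Ioo 0 T)))
      ≤ ENNReal.ofReal T * K

theorem IsTrace.congr (h : IsTrace A p U u) (hU : U =ᵐ[volume.restrict (halfSpace d)] U')
    (hu : u =ᵐ[volume] u') : IsTrace A p U' u' := by
  obtain ⟨K, hK, T₀, hT₀, h⟩ := h
  refine ⟨K, hK, T₀, hT₀, fun T hT hT' => le_of_eq_of_le (eLpNorm_congr_ae ?_) (h T hT hT')⟩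
  filter_upwards [ae_restrict_of_ae_restrict_of_subset slab_Ioo_subset_halfSpace hU,
    ae_restrict_of_ae (ae_comp_base hu)] with X h1 h2
  simp only [stripDiff, h1, h2]

theorem IsTrace.add (hp : 1 < p) (hA : Continuous A)
    (hU : AEStronglyMeasurable U (volume.restrict (halfSpace d)))
    (hU' : AEStronglyMeasurable U' (volume.restrict (halfSpace d))) (hu : Measurable u)
    (hu' : Measurable u') (h : IsTrace A p U u) (h' : IsTrace A p U' u') :
    IsTrace A p (U + U') (u + u') := by
  obtain ⟨K, hK, T₀, hT₀, h⟩ := h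
  obtain ⟨K', hK', T₀', hT₀', h'⟩ := h'
  refine ⟨K + K', ENNReal.add_ne_top.2 ⟨hK, hK'⟩, min T₀ T₀', lt_min hT₀ hT₀', fun T hT hT' => ?_⟩
  have e : stripDiff A (U + U') (u + u') = stripDiff A U u + stripDiff A U' u' := by
    funext X
    simp only [stripDiff, Pi.add_apply]
    ring
  rw [e, mul_add]
  exact (eLpNorm_add_le (aestronglyMeasurable_stripDiff hA hU hu)
    (aestronglyMeasurable_stripDiff hA hU' hu') (by simpa using hp.le)).trans
    (add_le_add (h T hT (hT'.trans (min_le_left _ _))) (h' T hT (hT'.trans (min_le_right _ _))))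

theorem IsTrace.smul (c : ℂ) (h : IsTrace A p U u) : IsTrace A p (c • U) (c • u) := by
  obtain ⟨K, hK, T₀, hT₀, h⟩ := h
  refine ⟨‖c‖ₑ * K, ENNReal.mul_ne_top enorm_ne_top hK, T₀, hT₀, fun T hT hT' => ?_⟩
  have e : stripDiff A (c • U) (c • u) = c • stripDiff A U u := by
    funext X
    simp only [stripDiff, Pi.smul_apply, smul_eq_mul]
    ring
  rw [e, eLpNorm_const_smul, mul_left_comm]
  exact mul_le_mul_right (h T hT hT') _

theorem tendsto_ofReal_rpow_zero {q : ℝ} (hq : 0 < q) (K : ℝ≥0∞) (hK : K ≠ ⊤) :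
    Filter.Tendsto (fun T : ℝ => ENNReal.ofReal (T ^ q) * K) (nhdsWithin 0 (Ioi 0)) (nhds 0) := by
  have h1 : Filter.Tendsto (fun T : ℝ => T ^ q) (nhdsWithin 0 (Ioi 0)) (nhds 0) := by
    have := (Real.continuousAt_rpow_const 0 q (Or.inr hq.le)).tendsto
    rw [Real.zero_rpow hq.ne'] at this
    exact this.mono_left nhdsWithin_le_nhds
  have h2 := ENNReal.Tendsto.mul_const (ENNReal.tendsto_ofReal h1) (Or.inr hK)
  rwa [ENNReal.ofReal_zero, zero_mul] at h2

/-- On the strip of width `T` the function `u ∘ base` has norm `T^{1/p} ‖u‖`, while the strip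
difference is at most `K T`. Hence `‖u‖ ≤ K T^{1 - 1/p}`, which tends to `0` since `p > 1`. -/
theorem IsTrace.ae_eq_zero (hp : 1 < p) (hA : Continuous A) (hu : Measurable u)
    (h : IsTrace A p 0 u) : u =ᵐ[volume] 0 := by
  have hp0 : 0 < p := by linarith
  obtain ⟨K, hK, T₀, hT₀, h⟩ := h
  have h1 : ∀ T : ℝ, 0 < T → T ≤ T₀ → eLpNorm u (ENNReal.ofReal p) volume
      ≤ ENNReal.ofReal (T ^ (1 - 1 / p)) * K := by
    intro T hT hT'
    have h2 := (rpow_mul_eLpNorm_le (U := 0) (T := T) hp hA aestronglyMeasurable_zero hu)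
    rw [eLpNorm_zero, zero_add] at h2
    have h3 := mul_le_mul_right (h2.trans (h T hT hT')) (ENNReal.ofReal (T ^ (-(1 / p))))
    rw [ENNReal.ofReal_rpow_of_pos hT, ← mul_assoc, ← mul_assoc,
      ← ENNReal.ofReal_mul (by positivity), ← ENNReal.ofReal_mul (by positivity),
      ← Real.rpow_add hT, neg_add_cancel, Real.rpow_zero, ENNReal.ofReal_one, one_mul] at h3
    refine h3.trans (le_of_eq ?_)
    rw [show 1 - 1 / p = -(1 / p) + 1 by ring, Real.rpow_add hT, Real.rpow_one]
  have hq : 0 < 1 - 1 / p := by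
    have : 1 / p < 1 := (div_lt_one hp0).2 hp
    linarith
  have h4 : eLpNorm u (ENNReal.ofReal p) volume ≤ 0 := by
    refine ge_of_tendsto (tendsto_ofReal_rpow_zero hq K hK) ?_
    filter_upwards [Ioo_mem_nhdsGT hT₀] with T hT
    exact h1 T hT.1 hT.2.le
  exact (eLpNorm_eq_zero_iff hu.aestronglyMeasurable (by simpa using hp0)).1 (le_antisymm h4 bot_le)

/-- The trace is unique. -/
theorem IsTrace.unique (hp : 1 < p) (hA : Continuous A)
    (hU : AEStronglyMeasurable U (volume.restrict (halfSpace d))) (hu : Measurable u)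
    (hu' : Measurable u') (h : IsTrace A p U u) (h' : IsTrace A p U u') : u =ᵐ[volume] u' := by
  have h1 := h.add hp hA hU (hU.const_smul (-1 : ℂ)) hu (hu'.const_smul (-1 : ℂ)) (h'.smul (-1))
  have e : U + (-1 : ℂ) • U = 0 := by
    rw [neg_one_smul, add_neg_cancel]
  rw [e] at h1
  filter_upwards [h1.ae_eq_zero hp hA (hu.add (hu'.const_smul (-1 : ℂ)))] with x hx
  simpa [add_neg_eq_zero] using hx

theorem grad_sub {n : ℕ} {f g : EuclideanSpace ℝ (Fin n) → ℂ} (hf : ContDiff ℝ 1 f)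
    (hg : ContDiff ℝ 1 g) : grad (fun X => f X - g X) = fun X => grad f X - grad g X := by
  funext X
  ext j
  rw [grad_apply, fderiv_fun_sub (hf.differentiable one_ne_zero X) (hg.differentiable one_ne_zero X)]
  rfl

theorem covGradOf_sub {n : ℕ} (A : EuclideanSpace ℝ (Fin n) → EuclideanSpace ℝ (Fin n))
    (U U' : EuclideanSpace ℝ (Fin n) → ℂ)
    (V V' : EuclideanSpace ℝ (Fin n) → EuclideanSpace ℂ (Fin n)) :
    covGradOf A (fun X => U X - U' X) (fun X => V X - V' X)
      = fun X => covGradOf A U V X - covGradOf A U' V' X := by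
  funext X
  ext j
  simp [covGradOf]
  ring

theorem measurable_diffQuot {n : ℕ} {a : EuclideanSpace ℝ (Fin n) → EuclideanSpace ℝ (Fin n)}
    (ha : Continuous a) {u : EuclideanSpace ℝ (Fin n) → ℂ} (hu : Measurable u) (s p : ℝ) :
    Measurable (diffQuot a s p u) := by
  have h1 := (continuous_intPot ha).measurable
  unfold diffQuot covDiff
  fun_prop

theorem memLp_comp_pt {f : EuclideanSpace ℝ (Fin (d + 1)) → ℂ} (hf : Continuous f)
    (hc : HasCompactSupport f) (q : ℝ≥0∞) : MemLp (fun x => f (pt x 0)) q volume := by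
  have h1 : Continuous fun x : EuclideanSpace ℝ (Fin d) => f (pt x 0) := by fun_prop
  refine h1.memLp_of_hasCompactSupport ?_
  obtain ⟨R, hR⟩ := hc.isCompact.isBounded.subset_closedBall 0
  refine HasCompactSupport.intro (isCompact_closedBall 0 R) fun x hx => ?_
  refine image_eq_zero_of_notMem_tsupport fun h => hx ?_
  simpa using hR h

/-- The strip of width `1` gives a bound free of constants and of the field. It makes the traces of
a sequence converging in the Sobolev norm Cauchy in `L^p`. -/
theorem eLpNorm_trace_sub_le (hp : 1 < p) (hA : ContDiff ℝ 1 A)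
    {f g : EuclideanSpace ℝ (Fin (d + 1)) → ℂ} (hf : ContDiff ℝ 1 f) (hg : ContDiff ℝ 1 g) :
    eLpNorm (fun x => f (pt x 0) - g (pt x 0)) (ENNReal.ofReal p) volume
      ≤ eLpNorm (fun X => f X - g X) (ENNReal.ofReal p) (volume.restrict (halfSpace d))
        + eLpNorm (fun X => covGradOf A f (grad f) X - covGradOf A g (grad g) X)
          (ENNReal.ofReal p) (volume.restrict (halfSpace d)) := by
  have hfg : ContDiff ℝ 1 fun X => f X - g X := hf.sub hg
  have hfgc := hfg.continuous
  have h1 := rpow_mul_eLpNorm_le (U := fun X => f X - g X) (u := fun x => f (pt x 0) - g (pt x 0))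
    (T := 1) hp hA.continuous hfgc.aestronglyMeasurable
    (by have := hf.continuous; have := hg.continuous; fun_prop)
  have h2 := eLpNorm_stripDiff_le hp hA hfg one_pos
  rw [grad_sub hf hg, covGradOf_sub] at h2
  simp only [ENNReal.ofReal_one, ENNReal.one_rpow, one_mul] at h1 h2
  exact h1.trans (by gcongr)

end trace

end MagneticTrace

end

noncomputable section

namespace MagneticTrace

/-! ### The trace as a limit of traces of smooth functions -/

section existence

variable {d : ℕ} {p β : ℝ} {A : EuclideanSpace ℝ (Fin (d + 1)) → EuclideanSpace ℝ (Fin (d + 1))}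
  {U : EuclideanSpace ℝ (Fin (d + 1)) → ℂ}
  {V : EuclideanSpace ℝ (Fin (d + 1)) → EuclideanSpace ℂ (Fin (d + 1))}

theorem tendsto_ofReal_one_div_add_one :
    Filter.Tendsto (fun k : ℕ => ENNReal.ofReal (1 / ((k : ℝ) + 1))) Filter.atTop (nhds 0) := by
  have h := ENNReal.tendsto_ofReal (tendsto_one_div_add_atTop_nhds_zero_nat (𝕜 := ℝ))
  rwa [ENNReal.ofReal_zero] at h

theorem eLpNorm_le_add_of_sub_le {α F : Type*} [MeasurableSpace α] [NormedAddCommGroup F]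
    {μ : Measure α} {q c : ℝ≥0∞} (hq : 1 ≤ q) {f g : α → F} (hf : AEStronglyMeasurable f μ)
    (hg : AEStronglyMeasurable g μ) (h : eLpNorm (fun a => f a - g a) q μ ≤ c) :
    eLpNorm f q μ ≤ eLpNorm g q μ + c := by
  have e : f = g + fun a => f a - g a := by
    funext a
    simp
  calc eLpNorm f q μ ≤ eLpNorm g q μ + eLpNorm (fun a => f a - g a) q μ := by
        conv_lhs => rw [e]
        exact eLpNorm_add_le hg (hf.sub hg) hq
    _ ≤ _ := by gcongr

/-- Traces of a convergent sequence of smooth functions converge. -/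
theorem exists_limit_trace [Fact (1 ≤ p)] (hp : 1 < p) (hA : ContDiff ℝ 1 A)
    (h : HasWeakGradient (halfSpace d) U V)
    (hU : MemLp U (ENNReal.ofReal p) (volume.restrict (halfSpace d)))
    (hG : MemLp (covGradOf A U V) (ENNReal.ofReal p) (volume.restrict (halfSpace d))) :
    ∃ (g : ℕ → EuclideanSpace ℝ (Fin (d + 1)) → ℂ)
      (u : Lp ℂ (ENNReal.ofReal p) (volume : Measure (EuclideanSpace ℝ (Fin d)))),
      (∀ k, ContDiff ℝ 1 (g k)) ∧
      (∀ k, eLpNorm (fun X => g k X - U X) (ENNReal.ofReal p) (volume.restrict (halfSpace d))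
        ≤ ENNReal.ofReal (1 / ((k : ℝ) + 1))) ∧
      (∀ k, eLpNorm (covGradOf A (g k) (grad (g k))) (ENNReal.ofReal p)
          (volume.restrict (halfSpace d)) ≤ eLpNorm (covGradOf A U V) (ENNReal.ofReal p)
          (volume.restrict (halfSpace d)) + ENNReal.ofReal (1 / ((k : ℝ) + 1))) ∧
      Filter.Tendsto (fun k => eLpNorm (fun x => g k (pt x 0) - u x) (ENNReal.ofReal p) volume)
        Filter.atTop (nhds 0) := by
  have hq : 1 ≤ ENNReal.ofReal p := by simpa using hp.le
  have hε : ∀ k : ℕ, 0 < 1 / ((k : ℝ) + 1) := fun k => by positivity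
  choose g h1 h2 h3 h4 using fun k : ℕ => exists_contDiff_approx hp hA.continuous h hU hG (hε k)
  have hm : ∀ k, MemLp (fun x => g k (pt x 0)) (ENNReal.ofReal p)
      (volume : Measure (EuclideanSpace ℝ (Fin d))) :=
    fun k => memLp_comp_pt (h1 k).continuous (h2 k) _
  have hGc := fun k => continuous_covGradOf hA.continuous (h1 k)
  -- The factor `4` counts the two approximation errors for the functions and the two for the
  -- covariant gradients.
  have hdiff : ∀ n m, n ≤ m → dist ((hm n).toLp _) ((hm m).toLp _) ≤ 4 * (1 / ((n : ℝ) + 1)) := by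
    intro n m hnm
    rw [dist_edist, Lp.edist_toLp_toLp]
    refine ENNReal.toReal_le_of_le_ofReal (by positivity) ?_
    refine (eLpNorm_trace_sub_le hp hA (h1 n) (h1 m)).trans ?_
    have hmn : ENNReal.ofReal (1 / ((m : ℝ) + 1)) ≤ ENNReal.ofReal (1 / ((n : ℝ) + 1)) :=
      ENNReal.ofReal_le_ofReal (one_div_le_one_div_of_le (by positivity) (by gcongr))
    have b1 : eLpNorm (fun X => g n X - g m X) (ENNReal.ofReal p) (volume.restrict (halfSpace d))
        ≤ ENNReal.ofReal (1 / ((n : ℝ) + 1)) + ENNReal.ofReal (1 / ((n : ℝ) + 1)) := by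
      have e : (fun X => g n X - g m X) = (fun X => g n X - U X) - fun X => g m X - U X := by
        funext X; simp
      rw [e]
      exact (eLpNorm_sub_le ((h1 n).continuous.aestronglyMeasurable.sub hU.1)
        ((h1 m).continuous.aestronglyMeasurable.sub hU.1) hq).trans
        (add_le_add (h3 n) ((h3 m).trans hmn))
    have b2 : eLpNorm (fun X => covGradOf A (g n) (grad (g n)) X - covGradOf A (g m) (grad (g m)) X)
        (ENNReal.ofReal p) (volume.restrict (halfSpace d))
        ≤ ENNReal.ofReal (1 / ((n : ℝ) + 1)) + ENNReal.ofReal (1 / ((n : ℝ) + 1)) := by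
      have e : (fun X => covGradOf A (g n) (grad (g n)) X - covGradOf A (g m) (grad (g m)) X)
          = (fun X => covGradOf A (g n) (grad (g n)) X - covGradOf A U V X)
            - fun X => covGradOf A (g m) (grad (g m)) X - covGradOf A U V X := by
        funext X; simp
      rw [e]
      exact (eLpNorm_sub_le ((hGc n).aestronglyMeasurable.sub hG.1)
        ((hGc m).aestronglyMeasurable.sub hG.1) hq).trans
        (add_le_add (h4 n) ((h4 m).trans hmn))
    refine (add_le_add b1 b2).trans (le_of_eq ?_)
    rw [← ENNReal.ofReal_add (by positivity) (by positivity),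
      ← ENNReal.ofReal_add (by positivity) (by positivity)]
    congr 1
    ring
  have hlim : Filter.Tendsto (fun n : ℕ => 4 * (1 / ((n : ℝ) + 1))) Filter.atTop (nhds 0) := by
    simpa using (tendsto_one_div_add_atTop_nhds_zero_nat (𝕜 := ℝ)).const_mul 4
  obtain ⟨u, hu⟩ := cauchySeq_tendsto_of_complete (cauchySeq_of_le_tendsto_0' _ hdiff hlim)
  refine ⟨g, u, h1, h3, fun k => ?_, ?_⟩
  · exact eLpNorm_le_add_of_sub_le hq (hGc k).aestronglyMeasurable hG.1 (h4 k)
  · rw [Lp.tendsto_Lp_iff_tendsto_eLpNorm'] at hu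
    refine hu.congr fun k => eLpNorm_congr_ae ?_
    filter_upwards [(hm k).coeFn_toLp] with x hx
    simp [hx]

/-- Every Sobolev function has a trace, which obeys the trace inequality. -/
theorem exists_trace [Fact (1 ≤ p)] (hd : 1 ≤ d) (hp : 1 < p) (hA : ContDiff ℝ 1 A)
    (h : HasWeakGradient (halfSpace d) U V)
    (hU : MemLp U (ENNReal.ofReal p) (volume.restrict (halfSpace d)))
    (hG : MemLp (covGradOf A U V) (ENNReal.ofReal p) (volume.restrict (halfSpace d))) :
    ∃ u : Lp ℂ (ENNReal.ofReal p) (volume : Measure (EuclideanSpace ℝ (Fin d))),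
      (∀ T, 0 < T → eLpNorm (stripDiff A U u) (ENNReal.ofReal p)
          (volume.restrict (slab d (Ioo 0 T))) ≤ ENNReal.ofReal T *
        eLpNorm (covGradOf A U V) (ENNReal.ofReal p) (volume.restrict (halfSpace d))) ∧
      ∀ β : ℝ, 0 ≤ β → FieldBound A β → gagliardo (tangential A) (1 - 1 / p) p u
        ≤ traceConst d p ^ (1 / p) *
        (eLpNorm (covGradOf A U V) (ENNReal.ofReal p) (volume.restrict (halfSpace d))
        + ENNReal.ofReal (β ^ (1 / 2 : ℝ)) *
          eLpNorm U (ENNReal.ofReal p) (volume.restrict (halfSpace d))) := by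
  have hq : 1 ≤ ENNReal.ofReal p := by simpa using hp.le
  have hp0 : 0 < p := by linarith
  obtain ⟨g, u, h1, h3, h4, h5⟩ := exists_limit_trace hp hA h hU hG
  have hum : Measurable u := (Lp.stronglyMeasurable u).measurable
  have hvm : ∀ k, Measurable fun x : EuclideanSpace ℝ (Fin d) => g k (pt x 0) := fun k => by
    have := (h1 k).continuous
    fun_prop
  refine ⟨u, fun T hT => ?_, fun β hβ0 hβ => ?_⟩
  · set G := eLpNorm (covGradOf A U V) (ENNReal.ofReal p) (volume.restrict (halfSpace d))
    have hlim := (ENNReal.Tendsto.const_mul (a := ENNReal.ofReal T)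
      ((tendsto_const_nhds (x := G)).add tendsto_ofReal_one_div_add_one)
      (Or.inr ENNReal.ofReal_ne_top)).add (tendsto_ofReal_one_div_add_one.add
      (ENNReal.Tendsto.const_mul (a := ENNReal.ofReal T ^ (1 / p)) h5
        (Or.inr (ENNReal.rpow_ne_top_of_nonneg (by positivity) ENNReal.ofReal_ne_top))))
    rw [mul_zero, add_zero, add_zero, add_zero] at hlim
    refine ge_of_tendsto' hlim fun k => ?_
    -- The strip difference of the limit is that of the smooth approximant plus two errors, one in
    -- the half-space and one on the boundary, both of which vanish in `L^p` of the fixed strip.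
    have e : stripDiff A U u = stripDiff A (g k) (fun x => g k (pt x 0))
        - ((fun X => Complex.exp (Complex.I * (intPot A (pt (base X) 0) X : ℂ)) * (g k X - U X))
          - fun X => (fun x => g k (pt x 0) - u x) (base X)) := by
      funext X
      simp only [stripDiff, Pi.sub_apply]
      ring
    have hgU : AEStronglyMeasurable (fun X => g k X - U X) (volume.restrict (halfSpace d)) :=
      (h1 k).continuous.aestronglyMeasurable.sub hU.1
    have hvu : Measurable fun x : EuclideanSpace ℝ (Fin d) => g k (pt x 0) - u x :=
      (hvm k).sub hum
    have m1 : AEStronglyMeasurable (stripDiff A (g k) fun x => g k (pt x 0))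
        (volume.restrict (slab d (Ioo 0 T))) :=
      aestronglyMeasurable_stripDiff hA.continuous (h1 k).continuous.aestronglyMeasurable (hvm k)
    have m2 := aestronglyMeasurable_stripPhase_mul (T := T) hA.continuous hgU
    have m3 : AEStronglyMeasurable (fun X => (fun x => g k (pt x 0) - u x) (base X))
        (volume.restrict (slab d (Ioo 0 T))) := (hvu.comp measurable_base).aestronglyMeasurable
    rw [e]
    refine (eLpNorm_sub_le m1 (m2.sub m3) hq).trans (add_le_add ?_ ?_)
    · exact (eLpNorm_stripDiff_le hp hA (h1 k) hT).trans (mul_le_mul_right (h4 k) _)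
    · refine (eLpNorm_sub_le m2 m3 hq).trans (add_le_add ?_ ?_)
      · exact eLpNorm_stripPhase_mul_le.trans (h3 k)
      · exact (eLpNorm_comp_base hp0 hvu).le
  · set G := eLpNorm (covGradOf A U V) (ENNReal.ofReal p) (volume.restrict (halfSpace d))
    set L := eLpNorm U (ENNReal.ofReal p) (volume.restrict (halfSpace d))
    set c := traceConst d p ^ (1 / p)
    have hc : c ≠ ⊤ := ENNReal.rpow_ne_top_of_nonneg (by positivity) (traceConst_lt_top d hp).ne
    have hlim := ENNReal.Tendsto.const_mul (a := c)
      (((tendsto_const_nhds (x := G)).add tendsto_ofReal_one_div_add_one).add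
      (ENNReal.Tendsto.const_mul (a := ENNReal.ofReal (β ^ (1 / 2 : ℝ)))
        ((tendsto_const_nhds (x := L)).add tendsto_ofReal_one_div_add_one)
          (Or.inr ENNReal.ofReal_ne_top))) (Or.inr hc)
    rw [add_zero, add_zero] at hlim
    -- Convergence in `L^p` gives almost everywhere convergence along a subsequence, hence that of
    -- the difference quotients on the product. Fatou's lemma then bounds the seminorm of the limit
    -- without any convergence of seminorms.
    have hmeas := tendstoInMeasure_of_tendsto_eLpNorm (by simpa using hp0)
      (fun k => (hvm k).aestronglyMeasurable) hum.aestronglyMeasurable h5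
    obtain ⟨ns, hns, hae⟩ := hmeas.exists_seq_tendsto_ae
    have ha := continuous_tangential hA.continuous
    rw [← eLpNorm_diffQuot hp0 (measurable_diffQuot ha hum _ _).aestronglyMeasurable]
    refine (Lp.eLpNorm_lim_le_liminf_eLpNorm
      (f := fun i => diffQuot (tangential A) (1 - 1 / p) p fun x => g (ns i) (pt x 0))
      (fun i => (measurable_diffQuot ha (hvm _) _ _).aestronglyMeasurable) _ ?_).trans
      ((Filter.liminf_le_liminf (Filter.Eventually.of_forall fun i => ?_)).trans_eq
        (hlim.comp hns.tendsto_atTop).liminf_eq)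
    · have a1 := (Measure.quasiMeasurePreserving_fst (μ := (volume : Measure
        (EuclideanSpace ℝ (Fin d)))) (ν := (volume : Measure (EuclideanSpace ℝ (Fin d))))).ae hae
      have a2 := (Measure.quasiMeasurePreserving_snd (μ := (volume : Measure
        (EuclideanSpace ℝ (Fin d)))) (ν := (volume : Measure (EuclideanSpace ℝ (Fin d))))).ae hae
      filter_upwards [a1, a2] with z b1 b2
      exact ((b2.const_mul _).sub b1).div_const _
    · rw [eLpNorm_diffQuot hp0 (measurable_diffQuot ha (hvm _) _ _).aestronglyMeasurable]
      refine (gagliardo_le hd hp hA (h1 _) hβ0 hβ).trans ?_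
      refine mul_le_mul_right (add_le_add (h4 _) (mul_le_mul_right ?_ _)) c
      exact eLpNorm_le_add_of_sub_le hq (h1 _).continuous.aestronglyMeasurable hU.1 (h3 _)

end existence

end MagneticTrace

end

noncomputable section

namespace MagneticTrace

/-! ### The trace operator -/

section operators

variable {d : ℕ} {p β : ℝ}
  {A B : EuclideanSpace ℝ (Fin (d + 1)) → EuclideanSpace ℝ (Fin (d + 1))}

/-- With the next lemma, this shows that the spaces and norms only see `A` on the closed half-space,
so all estimates may be made with the extension `B`. -/
theorem tangential_congr (hAB : EqOn B A (closedHalfSpace d)) : tangential A = tangential B := by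
  funext x
  ext j
  have h : B (boundaryPoint x) = A (boundaryPoint x) :=
    hAB (by rw [boundaryPoint_eq]; exact pt_mem_closedHalfSpace le_rfl)
  simp only [tangential, h]

theorem covGradOf_congr_potential (hAB : EqOn B A (closedHalfSpace d))
    (U : EuclideanSpace ℝ (Fin (d + 1)) → ℂ)
    (V : EuclideanSpace ℝ (Fin (d + 1)) → EuclideanSpace ℂ (Fin (d + 1))) :
    covGradOf A U V =ᵐ[volume.restrict (halfSpace d)] covGradOf B U V := by
  filter_upwards [ae_restrict_mem measurableSet_halfSpace] with X hX
  simp only [covGradOf, hAB (halfSpace_subset_closedHalfSpace hX)]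

theorem toReal_le_of_le_mul_add {a c x y : ℝ≥0∞} {r : ℝ} (hc : c ≠ ⊤) (hx : x ≠ ⊤) (hy : y ≠ ⊤)
    (hr : 0 ≤ r) (h : a ≤ c * (x + ENNReal.ofReal r * y)) :
    a.toReal ≤ c.toReal * (x.toReal + r * y.toReal) := by
  have hy' : ENNReal.ofReal r * y ≠ ⊤ := ENNReal.mul_ne_top ENNReal.ofReal_ne_top hy
  have h1 := ENNReal.toReal_mono (ENNReal.mul_ne_top hc (ENNReal.add_ne_top.2 ⟨hx, hy'⟩)) h
  rwa [ENNReal.toReal_mul, ENNReal.toReal_add hx hy', ENNReal.toReal_mul,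
    ENNReal.toReal_ofReal hr] at h1

theorem le_add_of_rpow_eq_add {a b c : ℝ} (hp : 1 < p) (ha : 0 ≤ a) (hb : 0 ≤ b) (hc : 0 ≤ c)
    (h : c ^ p = a ^ p + b ^ p) : c ≤ a + b ∧ a ≤ c ∧ b ≤ c := by
  have hp0 : 0 < p := by linarith
  refine ⟨?_, ?_, ?_⟩
  · refine (Real.rpow_le_rpow_iff hc (by positivity) hp0).1 ?_
    rw [h]
    exact Real.add_rpow_le_rpow_add ha hb hp.le
  · refine (Real.rpow_le_rpow_iff ha hc hp0).1 ?_
    rw [h]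
    exact le_add_of_nonneg_right (Real.rpow_nonneg hb p)
  · refine (Real.rpow_le_rpow_iff hb hc hp0).1 ?_
    rw [h]
    exact le_add_of_nonneg_left (Real.rpow_nonneg ha p)

theorem MagneticSobolev.norm_bounds [Fact (1 ≤ p)] (hp : 1 < p) (U : MagneticSobolev A p) :
    ‖U‖ ≤ ‖U.toLp‖ + ‖U.covGrad‖ ∧ ‖U.toLp‖ ≤ ‖U‖ ∧ ‖U.covGrad‖ ≤ ‖U‖ :=
  le_add_of_rpow_eq_add hp (norm_nonneg _) (norm_nonneg _) (norm_nonneg _)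
    (MagneticSobolev.norm_rpow U)

theorem MagneticFractional.norm_bounds [Fact (1 ≤ p)] (hp : 1 < p) {n : ℕ}
    {a : EuclideanSpace ℝ (Fin n) → EuclideanSpace ℝ (Fin n)} {s : ℝ}
    (u : MagneticFractional a s p) :
    ‖u‖ ≤ ‖u.toLp‖ + u.seminorm ∧ ‖u.toLp‖ ≤ ‖u‖ ∧ u.seminorm ≤ ‖u‖ :=
  le_add_of_rpow_eq_add hp (norm_nonneg _) ENNReal.toReal_nonneg (norm_nonneg _)
    (MagneticFractional.norm_rpow u)

theorem MagneticSobolev.norm_covGrad (U : MagneticSobolev A p) :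
    ‖U.covGrad‖ = (eLpNorm (covGradOf A U.toLp U.weakGrad) (ENNReal.ofReal p)
      (volume.restrict (halfSpace d))).toReal :=
  Lp.norm_toLp _ U.memLp_covGradOf

theorem MagneticSobolev.covGradOf_ae_eq {U : EuclideanSpace ℝ (Fin (d + 1)) → ℂ}
    {V : EuclideanSpace ℝ (Fin (d + 1)) → EuclideanSpace ℂ (Fin (d + 1))}
    (W : MagneticSobolev A p) (h : HasWeakGradient (halfSpace d) U V)
    (e : W.toLp =ᵐ[volume.restrict (halfSpace d)] U) :
    covGradOf A W.toLp W.weakGrad =ᵐ[volume.restrict (halfSpace d)] covGradOf A U V :=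
  covGradOf_congr A e ((W.hasWeakGradient.congr e).unique (isOpen_halfSpace d) h)

theorem MagneticSobolev.exists_of_memLp {U : EuclideanSpace ℝ (Fin (d + 1)) → ℂ}
    {V : EuclideanSpace ℝ (Fin (d + 1)) → EuclideanSpace ℂ (Fin (d + 1))}
    (h : HasWeakGradient (halfSpace d) U V)
    (hU : MemLp U (ENNReal.ofReal p) (volume.restrict (halfSpace d)))
    (hG : MemLp (covGradOf A U V) (ENNReal.ofReal p) (volume.restrict (halfSpace d))) :
    ∃ W : MagneticSobolev A p, W.toLp =ᵐ[volume.restrict (halfSpace d)] U := by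
  have e := hU.coeFn_toLp
  refine ⟨⟨hU.toLp U, V, h.congr e.symm, ?_⟩, e⟩
  exact (memLp_congr_ae (covGradOf_congr A e (Filter.EventuallyEq.refl _ _))).2 hG

/-- The constant of the trace inequality. -/
def traceRealConst (d : ℕ) (p : ℝ) : ℝ := (traceConst d p ^ (1 / p)).toReal

/-- The width `T = β^{-1/2}` balances the two terms on the right, and multiplication by `β^{1/2}`
gives the claim. For `β = 0` both powers of `β` vanish, as `p > 1`, and nothing remains to prove. -/
theorem rpow_mul_le_of_forall_strip {x G L : ℝ} (hp : 1 < p) (hG : 0 ≤ G)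
    (h : ∀ T : ℝ, 0 < T → T ^ (1 / p) * x ≤ L + T * G) {β : ℝ} (hβ : 0 ≤ β) :
    β ^ (1 / 2 - 1 / (2 * p) : ℝ) * x ≤ G + β ^ (1 / 2 : ℝ) * L := by
  have hp0 : 0 < p := by linarith
  rcases hβ.eq_or_lt with rfl | hβ0
  · have hne : (1 / 2 - 1 / (2 * p) : ℝ) ≠ 0 := by
      have : 1 / (2 * p) < 1 / 2 := one_div_lt_one_div_of_lt (by norm_num) (by linarith)
      linarith
    rw [Real.zero_rpow hne, Real.zero_rpow (by norm_num)]
    simpa using hG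
  · have h1 := mul_le_mul_of_nonneg_left (h (β ^ (-(1 / 2) : ℝ)) (by positivity))
      (Real.rpow_nonneg hβ (1 / 2))
    have e1 : β ^ (1 / 2 : ℝ) * ((β ^ (-(1 / 2) : ℝ)) ^ (1 / p) * x)
        = β ^ (1 / 2 - 1 / (2 * p) : ℝ) * x := by
      rw [← Real.rpow_mul hβ, ← mul_assoc, ← Real.rpow_add hβ0]
      congr 2
      field_simp
      ring
    have e2 : β ^ (1 / 2 : ℝ) * (L + β ^ (-(1 / 2) : ℝ) * G) = G + β ^ (1 / 2 : ℝ) * L := by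
      rw [mul_add, ← mul_assoc, ← Real.rpow_add hβ0, add_neg_cancel, Real.rpow_zero]
      ring
    rwa [e1, e2] at h1

/-- The bound `β₀` only ensures that the seminorm is finite. A single trace has to satisfy the
estimates for all admissible `β`, so `β` is quantified after `u`. -/
theorem exists_trace_element [Fact (1 ≤ p)] (hd : 1 ≤ d) (hp : 1 < p) (hB : ContDiff ℝ 1 B)
    (hAB : EqOn B A (closedHalfSpace d)) {β₀ : ℝ} (hβ₀ : 0 ≤ β₀) (hβ₀' : FieldBound B β₀)
    (U : MagneticSobolev A p) :
    ∃ u : MagneticFractional (tangential A) (1 - 1 / p) p, IsTrace B p U.toLp u.toLp ∧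
      ∀ β : ℝ, 0 ≤ β → FieldBound B β →
        u.seminorm ≤ traceRealConst d p * (‖U.covGrad‖ + β ^ (1 / 2 : ℝ) * ‖U.toLp‖) ∧
        β ^ (1 / 2 - 1 / (2 * p) : ℝ) * ‖u.toLp‖ ≤ ‖U.covGrad‖ + β ^ (1 / 2 : ℝ) * ‖U.toLp‖ := by
  have hp0 : 0 < p := by linarith
  have eG := covGradOf_congr_potential hAB U.toLp U.weakGrad
  have hU := Lp.memLp U.toLp
  obtain ⟨u, h1, h2⟩ := exists_trace hd hp hB U.hasWeakGradient hU
    ((memLp_congr_ae eG).1 U.memLp_covGradOf)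
  rw [← eLpNorm_congr_ae eG] at h1 h2
  have ht := tangential_congr hAB
  rw [← ht] at h2
  have hGt := U.memLp_covGradOf.2.ne
  have hc : traceConst d p ^ (1 / p) ≠ ⊤ :=
    ENNReal.rpow_ne_top_of_nonneg (by positivity) (traceConst_lt_top d hp).ne
  have hfin : gagliardo (tangential A) (1 - 1 / p) p u < ⊤ :=
    (h2 β₀ hβ₀ hβ₀').trans_lt (ENNReal.mul_lt_top hc.lt_top
      (ENNReal.add_lt_top.2 ⟨hGt.lt_top, ENNReal.mul_lt_top ENNReal.ofReal_lt_top hU.2⟩))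
  have hcont : Continuous (tangential A) := by
    rw [ht]; exact continuous_tangential hB.continuous
  refine ⟨⟨u, (mem_fractionalSubmodule hcont u).2 hfin⟩, ⟨_, hGt, 1, one_pos,
    fun T hT _ => h1 T hT⟩, fun β hβ hβ' => ⟨?_, ?_⟩⟩
  · rw [U.norm_covGrad, Lp.norm_def]
    exact toReal_le_of_le_mul_add hc hGt hU.2.ne (by positivity) (h2 β hβ hβ')
  · refine rpow_mul_le_of_forall_strip hp (norm_nonneg _) (fun T hT => ?_) hβ
    have h3 := (rpow_mul_eLpNorm_le (T := T) hp hB.continuous hU.1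
      (Lp.stronglyMeasurable u).measurable).trans (add_le_add_right (h1 T hT) _)
    have hT' : ENNReal.ofReal T * eLpNorm (covGradOf A U.toLp U.weakGrad) (ENNReal.ofReal p)
      (volume.restrict (halfSpace d)) ≠ ⊤ := ENNReal.mul_ne_top ENNReal.ofReal_ne_top hGt
    have h4 := ENNReal.toReal_mono (ENNReal.add_ne_top.2 ⟨hU.2.ne, hT'⟩) h3
    rw [ENNReal.toReal_mul, ENNReal.toReal_add hU.2.ne hT', ENNReal.toReal_mul,
      ENNReal.toReal_ofReal hT.le, ← ENNReal.toReal_rpow, ENNReal.toReal_ofReal hT.le] at h4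
    rw [U.norm_covGrad, Lp.norm_def]
    exact h4

theorem IsTrace.toLp_eq [Fact (1 ≤ p)] (hp : 1 < p) (hB : Continuous B) {U : EuclideanSpace ℝ (Fin (d + 1)) → ℂ}
    (hU : AEStronglyMeasurable U (volume.restrict (halfSpace d)))
    {u v : MagneticFractional (tangential A) (1 - 1 / p) p}
    (hu : IsTrace B p U u.toLp) (hv : IsTrace B p U v.toLp) : u = v :=
  MagneticFractional.toLp_injective (Lp.ext (hu.unique hp hB hU
    (Lp.stronglyMeasurable _).measurable (Lp.stronglyMeasurable _).measurable hv))

/-- The trace operator, with its characterization and its estimates. -/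
theorem exists_traceOperator [Fact (1 ≤ p)] (hd : 1 ≤ d) (hp : 1 < p) (hB : ContDiff ℝ 1 B)
    (hAB : EqOn B A (closedHalfSpace d)) {β₀ : ℝ} (hβ₀ : 0 ≤ β₀) (hβ₀' : FieldBound B β₀) :
    ∃ Tr : MagneticSobolev A p →L[ℂ] MagneticFractional (tangential A) (1 - 1 / p) p,
      ∀ U, IsTrace B p U.toLp (Tr U).toLp ∧
      ∀ β : ℝ, 0 ≤ β → FieldBound B β →
        (Tr U).seminorm ≤ traceRealConst d p * (‖U.covGrad‖ + β ^ (1 / 2 : ℝ) * ‖U.toLp‖) ∧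
        β ^ (1 / 2 - 1 / (2 * p) : ℝ) * ‖(Tr U).toLp‖
          ≤ ‖U.covGrad‖ + β ^ (1 / 2 : ℝ) * ‖U.toLp‖ := by
  -- The traces are chosen independently of one another; linearity comes from their uniqueness.
  choose f hf hf' using exists_trace_element (p := p) hd hp hB hAB hβ₀ hβ₀'
  have hm : ∀ U : MagneticSobolev A p, AEStronglyMeasurable U.toLp (volume.restrict (halfSpace d)) :=
    fun U => (Lp.memLp U.toLp).1
  have hum : ∀ u : MagneticFractional (tangential A) (1 - 1 / p) p, Measurable u.toLp :=
    fun u => (Lp.stronglyMeasurable _).measurable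
  let L : MagneticSobolev A p →ₗ[ℂ] MagneticFractional (tangential A) (1 - 1 / p) p :=
    { toFun := f
      map_add' := fun U W => by
        refine (hf (U + W)).toLp_eq hp hB.continuous (hm _) ?_
        refine ((hf U).add hp hB.continuous (hm U) (hm W) (hum _) (hum _) (hf W)).congr ?_ ?_
        · rw [map_add]
          exact (Lp.coeFn_add _ _).symm
        · rw [map_add]
          exact (Lp.coeFn_add _ _).symm
      map_smul' := fun c U => by
        refine (hf (c • U)).toLp_eq hp hB.continuous (hm _) ?_
        refine ((hf U).smul c).congr ?_ ?_
        · rw [map_smul]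
          exact (Lp.coeFn_smul _ _).symm
        · rw [RingHom.id_apply, map_smul]
          exact (Lp.coeFn_smul _ _).symm }
  -- Continuity needs a field bound of at least `1`, so that the power of it multiplying `‖u‖` is at
  -- least `1`; this covers a vanishing field.
  have hβ1 : FieldBound B (max β₀ 1) := fun X hX v w =>
    (hβ₀' X hX v w).trans (by gcongr; exact le_max_left _ _)
  have hbound : ∀ U, ‖L U‖ ≤ ((traceRealConst d p + 1) * (1 + (max β₀ 1) ^ (1 / 2 : ℝ))) * ‖U‖ := by
    intro U
    obtain ⟨h1, h2⟩ := hf' U (max β₀ 1) (hβ₀.trans (le_max_left _ _)) hβ1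
    obtain ⟨-, n1, n2⟩ := MagneticSobolev.norm_bounds hp U
    obtain ⟨n3, -, -⟩ := MagneticFractional.norm_bounds hp (f U)
    set r := (max β₀ 1) ^ (1 / 2 : ℝ)
    have hr : 0 ≤ r := Real.rpow_nonneg (hβ₀.trans (le_max_left _ _)) _
    have hone : 1 ≤ (max β₀ 1) ^ (1 / 2 - 1 / (2 * p) : ℝ) := by
      refine Real.one_le_rpow (le_max_right _ _) ?_
      have : 1 / (2 * p) < 1 / 2 := one_div_lt_one_div_of_lt (by norm_num) (by linarith)
      linarith
    have hR : ‖U.covGrad‖ + r * ‖U.toLp‖ ≤ (1 + r) * ‖U‖ := by nlinarith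
    have ht : 0 ≤ traceRealConst d p := ENNReal.toReal_nonneg
    have h3 : ‖(f U).toLp‖ ≤ ‖U.covGrad‖ + r * ‖U.toLp‖ :=
      (le_mul_of_one_le_left (norm_nonneg _) hone).trans h2
    calc ‖f U‖ ≤ (‖U.covGrad‖ + r * ‖U.toLp‖)
          + traceRealConst d p * (‖U.covGrad‖ + r * ‖U.toLp‖) := n3.trans (add_le_add h3 h1)
      _ = (traceRealConst d p + 1) * (‖U.covGrad‖ + r * ‖U.toLp‖) := by ring
      _ ≤ (traceRealConst d p + 1) * ((1 + r) * ‖U‖) := by gcongr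
      _ = _ := by ring
  exact ⟨L.mkContinuous _ hbound, fun U => ⟨hf U, hf' U⟩⟩

end operators

end MagneticTrace

end

noncomputable section

namespace MagneticTrace

/-! ### Restriction, uniqueness and the extension operator -/

section main

variable {d : ℕ} {p β : ℝ}
  {A B : EuclideanSpace ℝ (Fin (d + 1)) → EuclideanSpace ℝ (Fin (d + 1))}

/-- An operator computing traces is given by restriction on smooth functions. -/
theorem isRestriction_of_isTrace [Fact (1 ≤ p)] (hp : 1 < p) (hB : ContDiff ℝ 1 B)
    (hAB : EqOn B A (closedHalfSpace d))
    {Tr : MagneticSobolev A p →L[ℂ] MagneticFractional (tangential A) (1 - 1 / p) p}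
    (hTr : ∀ U, IsTrace B p U.toLp (Tr U).toLp) : IsRestriction Tr := by
  intro U f hf hUf
  -- The extension `g` need not have compact support below the boundary. That is immaterial: the
  -- finiteness of its covariant gradient norm is read off from `U`, with which it agrees in the
  -- half-space.
  obtain ⟨g, hg, hgf⟩ := exists_contDiff_extension hf.1
  have hgc := hg.continuous
  have e1 : U.toLp =ᵐ[volume.restrict (halfSpace d)] g := by
    filter_upwards [hUf, ae_restrict_mem measurableSet_halfSpace] with X hX hXm
    rw [hX, hgf (halfSpace_subset_closedHalfSpace hXm)]
  have e2 := (U.covGradOf_ae_eq (hasWeakGradient_grad hg (halfSpace d)) e1).trans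
    (covGradOf_congr_potential hAB g (grad g))
  have hfin : eLpNorm (covGradOf B g (grad g)) (ENNReal.ofReal p)
      (volume.restrict (halfSpace d)) ≠ ⊤ := by
    rw [← eLpNorm_congr_ae e2]
    exact U.memLp_covGradOf.2.ne
  have h1 : IsTrace B p g fun x => g (pt x 0) :=
    ⟨_, hfin, 1, one_pos, fun T hT _ => eLpNorm_stripDiff_le hp hB hg hT⟩
  have h2 := (hTr U).unique hp hB.continuous (Lp.memLp U.toLp).1
    (Lp.stronglyMeasurable _).measurable (by fun_prop)
    (h1.congr e1.symm (Filter.EventuallyEq.refl _ _))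
  filter_upwards [h2] with x hx
  rw [hx, hgf (by exact pt_mem_closedHalfSpace le_rfl), boundaryPoint_eq]

/-- Smooth functions are dense in the Sobolev space. -/
theorem exists_contDiff_dist_lt [Fact (1 ≤ p)] (hp : 1 < p) (hB : ContDiff ℝ 1 B)
    (hAB : EqOn B A (closedHalfSpace d)) (U : MagneticSobolev A p) {ε : ℝ} (hε : 0 < ε) :
    ∃ (W : MagneticSobolev A p) (g : EuclideanSpace ℝ (Fin (d + 1)) → ℂ), IsC1c g ∧
      W.toLp =ᵐ[volume.restrict (halfSpace d)] g ∧ dist U W < ε := by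
  have hq : 1 ≤ ENNReal.ofReal p := by simpa using hp.le
  have eU := covGradOf_congr_potential hAB U.toLp U.weakGrad
  have hU := Lp.memLp U.toLp
  have hG := (memLp_congr_ae eU).1 U.memLp_covGradOf
  obtain ⟨g, h1, h2, h3, h4⟩ := exists_contDiff_approx hp hB.continuous U.hasWeakGradient hU hG
    (ε := ε / 3) (by positivity)
  have hw := hasWeakGradient_grad h1 (halfSpace d)
  have eg := covGradOf_congr_potential hAB g (grad g)
  have hgm : MemLp g (ENNReal.ofReal p) (volume.restrict (halfSpace d)) :=
    h1.continuous.memLp_of_hasCompactSupport h2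
  have hGm : MemLp (covGradOf B g (grad g)) (ENNReal.ofReal p) (volume.restrict (halfSpace d)) := by
    refine ⟨(continuous_covGradOf hB.continuous h1).aestronglyMeasurable, ?_⟩
    exact (eLpNorm_le_add_of_sub_le hq
      (continuous_covGradOf hB.continuous h1).aestronglyMeasurable hG.1 h4).trans_lt
      (ENNReal.add_lt_top.2 ⟨hG.2, ENNReal.ofReal_lt_top⟩)
  obtain ⟨W, hW⟩ := MagneticSobolev.exists_of_memLp hw hgm ((memLp_congr_ae eg).2 hGm)
  refine ⟨W, g, ⟨h1.contDiffOn, tsupport g, h2, fun X hX => image_eq_zero_of_notMem_tsupport hX.2⟩,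
    hW, ?_⟩
  have n1 : ‖(W - U).toLp‖ ≤ ε / 3 := by
    rw [Lp.norm_def]
    refine ENNReal.toReal_le_of_le_ofReal (by positivity) (le_of_eq_of_le (eLpNorm_congr_ae ?_) h3)
    rw [map_sub]
    filter_upwards [Lp.coeFn_sub W.toLp U.toLp, hW] with X a1 a2
    rw [a1, Pi.sub_apply, a2]
  have n2 : ‖(W - U).covGrad‖ ≤ ε / 3 := by
    rw [Lp.norm_def]
    refine ENNReal.toReal_le_of_le_ofReal (by positivity) (le_of_eq_of_le (eLpNorm_congr_ae ?_) h4)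
    rw [map_sub]
    have b1 : W.covGrad =ᵐ[volume.restrict (halfSpace d)] covGradOf A W.toLp W.weakGrad :=
      W.memLp_covGradOf.coeFn_toLp
    have b2 : U.covGrad =ᵐ[volume.restrict (halfSpace d)] covGradOf A U.toLp U.weakGrad :=
      U.memLp_covGradOf.coeFn_toLp
    filter_upwards [Lp.coeFn_sub W.covGrad U.covGrad, b1, b2, eU, eg,
      W.covGradOf_ae_eq hw hW] with X a1 a2 a3 a4 a5 a6
    rw [a1, Pi.sub_apply, a2, a3, a4, a6, a5]
  rw [dist_comm, dist_eq_norm]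
  have := (MagneticSobolev.norm_bounds hp (W - U)).1
  linarith

/-- A restriction operator is unique. -/
theorem IsRestriction.unique [Fact (1 ≤ p)] (hp : 1 < p) (hB : ContDiff ℝ 1 B)
    (hAB : EqOn B A (closedHalfSpace d)) {s : ℝ}
    {T T' : MagneticSobolev A p →L[ℂ] MagneticFractional (tangential A) s p}
    (h : IsRestriction T) (h' : IsRestriction T') : T' = T := by
  refine ContinuousLinearMap.ext fun U => ?_
  have hcl : IsClosed {W | T' W = T W} := isClosed_eq T'.continuous T.continuous
  have hmem : U ∈ closure {W | T' W = T W} := by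
    refine Metric.mem_closure_iff.2 fun ε hε => ?_
    obtain ⟨W, g, hg, hW, hd⟩ := exists_contDiff_dist_lt hp hB hAB U hε
    refine ⟨W, ?_, hd⟩
    exact MagneticFractional.toLp_injective (Lp.ext ((h' W g hg hW).trans (h W g hg hW).symm))
  rw [hcl.closure_eq] at hmem
  exact hmem

theorem gaugeAverage_congr {u v : EuclideanSpace ℝ (Fin d) → ℂ} (h : u =ᵐ[volume] v) :
    gaugeAverage B u = gaugeAverage B v := by
  funext X
  refine integral_congr_ae ?_
  filter_upwards [h] with y hy
  rw [hy]

theorem extend_congr {u v : EuclideanSpace ℝ (Fin d) → ℂ} (h : u =ᵐ[volume] v) (b : ℝ) :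
    extend B b u = extend B b v := by
  unfold extend
  rw [gaugeAverage_congr h]

theorem extend_add (hB : ContDiff ℝ 1 B) {u v : EuclideanSpace ℝ (Fin d) → ℂ}
    (hu : LocallyIntegrable u) (hv : LocallyIntegrable v) (b : ℝ) :
    extend B b (u + v) =ᵐ[volume.restrict (halfSpace d)] extend B b u + extend B b v := by
  filter_upwards [ae_restrict_mem measurableSet_halfSpace] with X hX
  have hk := kernelContinuous_gaugeKernel hB
  have h1 := integrable_kernel hk kernelSupport_gaugeKernel hu hX
  have h2 := integrable_kernel hk kernelSupport_gaugeKernel hv hX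
  simp only [extend, gaugeAverage, Pi.add_apply, add_smul]
  rw [integral_add h1 h2, smul_add]

theorem extend_smul (c : ℂ) (u : EuclideanSpace ℝ (Fin d) → ℂ) (b : ℝ) :
    extend B b (c • u) = c • extend B b u := by
  funext X
  simp only [extend, gaugeAverage, Pi.smul_apply, smul_assoc, integral_smul]
  rw [smul_comm]

/-- The constant of the extension estimate. -/
def extendRealConst (d : ℕ) (p : ℝ) : ℝ := (extendConst d p).toReal

/-- The parameter `b` stands for `β^{1/2}`. The element is tied to the explicit formula `extend`,
from which linearity of the extension will follow, and to `IsTrace`, from which `Tr ∘ Ext = id` will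
follow. -/
theorem exists_extension_element [Fact (1 ≤ p)] (hp : 1 < p) (hB : ContDiff ℝ 1 B)
    (hAB : EqOn B A (closedHalfSpace d)) {b : ℝ} (hb : 0 < b) (hβ : FieldBound B (b ^ 2))
    (u : MagneticFractional (tangential A) (1 - 1 / p) p) :
    ∃ W : MagneticSobolev A p,
      W.toLp =ᵐ[volume.restrict (halfSpace d)] extend B b u.toLp ∧ IsTrace B p W.toLp u.toLp ∧
      ‖W.covGrad‖ + b * ‖W.toLp‖
        ≤ extendRealConst d p * (u.seminorm + b ^ (1 - 1 / p) * ‖u.toLp‖) := by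
  have hq : 1 ≤ ENNReal.ofReal p := by simpa using hp.le
  have hum : Measurable u.toLp := (Lp.stronglyMeasurable _).measurable
  have hul : LocallyIntegrable u.toLp := (Lp.memLp u.toLp).locallyIntegrable hq
  have hL := (Lp.memLp u.toLp).2
  have hN : gagliardo (tangential A) (1 - 1 / p) p u.toLp < ⊤ := u.2.2
  have hest := eLpNorm_extend_le hp hB hb hβ hum hul
  rw [← tangential_congr hAB] at hest
  have hw := hasWeakGradient_extend hB hul b
  have hC := extendConst_lt_top d hp
  have hR : extendConst d p * (gagliardo (tangential A) (1 - 1 / p) p u.toLp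
      + ENNReal.ofReal (b ^ (1 - 1 / p)) * eLpNorm u.toLp (ENNReal.ofReal p) volume) < ⊤ :=
    ENNReal.mul_lt_top hC (ENNReal.add_lt_top.2
      ⟨hN, ENNReal.mul_lt_top ENNReal.ofReal_lt_top hL⟩)
  have hsum := hest.trans_lt hR
  obtain ⟨hG, hU⟩ := ENNReal.add_lt_top.1 hsum
  have hU' : eLpNorm (extend B b u.toLp) (ENNReal.ofReal p) (volume.restrict (halfSpace d)) < ⊤ := by
    -- Finiteness of `b ‖U‖` gives that of `‖U‖` because `b > 0`.
    refine lt_top_iff_ne_top.2 fun htop => ?_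
    rw [htop, ENNReal.mul_top (by simpa using hb)] at hU
    exact lt_irrefl _ hU
  have eg := covGradOf_congr_potential hAB (extend B b u.toLp) (extendGrad B b u.toLp)
  have hGm : MemLp (covGradOf B (extend B b u.toLp) (extendGrad B b u.toLp)) (ENNReal.ofReal p)
      (volume.restrict (halfSpace d)) := ⟨hw.aestronglyMeasurable_covGradOf hB.continuous, hG⟩
  obtain ⟨W, hW⟩ := MagneticSobolev.exists_of_memLp (A := A) hw ⟨hw.aestronglyMeasurable, hU'⟩
    ((memLp_congr_ae eg).2 hGm)
  refine ⟨W, hW, ?_, ?_⟩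
  · refine IsTrace.congr (U := extend B b u.toLp) ⟨_, ?_, min (4 * b)⁻¹ 1, by positivity,
      fun T hT hT' => eLpNorm_stripDiff_extend_le hp hB hb hβ hum hul
        (hT'.trans (min_le_left _ _)) (hT'.trans (min_le_right _ _))⟩ hW.symm
        (Filter.EventuallyEq.refl _ _)
    rw [← tangential_congr hAB]
    exact (ENNReal.mul_lt_top (ENNReal.mul_lt_top ENNReal.ofReal_lt_top (averageConst_lt_top d hp))
      (ENNReal.add_lt_top.2 ⟨hN, ENNReal.mul_lt_top ENNReal.ofReal_lt_top hL⟩)).ne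
  · have h1 := toReal_le_of_le_mul_add hC.ne hN.ne hL.ne (by positivity) hest
    rw [ENNReal.toReal_add hG.ne hU.ne, ENNReal.toReal_mul, ENNReal.toReal_ofReal hb.le] at h1
    rw [W.norm_covGrad, Lp.norm_def, eLpNorm_congr_ae ((W.covGradOf_ae_eq hw hW).trans eg),
      eLpNorm_congr_ae hW, Lp.norm_def]
    exact h1

/-- The extension operator. -/
theorem exists_extensionOperator [Fact (1 ≤ p)] (hp : 1 < p) (hB : ContDiff ℝ 1 B)
    (hAB : EqOn B A (closedHalfSpace d)) {b : ℝ} (hb : 0 < b) (hβ : FieldBound B (b ^ 2)) :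
    ∃ Ext : MagneticFractional (tangential A) (1 - 1 / p) p →L[ℂ] MagneticSobolev A p,
      ∀ u, IsTrace B p (Ext u).toLp u.toLp ∧ ‖(Ext u).covGrad‖ + b * ‖(Ext u).toLp‖
        ≤ extendRealConst d p * (u.seminorm + b ^ (1 - 1 / p) * ‖u.toLp‖) := by
  choose f hf hf' hf'' using exists_extension_element (p := p) hp hB hAB hb hβ
  have hq : 1 ≤ ENNReal.ofReal p := by simpa using hp.le
  have hul : ∀ u : MagneticFractional (tangential A) (1 - 1 / p) p, LocallyIntegrable u.toLp :=
    fun u => (Lp.memLp u.toLp).locallyIntegrable hq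
  let L : MagneticFractional (tangential A) (1 - 1 / p) p →ₗ[ℂ] MagneticSobolev A p :=
    { toFun := f
      map_add' := fun u v => by
        refine MagneticSobolev.toLp_injective (Lp.ext ?_)
        rw [map_add]
        have e : extend B b (u + v).toLp = extend B b (u.toLp + v.toLp) := by
          rw [map_add]
          exact extend_congr (Lp.coeFn_add _ _) b
        filter_upwards [hf (u + v), hf u, hf v, Lp.coeFn_add (f u).toLp (f v).toLp,
          extend_add hB (hul u) (hul v) b] with X a1 a2 a3 a4 a5
        rw [a1, a4, Pi.add_apply, a2, a3, e, a5, Pi.add_apply]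
      map_smul' := fun c u => by
        refine MagneticSobolev.toLp_injective (Lp.ext ?_)
        rw [RingHom.id_apply, map_smul]
        have e : extend B b (c • u).toLp = extend B b (c • ⇑u.toLp) := by
          rw [map_smul]
          exact extend_congr (Lp.coeFn_smul _ _) b
        filter_upwards [hf (c • u), hf u, Lp.coeFn_smul c (f u).toLp] with X a1 a2 a3
        rw [a1, a3, Pi.smul_apply, a2, e, extend_smul, Pi.smul_apply] }
  have hC : 0 ≤ extendRealConst d p := ENNReal.toReal_nonneg
  have hr : 0 ≤ b ^ (1 - 1 / p) := by positivity
  refine ⟨L.mkContinuous ((1 + b⁻¹) * (extendRealConst d p * (1 + b ^ (1 - 1 / p)))) fun u => ?_,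
    fun u => ⟨hf' u, hf'' u⟩⟩
  have n1 := (MagneticSobolev.norm_bounds hp (f u)).1
  obtain ⟨-, n2, n3⟩ := MagneticFractional.norm_bounds hp u
  have h1 := hf'' u
  set R := extendRealConst d p * (u.seminorm + b ^ (1 - 1 / p) * ‖u.toLp‖)
  have hR : R ≤ extendRealConst d p * ((1 + b ^ (1 - 1 / p)) * ‖u‖) := by
    refine mul_le_mul_of_nonneg_left ?_ hC
    nlinarith
  have h2 : ‖(f u).covGrad‖ ≤ R := (le_add_of_nonneg_right (by positivity)).trans h1
  -- The estimate controls `b ‖U‖` only, so the operator norm bound involves `b⁻¹`. This is where a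
  -- strictly positive `β` is used for continuity.
  have h3 : ‖(f u).toLp‖ ≤ b⁻¹ * R := by
    rw [← div_eq_inv_mul, le_div_iff₀' hb]
    exact (le_add_of_nonneg_left (norm_nonneg _)).trans h1
  calc ‖f u‖ ≤ (1 + b⁻¹) * R := by linarith
    _ ≤ (1 + b⁻¹) * (extendRealConst d p * ((1 + b ^ (1 - 1 / p)) * ‖u‖)) := by gcongr
    _ = _ := by ring

end main

end MagneticTrace

end


/-! ### The trace theorem -/

theorem mainTheorem1 (d : ℕ) (hd : 1 ≤ d) (p : ℝ) [Fact (1 ≤ p)] (hp : 1 < p) :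
    ∃ C : ℝ, 0 < C ∧
      ∀ A : EuclideanSpace ℝ (Fin (d + 1)) → EuclideanSpace ℝ (Fin (d + 1)),
        ContDiffOn ℝ 1 A (MagneticTrace.closedHalfSpace d) →
        MagneticTrace.magneticFieldNorm A < ⊤ →
        ∃ Tr : MagneticTrace.MagneticSobolev A p →L[ℂ]
            MagneticTrace.MagneticFractional (MagneticTrace.tangential A) (1 - 1 / p) p,
          MagneticTrace.IsRestriction Tr ∧
          (∀ Tr' : MagneticTrace.MagneticSobolev A p →L[ℂ]
              MagneticTrace.MagneticFractional (MagneticTrace.tangential A) (1 - 1 / p) p,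
            MagneticTrace.IsRestriction Tr' → Tr' = Tr) ∧
          Function.Surjective Tr ∧
          (∀ β : ℝ, 0 ≤ β → MagneticTrace.magneticFieldNorm A ≤ ENNReal.ofReal β →
            ∀ U : MagneticTrace.MagneticSobolev A p,
              (Tr U).seminorm + β ^ (1 / 2 - 1 / (2 * p) : ℝ) * ‖(Tr U).toLp‖
                ≤ C * (‖U.covGrad‖ + β ^ (1 / 2 : ℝ) * ‖U.toLp‖)) ∧
          (∀ β : ℝ, 0 < β → MagneticTrace.magneticFieldNorm A ≤ ENNReal.ofReal β →
            ∃ Ext : MagneticTrace.MagneticFractional (MagneticTrace.tangential A) (1 - 1 / p) p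
                →L[ℂ] MagneticTrace.MagneticSobolev A p,
              (∀ u, Tr (Ext u) = u) ∧
              ∀ u, ‖(Ext u).covGrad‖ + β ^ (1 / 2 : ℝ) * ‖(Ext u).toLp‖
                ≤ C * (u.seminorm + β ^ (1 / 2 - 1 / (2 * p) : ℝ) * ‖u.toLp‖)) := by
  have hc1 : 0 ≤ MagneticTrace.traceRealConst d p := ENNReal.toReal_nonneg
  have hc2 : 0 ≤ MagneticTrace.extendRealConst d p := ENNReal.toReal_nonneg
  -- The summand `1` is the constant of the bound on the `L^p` norm of the trace, added to the one
  -- for its seminorm; it also makes the total positive.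
  refine ⟨MagneticTrace.traceRealConst d p + MagneticTrace.extendRealConst d p + 1,
    by positivity, fun A hA hfin => ?_⟩
  obtain ⟨B, hB, hAB⟩ := MagneticTrace.exists_contDiff_extension hA
  have hfield : ∀ β : ℝ, 0 ≤ β → MagneticTrace.magneticFieldNorm A ≤ ENNReal.ofReal β →
      MagneticTrace.FieldBound B β :=
    fun β hβ h => MagneticTrace.fieldBound_of_magneticFieldNorm_le hB hAB hβ h
  -- The trace operator is built once, with the actual supremum of the field, before any `β` is
  -- given.
  set β₀ := (MagneticTrace.magneticFieldNorm A).toReal with hβ₀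
  have hle₀ : MagneticTrace.magneticFieldNorm A ≤ ENNReal.ofReal β₀ :=
    (ENNReal.ofReal_toReal hfin.ne).ge
  obtain ⟨Tr, hTr⟩ := MagneticTrace.exists_traceOperator (p := p) hd hp hB hAB
    ENNReal.toReal_nonneg (hfield β₀ ENNReal.toReal_nonneg hle₀)
  have hrestr := MagneticTrace.isRestriction_of_isTrace hp hB hAB fun U => (hTr U).1
  have hExt : ∀ β : ℝ, 0 < β → MagneticTrace.magneticFieldNorm A ≤ ENNReal.ofReal β →
      ∃ Ext : MagneticTrace.MagneticFractional (MagneticTrace.tangential A) (1 - 1 / p) p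
          →L[ℂ] MagneticTrace.MagneticSobolev A p,
        (∀ u, Tr (Ext u) = u) ∧
        ∀ u, ‖(Ext u).covGrad‖ + β ^ (1 / 2 : ℝ) * ‖(Ext u).toLp‖
          ≤ (MagneticTrace.traceRealConst d p + MagneticTrace.extendRealConst d p + 1) *
            (u.seminorm + β ^ (1 / 2 - 1 / (2 * p) : ℝ) * ‖u.toLp‖) := by
    intro β hβ h
    have e1 : (β ^ (1 / 2 : ℝ)) ^ 2 = β := by
      rw [← Real.rpow_natCast, ← Real.rpow_mul hβ.le]
      norm_num
    have e2 : (β ^ (1 / 2 : ℝ)) ^ (1 - 1 / p) = β ^ (1 / 2 - 1 / (2 * p) : ℝ) := by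
      rw [← Real.rpow_mul hβ.le]
      congr 1
      have : p ≠ 0 := by linarith
      field_simp
    obtain ⟨Ext, hE⟩ := MagneticTrace.exists_extensionOperator (p := p) hp hB hAB
      (b := β ^ (1 / 2 : ℝ)) (by positivity) (by rw [e1]; exact hfield β hβ.le h)
    refine ⟨Ext, fun u => ?_, fun u => ?_⟩
    -- Both `Tr (Ext u)` and `u` satisfy `IsTrace` for the same function, so they coincide.
    · exact (hTr (Ext u)).1.toLp_eq hp hB.continuous (Lp.memLp _).1 (hE u).1
    · refine (hE u).2.trans ?_
      rw [e2]
      refine mul_le_mul_of_nonneg_right (by linarith) ?_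
      have : 0 ≤ u.seminorm := ENNReal.toReal_nonneg
      positivity
  refine ⟨Tr, hrestr, fun Tr' h' => hrestr.unique hp hB hAB h', fun u => ?_, fun β hβ h U => ?_, hExt⟩
  -- Surjectivity only needs some positive admissible `β`; the maximum with `1` provides one even if
  -- the field vanishes.
  · obtain ⟨Ext, hE, -⟩ := hExt (max β₀ 1) (lt_max_of_lt_right one_pos)
      (hle₀.trans (ENNReal.ofReal_le_ofReal (le_max_left _ _)))
    exact ⟨Ext u, hE u⟩
  · obtain ⟨h1, h2⟩ := (hTr U).2 β hβ (hfield β hβ h)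
    have hR : 0 ≤ ‖U.covGrad‖ + β ^ (1 / 2 : ℝ) * ‖U.toLp‖ := by positivity
    nlinarith
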